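/- **Setting.** Let $\lambda$ be a Dyck path of size $n\ge 0$ and $T$ the planar rooted tree with $n$ edges corresponding to it; the edges of $T$ are the chord pairs $(i,j)$ of $\lambda$ (an up step $i$ together with its matching down step $j$). The edge $(i,j)$ is below $(i',j')$ if $i'<i$ and $j<j'$, and strictly left to $(i',j')$ if $j<i'$. A decreasing label $L$ of $T$ is a bijection from the edges onto $\{1,\dots,n\}$ whose values decrease from the root to the leaves. It contains a $312$-pattern if there are edges $e_1,e_2,e_3$, with $e_1$ strictly right to $e_2$ and $e_2$ strictly right to $e_3$, such that $L(e_2)<L(e_3)<L(e_1)$; otherwise it is $312$-avoiding. Write $L\lessdot L'$ if $L'$ is obtained from $L$ by exchanging the labels of two edges $e_l,e_r$, where $e_l$ is strictly left to $e_r$, $L(e_l)<L(e_r)$, and no edge that is strictly right to $e_l$ and strictly left to $e_r$ has a label in $[L(e_l),L(e_r)]$; let $\le$ be the reflexive transitive closure of $\lessdot$ on decreasing labels. Let $h_L(e)$ be the number of edges that precede $e$ in pre-order and have a smaller label than $e$, and $\mathrm{inv}(L)=\sum_e h_L(e)$. Put $$Z(L_0,T)=\sum_{L\ge L_0}q^{\mathrm{inv}(L)}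 .$$ A Dyck tile of size $m$ is a ribbon of $2m+1$ unit boxes whose centres form a Dyck path of size $m$; its weight is $m+1$, and it is trivial if $m=0$. A Dyck tiling $D$ above $\lambda$ is a tiling by Dyck tiles of the region between $\lambda$ and a Dyck path $\mu$ above $\lambda$ which is cover-inclusive: each tile, moved straight downward by one box, is contained in another tile or lies below $\lambda$. Its weight $\mathrm{wt}(D)$ is the sum of the weights of its tiles; $D$ is trivial if all its tiles are trivial. The Hermite history of $D$ associates to each up step $u$ of $\lambda$ a line: it starts at $u$, or, as long as the tile on the upper left side of the current up step is one whose right-most south-east edge is elsewhere, at the up step straight above; from there it passes through successive tiles, each from its right-most south-east edge to its left-most north-west edge. The label of $D$ is the decreasing label $L$ such that, for each edge $e$, $h_L(e)$ is the sum of the weights of the tiles in the line associated to the up step of $e$. For a trivial Dyck tiling $D_0$, let $u_1,\dots,u_n$ be the up steps of $\lambda$ from the last one to the first one, $x(u_i)$ the number of down steps before $u_i$, and $\mu_i$ the number of tiles in the line associated to $u_i$. Put $c_1=(0,0)$, $c_{i+1}=c_i+(1,1)+(x(u_i)-x(u_{i+1}),0)$, $d_i=c_i-(0,1)+(\mu_i,0)$,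 and $$Y=q^{-\sum_{i}(i-1)\mu_i}\,\det\bigl(\mathrm{wt}(c_i\to d_j)\bigr)_{1\le i,j\le n},$$ where $\mathrm{wt}(c\to d)$ is the sum, over all lattice paths from $c$ to $d$ with right and down steps, of the product of $q^{y(r)+1}$ over the right steps $r$ of the path, $y(r)$ being the height of $r$. **Proposition.** Let $L_0$ be a $312$-avoiding decreasing label of $T$. There is exactly one Dyck tiling $D_0$ above $\lambda$ with label $L_0$, and $D_0$ is trivial. Let $Y(L_0,T)$ be the determinant $Y$ of $D_0$ and $W(L_0,T):=Z(L_0,T)-Y(L_0,T)$. Then $W(L_0,T)\in\mathbb{N}[q]$. Moreover, $W(L_0,T)$ is the generating function $\sum_D q^{\mathrm{wt}(D)}$ of the (finitely many) Dyck tilings $D$ above $\lambda$ that have a label $L\ge L_0$ and contain at least one non-trivial Dyck tile, and the label of each of these tilings contains at least one $312$-pattern. -/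

import Mathlib

open DyckStep LaurentPolynomial

noncomputable section

/-! ### Dyck paths, planar rooted trees and decreasing labels

A planar rooted tree with `n` edges is identified with a Dyck path of size `n` (`DyckWord`, steps
`U` and `D`); its edges are the chord pairs of the path. -/

/-- The steps `i, i + 1, ..., j` of a path. -/
def DyckWord.segment (w : DyckWord) (i j : ℕ) : List DyckStep :=
  (w.toList.drop i).take (j + 1 - i)

/-- `(i, j)` is a balanced pair: the step `i` is `U`, and there are as many `U` as `D` among the
steps `i, ..., j`. -/
def DyckWord.IsBalancedPair (w : DyckWord) (i j : ℕ) : Prop :=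
  w.toList[i]? = some U ∧ (w.segment i j).count U = (w.segment i j).count D

/-- `(i, j)` is a chord pair: the step `j` is `D`, and `i` is the maximal index `i < j` for which
`(i, j)` is balanced. (Steps are numbered from `0`.) -/
def DyckWord.IsChordPair (w : DyckWord) (i j : ℕ) : Prop :=
  w.toList[j]? = some D ∧ i < j ∧ w.IsBalancedPair i j ∧
    ∀ k, i < k → k < j → ¬ w.IsBalancedPair k j

/-- The edges of the planar rooted tree of the Dyck path `w`. -/
def TreeEdge (w : DyckWord) : Type :=
  {c : Fin w.toList.length × Fin w.toList.length // w.IsChordPair c.1 c.2}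

namespace TreeEdge

variable {w : DyckWord}

open Classical in
instance : Fintype (TreeEdge w) :=
  inferInstanceAs
    (Fintype {c : Fin w.toList.length × Fin w.toList.length // w.IsChordPair c.1 c.2})

open Classical in
instance : DecidableEq (TreeEdge w) := inferInstance

/-- The position of the up step of the chord. -/
def opening (e : TreeEdge w) : ℕ := e.1.1

/-- The position of the down step of the chord. -/
def closing (e : TreeEdge w) : ℕ := e.1.2

/-- The edge `e` is a proper descendant of the edge `f`, i.e. `f ≠ e` lies between `e` and the
root. -/
def IsBelow (e f : TreeEdge w) : Prop := f.opening < e.opening ∧ e.closing < f.closing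

/-- The edge `e` is strictly left to the edge `f`. -/
def StrictlyLeft (e f : TreeEdge w) : Prop := e.closing < f.opening

/-- The number of up steps before the up step of `e`. -/
def row (e : TreeEdge w) : ℕ := (w.toList.take e.opening).count U

end TreeEdge

/-- Decreasing labels of the tree of `w`: bijections from the edges to an `n`-element chain (the
labels `1, ..., n` are written as `0, ..., n - 1`) that decrease from the root to the leaves. -/
def DecreasingLabel (w : DyckWord) : Type :=
  {L : TreeEdge w ≃ Fin w.semilength // ∀ e f : TreeEdge w, e.IsBelow f → L e < L f}

namespace DecreasingLabel

variable {w : DyckWord}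

instance : CoeFun (DecreasingLabel w) (fun _ => TreeEdge w → Fin w.semilength) :=
  ⟨fun L => L.1⟩

open Classical in
instance : Fintype (DecreasingLabel w) :=
  inferInstanceAs
    (Fintype {L : TreeEdge w ≃ Fin w.semilength // ∀ e f : TreeEdge w, e.IsBelow f → L e < L f})

/-- The label contains a `312`-pattern: edges `e₁, e₂, e₃`, each strictly right to the next one,
with `L e₂ < L e₃ < L e₁`. -/
def Contains312 (L : DecreasingLabel w) : Prop :=
  ∃ e₁ e₂ e₃ : TreeEdge w, e₂.StrictlyLeft e₁ ∧ e₃.StrictlyLeft e₂ ∧ L e₂ < L e₃ ∧ L e₃ < L e₁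

/-- The covering relation: `L'` arises from `L` by exchanging the labels of an edge `l` and of an
edge `r` strictly right to it, where `L l < L r` and no edge strictly between them has a label in
`[L l, L r]`. -/
def CoveredBy (L L' : DecreasingLabel w) : Prop :=
  ∃ l r : TreeEdge w, l.StrictlyLeft r ∧
    (∀ e, e ≠ l → e ≠ r → L e = L' e) ∧
    L l < L r ∧ L' r = L l ∧ L' l = L r ∧
    ¬ ∃ c : TreeEdge w, l.StrictlyLeft c ∧ c.StrictlyLeft r ∧ L c ∈ Set.Icc (L l) (L r)

/-- The order of the poset of labels: `L ≤ L'` if `L'` is reached from `L` by finitely many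
covers. -/
def Le (L L' : DecreasingLabel w) : Prop := Relation.ReflTransGen CoveredBy L L'

open Classical in
/-- The entry at the edge `e` of the Lehmer code of the label: the number of smaller labels before
`e` in the pre-order word read from left to right (equivalently, after `e` in the post-order word
read from right to left). -/
def code (L : DecreasingLabel w) (e : TreeEdge w) : ℕ :=
  (Finset.univ.filter fun f : TreeEdge w => f.opening < e.opening ∧ L f < L e).card

/-- The inversion number `∑ᵢ #{j < i : ωⱼ < ωᵢ}` of the pre-order word `ω` of the label. -/
def inv (L : DecreasingLabel w) : ℕ := ∑ e : TreeEdge w, L.code e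

open Classical in
/-- The generating function `Z(L, T)` of the labels above `L`. -/
def Z (L : DecreasingLabel w) : ℤ[T;T⁻¹] :=
  ∑ L' ∈ Finset.univ.filter (fun L' : DecreasingLabel w => L.Le L'), T (L'.inv : ℤ)

end DecreasingLabel

/-! ### Cover-inclusive Dyck tilings

Paths are drawn in the plane with `U = (0, 1)` and `D = (1, 0)` (the usual picture, rotated by 45
degrees clockwise). The unit box `[d, d + 1] × [u, u + 1]` is denoted by `(d, u)`, and the unit up
step from `(d, u)` to `(d, u + 1)` also by `(d, u)`. In the usual picture, the translation by
`(1, -1)` moves straight downward. -/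

open Classical in
/-- The number of down steps before the up step number `r` (counted from `0`), i.e. the
`x`-coordinate of this up step. -/
def DyckWord.upCol (w : DyckWord) (r : ℕ) : ℕ :=
  (Finset.univ.filter fun j : Fin w.toList.length =>
    w.toList[j] = D ∧ (w.toList.take j).count U ≤ r).card

/-- The box `b` lies above the path `w`: it is to the left of the up step of `w` in its row. -/
def DyckWord.BoxAbove (w : DyckWord) (b : ℤ × ℤ) : Prop :=
  ∃ r : ℕ, r < w.semilength ∧ b.2 = r ∧ b.1 < w.upCol r

/-- A Dyck tile: a ribbon of boxes which form a Dyck path that starts at the box `start`. -/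
structure DyckTile where
  start : ℤ × ℤ
  path : DyckWord

namespace DyckTile

/-- The boxes of the tile. -/
def boxes (t : DyckTile) : Set (ℤ × ℤ) :=
  {b | ∃ k ≤ t.path.toList.length,
    b = t.start + (((t.path.toList.take k).count D : ℤ), ((t.path.toList.take k).count U : ℤ))}

/-- The size of the tile. -/
def size (t : DyckTile) : ℕ := t.path.semilength

/-- The weight of the tile. -/
def weight (t : DyckTile) : ℕ := t.size + 1

/-- The left-most north-west edge of the tile (in the usual picture), i.e. the left side of its
first box. -/
def exitEdge (t : DyckTile) : ℤ × ℤ := t.start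

/-- The right-most south-east edge of the tile (in the usual picture), i.e. the right side of its
last box. -/
def entryEdge (t : DyckTile) : ℤ × ℤ := t.start + ((t.size : ℤ) + 1, (t.size : ℤ))

end DyckTile

/-- The cover-inclusive Dyck tilings above the Dyck path `w`. -/
structure DyckTiling (w : DyckWord) where
  /-- The top path. -/
  top : DyckWord
  /-- The tiles. -/
  tiles : Finset DyckTile
  semilength_top : top.semilength = w.semilength
  top_above : ∀ k, (w.toList.take k).count U ≤ (top.toList.take k).count U
  disjoint : (tiles : Set DyckTile).PairwiseDisjoint DyckTile.boxes
  union : (⋃ t ∈ tiles, t.boxes) = {b | w.BoxAbove b ∧ ¬ top.BoxAbove b}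
  /-- A tile that is moved straight downward is contained in another tile or is below `w`. -/
  cover_inclusive : ∀ t ∈ tiles,
    (∃ t' ∈ tiles, ∀ b ∈ t.boxes, b + (1, -1) ∈ t'.boxes) ∨
      ∀ b ∈ t.boxes, ¬ w.BoxAbove (b + (1, -1))

namespace DyckTiling

variable {w : DyckWord}

/-- The tiling has only trivial tiles, i.e. tiles of size zero. -/
def IsTrivial (D : DyckTiling w) : Prop := ∀ t ∈ D.tiles, t.size = 0

/-- The weight of the tiling. -/
def weight (D : DyckTiling w) : ℕ := ∑ t ∈ D.tiles, t.weight

/-- The box to the left of the up step `v` is in a tile which is not entered at `v` (so that the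
line in this tile belongs to another up step), and `v'` is straight above `v`. -/
def Lift (D : DyckTiling w) (v v' : ℤ × ℤ) : Prop :=
  (∃ t ∈ D.tiles, v + (-1, 0) ∈ t.boxes ∧ t.entryEdge ≠ v) ∧ v' = v + (-1, 1)

/-- A tile is entered at `v` and left at `v'`. -/
def Cross (D : DyckTiling w) (v v' : ℤ × ℤ) : Prop :=
  ∃ t ∈ D.tiles, t.entryEdge = v ∧ t.exitEdge = v'

/-- The line of the Hermite history that is associated to the up step `v` of `w` passes through the
tile `t`: the line starts at the first point straight above `v` where no tile is in its way, and
then passes through tiles from the south-east edge to the left-most north-west edge. -/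
def LineMeets (D : DyckTiling w) (v : ℤ × ℤ) (t : DyckTile) : Prop :=
  ∃ v', Relation.ReflTransGen D.Lift v v' ∧ Relation.ReflTransGen D.Cross v' t.entryEdge

open Classical in
/-- The tiles in the line of the Hermite history associated to the up step number `r` of `w`. -/
def lineTiles (D : DyckTiling w) (r : ℕ) : Finset DyckTile :=
  D.tiles.filter fun t => D.LineMeets ((w.upCol r : ℤ), (r : ℤ)) t

/-- `L` is the decreasing label of the tiling `D`: its Lehmer code is the Hermite history of `D`,
which assigns to each up step the sum of the weights of the tiles in its line. -/
def HasLabel (D : DyckTiling w) (L : DecreasingLabel w) : Prop :=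
  ∀ e : TreeEdge w, L.code e = ∑ t ∈ D.lineTiles e.row, t.weight

end DyckTiling

/-! ### The Lindström–Gessel–Viennot determinant -/

/-- Steps of right-down lattice paths. -/
inductive RDStep
  | right
  | down

/-- All lattice paths with `a` right steps and `b` down steps. -/
def rdPaths : ℕ → ℕ → List (List RDStep)
  | 0, 0 => [[]]
  | a + 1, 0 => (rdPaths a 0).map (RDStep.right :: ·)
  | 0, b + 1 => (rdPaths 0 b).map (RDStep.down :: ·)
  | a + 1, b + 1 =>
    (rdPaths a (b + 1)).map (RDStep.right :: ·) ++ (rdPaths (a + 1) b).map (RDStep.down :: ·)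

/-- The weight of a lattice path that starts at height `y`: the product of `q ^ (y(r) + 1)` over
its right steps `r`. -/
def rdWeight : ℤ → List RDStep → ℤ[T;T⁻¹]
  | _, [] => 1
  | y, RDStep.right :: p => T (y + 1) * rdWeight y p
  | y, RDStep.down :: p => rdWeight (y - 1) p

open Classical in
/-- The sum of the weights of all right-down lattice paths from `a` to `b`. -/
def rdWeightSum (a b : ℤ × ℤ) : ℤ[T;T⁻¹] :=
  if a.1 ≤ b.1 ∧ b.2 ≤ a.2 then
    ((rdPaths (b.1 - a.1).toNat (a.2 - b.2).toNat).map (rdWeight a.2)).sum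
  else 0

namespace DyckTiling

variable {w : DyckWord}

/-- The `x`-coordinate of the up step number `i` (from `0`) of `w`, counted from the top. -/
def stepX (w : DyckWord) (i : ℕ) : ℤ := w.upCol (w.semilength - 1 - i)

/-- The number of tiles associated to the up step number `i` (from `0`), counted from the top. -/
def stepTiles (D : DyckTiling w) (i : ℕ) : ℕ := (D.lineTiles (w.semilength - 1 - i)).card

/-- The starting points of the lattice paths. -/
def source (w : DyckWord) : ℕ → ℤ × ℤ
  | 0 => (0, 0)
  | i + 1 => source w i + (1, 1) + (stepX w i - stepX w (i + 1), 0)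

/-- The end points of the lattice paths. -/
def sink (D : DyckTiling w) (i : ℕ) : ℤ × ℤ := source w i - (0, 1) + ((D.stepTiles i : ℤ), 0)

/-- The normalized determinant `Y` of the tiling (used for tilings with only trivial tiles). -/
def Y (D : DyckTiling w) : ℤ[T;T⁻¹] :=
  T (-∑ i : Fin w.semilength, ((i : ℕ) : ℤ) * D.stepTiles i) *
    (Matrix.of fun i j : Fin w.semilength => rdWeightSum (source w i) (D.sink j)).det

/-- The tilings with at least one non-trivial tile whose label is in the poset of labels with
minimal element `L₀`. -/
def nontrivialAbove (L₀ : DecreasingLabel w) : Set (DyckTiling w) :=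
  {D | ¬ D.IsTrivial ∧ ∃ L : DecreasingLabel w, D.HasLabel L ∧ L₀.Le L}

/-- `W = Z - Y`, for the label `L₀` and its tiling `D₀`. -/
def W (L₀ : DecreasingLabel w) (D₀ : DyckTiling w) : ℤ[T;T⁻¹] := L₀.Z - D₀.Y

end DyckTiling

end

/-! Everything is reduced to Lehmer codes. A label is determined by its code (`code_injective`), and
`inv` is the sum of the code; so both `Z` and `Y` can be read as sums over codes.

Tilings. Cover-inclusiveness forces every tile into one layer, a copy of `λ` shifted straight up,
and two boxes joined in one layer are joined in all lower layers. A tiling is therefore a top word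
together with the numbers `J k` of joined layers (`TilingData`). Labels and tilings correspond
bijectively (`existsUnique_hasLabel`), by induction on the number of edges. The smallest label sits
at a leaf, that is, a peak of `λ`. Inserting a peak stretches all tiles above its position and adds
single boxes further right; this gives the new up step an empty line, adds one to every line to its
right and leaves the other lines alone (`spread`, `exists_eq_spread`). Inserting a smallest label
has the same effect on the code (`HasWordLabel.spread`). Summing the lines gives `weight_eq_inv`.

Patterns. Boxes above a position come from an ascent between a chord closed before it and an up step
after it (`exists_ascent_of_gap_pos`). A non-trivial tile appears only when a peak is inserted under
existing boxes, and the smallest label placed inside such an ascent makes a `312`-pattern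
(`exists_pattern_of_joint_pos`). So the tiling of a `312`-avoiding label is trivial.

Trivial tilings. When all tiles are single boxes, `leftCount - code` is the `x`-coordinate of the up
step of the top path in the row of the edge. Hence a tiling is trivial exactly when this difference
weakly increases in pre-order, which is `RowMonotone` (`isTrivial_ofLabel_iff`). If `L₀` avoids
`312`, codes only decrease above it (`code_le_of_le`), and conversely every row monotone sequence
below its code is the code of a label above it (`exists_le_code_eq`).

Determinant. The matrix is, up to monomial factors in rows and columns, lower Hessenberg, and its
determinant enumerates the increasing sequences between two bounds (`det_rdWeightSum`). These are
shifted row monotone sequences below the code of `L₀`. So `Y` sums `q ^ inv` over the labels above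
`L₀` with a trivial tiling (`Y_eq`), and `W` sums it over the remaining ones. -/

/-! ### Words and their heights -/

/-- The number of up steps among the first `k` steps of the word `a`. -/
def upCount (a : ℕ → Bool) : ℕ → ℕ
  | 0 => 0
  | k + 1 => upCount a k + if a k then 1 else 0

/-- The height of the word `a` after `k` steps. -/
def ht (a : ℕ → Bool) (k : ℕ) : ℤ := 2 * (upCount a k : ℤ) - k

/-- Insert a peak at the position `s`. -/
def insertPeak (s : ℕ) (a : ℕ → Bool) (k : ℕ) : Bool :=
  if k < s then a k else if k = s then true else if k = s + 1 then false else a (k - 2)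

/-- Insert an up step at the position `s`. -/
def insertUp (s : ℕ) (b : ℕ → Bool) (k : ℕ) : Bool :=
  if k < s then b k else if k = s then true else b (k - 1)

/-- Insert the value `m` twice at the position `s`. -/
def insertTwice (s m : ℕ) (J : ℕ → ℕ) (k : ℕ) : ℕ :=
  if k < s then J k else if k ≤ s + 1 then m else J (k - 2)

/-- Delete the entries `s` and `s + 1`. -/
def deleteTwo {α : Type*} (s : ℕ) (a : ℕ → α) (k : ℕ) : α := if k < s then a k else a (k + 2)

/-- The number of boxes above the position `k` that lie between the words `a` and `b`. -/
def gap (a b : ℕ → Bool) (k : ℕ) : ℕ := upCount b k - upCount a k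

section Words

variable {a b : ℕ → Bool} {s k : ℕ}

@[simp] theorem upCount_zero : upCount a 0 = 0 := rfl

theorem upCount_succ : upCount a (k + 1) = upCount a k + if a k then 1 else 0 := rfl

theorem upCount_congr (h : ∀ i < k, a i = b i) : upCount a k = upCount b k := by
  induction k with
  | zero => rfl
  | succ k ih => rw [upCount_succ, upCount_succ, ih fun i hi => h i (by omega), h k (by omega)]

theorem upCount_mono : Monotone (upCount a) :=
  monotone_nat_of_le_succ fun k => by rw [upCount_succ]; omega

theorem upCount_le (k : ℕ) : upCount a k ≤ k := by
  induction k with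
  | zero => rfl
  | succ k ih => rw [upCount_succ]; split_ifs <;> omega

theorem insertPeak_of_lt (h : k < s) : insertPeak s a k = a k := by simp [insertPeak, h]

@[simp] theorem insertPeak_self : insertPeak s a s = true := by simp [insertPeak]

@[simp] theorem insertPeak_succ : insertPeak s a (s + 1) = false := by simp [insertPeak]

theorem insertPeak_add_two (h : s ≤ k) : insertPeak s a (k + 2) = a k := by
  simp only [insertPeak]
  rw [if_neg (by omega), if_neg (by omega), if_neg (by omega)]; rfl

theorem insertUp_of_lt (h : k < s) : insertUp s b k = b k := by simp [insertUp, h]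

@[simp] theorem insertUp_self : insertUp s b s = true := by simp [insertUp]

theorem insertUp_succ (h : s ≤ k) : insertUp s b (k + 1) = b k := by
  simp only [insertUp]
  rw [if_neg (by omega), if_neg (by omega)]; rfl

theorem insertTwice_of_lt {m : ℕ} {J : ℕ → ℕ} (h : k < s) : insertTwice s m J k = J k := by
  simp [insertTwice, h]

@[simp] theorem insertTwice_self {m : ℕ} {J : ℕ → ℕ} : insertTwice s m J s = m := by
  simp [insertTwice]

@[simp] theorem insertTwice_succ {m : ℕ} {J : ℕ → ℕ} : insertTwice s m J (s + 1) = m := by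
  simp [insertTwice]

theorem insertTwice_add_two {m : ℕ} {J : ℕ → ℕ} (h : s ≤ k) :
    insertTwice s m J (k + 2) = J k := by
  simp only [insertTwice]
  rw [if_neg (by omega), if_neg (by omega)]; rfl

theorem deleteTwo_of_lt {α : Type*} {c : ℕ → α} (h : k < s) : deleteTwo s c k = c k := by
  simp [deleteTwo, h]

theorem deleteTwo_of_le {α : Type*} {c : ℕ → α} (h : s ≤ k) : deleteTwo s c k = c (k + 2) := by
  simp [deleteTwo, h]

theorem upCount_insertPeak_of_le (h : k ≤ s) : upCount (insertPeak s a) k = upCount a k :=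
  upCount_congr fun i hi => insertPeak_of_lt (by omega)

theorem upCount_insertPeak_succ : upCount (insertPeak s a) (s + 1) = upCount a s + 1 := by
  rw [upCount_succ, upCount_insertPeak_of_le le_rfl]; simp

theorem upCount_insertPeak_add_two (h : s ≤ k) :
    upCount (insertPeak s a) (k + 2) = upCount a k + 1 := by
  induction k, h using Nat.le_induction with
  | base => rw [upCount_succ, upCount_insertPeak_succ]; simp
  | succ k hk ih =>
    rw [show k + 1 + 2 = (k + 2) + 1 from rfl, upCount_succ, ih, insertPeak_add_two hk,
      upCount_succ]; omega

theorem upCount_insertUp_of_le (h : k ≤ s) : upCount (insertUp s b) k = upCount b k :=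
  upCount_congr fun i hi => insertUp_of_lt (by omega)

theorem upCount_insertUp_succ (h : s ≤ k) :
    upCount (insertUp s b) (k + 1) = upCount b k + 1 := by
  induction k, h using Nat.le_induction with
  | base => rw [upCount_succ, upCount_insertUp_of_le le_rfl]; simp
  | succ k hk ih => rw [upCount_succ, ih, insertUp_succ hk, upCount_succ]; omega

theorem ht_insertPeak_of_le (h : k ≤ s) : ht (insertPeak s a) k = ht a k := by
  rw [ht, upCount_insertPeak_of_le h, ht]

theorem ht_insertPeak_succ : ht (insertPeak s a) (s + 1) = ht a s + 1 := by
  rw [ht, upCount_insertPeak_succ, ht]; push_cast; ring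

theorem ht_insertPeak_add_two (h : s ≤ k) : ht (insertPeak s a) (k + 2) = ht a k := by
  rw [ht, upCount_insertPeak_add_two h, ht]; push_cast; ring

theorem ht_succ_up (h : a k = true) : ht a (k + 1) = ht a k + 1 := by
  simp only [ht, upCount_succ, h]; push_cast; ring

theorem ht_succ_down (h : a k = false) : ht a (k + 1) = ht a k - 1 := by
  simp only [ht, upCount_succ, h]; push_cast; ring

theorem insertPeak_deleteTwo (h : a s = true) (h' : a (s + 1) = false) :
    insertPeak s (deleteTwo s a) = a := by
  funext k
  rcases lt_or_ge k s with hk | hk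
  · rw [insertPeak_of_lt hk, deleteTwo_of_lt hk]
  · obtain ⟨i, rfl⟩ := Nat.exists_eq_add_of_le hk
    match i with
    | 0 => simpa using h.symm
    | 1 => simpa using h'.symm
    | i + 2 =>
      rw [show s + (i + 2) = (s + i) + 2 by ring, insertPeak_add_two (by omega),
        deleteTwo_of_le (by omega)]

end Words

/-! ### Layered description of Dyck tilings -/

/-- A tiling of the region between the words `a` and `b` is described by the number `J k` of layers
in which the boxes above the positions `k` and `k + 1` belong to the same tile. -/
structure TilingData (a b : ℕ → Bool) (J : ℕ → ℕ) : Prop where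
  eventually_eq : ∃ N, ∀ k, N ≤ k → a k = false ∧ b k = false ∧ upCount a k = upCount b k
  above : ∀ k, upCount a k ≤ upCount b k
  joint_left : ∀ k, J k + upCount a k ≤ upCount b k
  joint_right : ∀ k, J k + upCount a (k + 1) ≤ upCount b (k + 1)
  -- A maximal run of joints in layer `j` glues the boxes above `p + 1, ..., r` into one tile, so
  -- the word between `p + 1` and `r` has to be a Dyck path. For `r = p + 1` this is a single box
  -- and the condition is void.
  run : ∀ j p r, p < r → J p ≤ j → J r ≤ j → (∀ k, p < k → k < r → j < J k) →
    ht a (p + 1) = ht a r ∧ ∀ k, p < k → k ≤ r → ht a (p + 1) ≤ ht a k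

/-- The weight of the part to the left of the position `k` of the line which passes through the
layer `j` there. -/
def lineWt (a b : ℕ → Bool) (J : ℕ → ℕ) : ℕ → ℕ → ℕ
  | 0, _ => 0
  | k + 1, j =>
    if gap a b (k + 1) ≤ j then 0
    -- Inside a tile up steps are free and down steps cost one. The step that leaves the tile also
    -- costs one, and raises the layer if it is an up step. A tile of size `m` thus contributes `m +
    -- 1`.
    else if a k then (if j < J k then lineWt a b J k j else 1 + lineWt a b J k (j + 1))
    else 1 + lineWt a b J k j

theorem lineWt_eq_zero {a b : ℕ → Bool} {J : ℕ → ℕ} {k j : ℕ} (h : gap a b k ≤ j) :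
    lineWt a b J k j = 0 := by
  cases k with
  | zero => rfl
  | succ k => rw [lineWt, if_pos h]

theorem lineWt_of_down {a b : ℕ → Bool} {J : ℕ → ℕ} {k j : ℕ} (h : j < gap a b (k + 1))
    (hk : a k = false) : lineWt a b J (k + 1) j = 1 + lineWt a b J k j := by
  rw [lineWt, if_neg (by omega), if_neg (by simp [hk])]

theorem lineWt_of_joint {a b : ℕ → Bool} {J : ℕ → ℕ} {k j : ℕ} (h : j < gap a b (k + 1))
    (hk : a k = true) (hj : j < J k) : lineWt a b J (k + 1) j = lineWt a b J k j := by
  rw [lineWt, if_neg (by omega), if_pos hk, if_pos hj]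

theorem lineWt_of_not_joint {a b : ℕ → Bool} {J : ℕ → ℕ} {k j : ℕ} (h : j < gap a b (k + 1))
    (hk : a k = true) (hj : J k ≤ j) :
    lineWt a b J (k + 1) j = 1 + lineWt a b J k (j + 1) := by
  rw [lineWt, if_neg (by omega), if_pos hk, if_neg (by omega)]

namespace TilingData

variable {a b : ℕ → Bool} {J : ℕ → ℕ}

theorem joint_zero (h : TilingData a b J) : J 0 = 0 := by
  have := h.joint_left 0
  simpa using this

theorem joint_le_gap (h : TilingData a b J) (k : ℕ) : J k ≤ gap a b k := by
  have := h.joint_left k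
  unfold gap; omega

theorem joint_le_gap_succ (h : TilingData a b J) (k : ℕ) : J k ≤ gap a b (k + 1) := by
  have := h.joint_right k
  unfold gap; omega

theorem exists_run_end (h : TilingData a b J) (k j : ℕ) :
    ∃ r, k ≤ r ∧ J r ≤ j ∧ ∀ i, k ≤ i → i < r → j < J i := by
  classical
  have hex : ∃ r, k ≤ r ∧ J r ≤ j := by
    obtain ⟨N, hN⟩ := h.eventually_eq
    refine ⟨max k N, le_max_left _ _, ?_⟩
    have := h.joint_left (max k N)
    have := (hN (max k N) (le_max_right _ _)).2.2
    omega
  refine ⟨Nat.find hex, (Nat.find_spec hex).1, (Nat.find_spec hex).2, fun i hi hlt => ?_⟩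
  have := Nat.find_min hex hlt
  omega

theorem exists_run_start (h : TilingData a b J) (k j : ℕ) (hk : 0 < k) :
    ∃ p, p < k ∧ J p ≤ j ∧ ∀ i, p < i → i < k → j < J i := by
  induction k with
  | zero => omega
  | succ k ih =>
    by_cases hj : J k ≤ j
    · exact ⟨k, by omega, hj, fun i hi hlt => by omega⟩
    · rcases Nat.eq_zero_or_pos k with rfl | hk0
      · rw [h.joint_zero] at hj; omega
      · obtain ⟨p, hp, hJ, hi⟩ := ih hk0
        refine ⟨p, by omega, hJ, fun i h1 h2 => ?_⟩
        rcases Nat.lt_succ_iff_lt_or_eq.1 h2 with h3 | rfl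
        · exact hi i h1 h3
        · omega

/-- Otherwise, in layer `J (k + 1)`, a tile would end with the up step `k`, which no Dyck path does.
-/
theorem joint_le_of_up (h : TilingData a b J) {k : ℕ} (hk : a k = true) : J k ≤ J (k + 1) := by
  by_contra hlt
  have hk0 : 0 < k := by
    rcases Nat.eq_zero_or_pos k with rfl | hk0
    · rw [h.joint_zero] at hlt; omega
    · exact hk0
  obtain ⟨p, hp, hJ, hi⟩ := h.exists_run_start k (J (k + 1)) hk0
  obtain ⟨h1, h2⟩ := h.run (J (k + 1)) p (k + 1) (by omega) hJ le_rfl fun i hi1 hi2 => by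
    rcases Nat.lt_succ_iff_lt_or_eq.1 hi2 with h3 | rfl
    · exact hi i hi1 h3
    · omega
  have h3 := h2 k hp (by omega)
  have := ht_succ_up hk
  omega

/-- Otherwise, in layer `J k`, a tile would begin with the down step `k + 1`. -/
theorem joint_le_of_down (h : TilingData a b J) {k : ℕ} (hk : a (k + 1) = false) :
    J (k + 1) ≤ J k := by
  by_contra hlt
  obtain ⟨r, hr, hJ, hi⟩ := h.exists_run_end (k + 1) (J k)
  have hr' : k + 1 ≠ r := by rintro rfl; omega
  obtain ⟨h1, h2⟩ := h.run (J k) k r (by omega) le_rfl hJ fun i hi1 hi2 => hi i hi1 hi2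
  have h3 := h2 (k + 2) (by omega) (by omega)
  have := ht_succ_down hk
  rw [show k + 2 = k + 1 + 1 from rfl] at h3
  omega

/-- Following joints for free keeps the line inside the region, and there is no box above position
`0`, so the line must pay somewhere. -/
theorem lineWt_pos (h : TilingData a b J) {k j : ℕ} (hj : j < gap a b k) :
    0 < lineWt a b J k j := by
  induction k with
  | zero => simp [gap] at hj
  | succ k ih =>
    rw [lineWt, if_neg (by omega)]
    split_ifs with h1 h2
    · exact ih (by have := h.joint_le_gap k; omega)
    · omega
    · omega

/-- Spreading a tiling: a peak is inserted at the position `s`. -/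
theorem spread (h : TilingData a b J) (s : ℕ) :
    TilingData (insertPeak s a) (insertUp s b) (insertTwice s (gap a b s) J) := by
  have hs := h.above s
  have hg : gap a b s + upCount a s = upCount b s := by unfold gap; omega
  have hcases : ∀ k, k < s ∨ k = s ∨ k = s + 1 ∨ ∃ i, s ≤ i ∧ k = i + 2 := fun k => by
    rcases lt_or_ge k s with h1 | h1
    · exact Or.inl h1
    · rcases Nat.lt_or_ge k (s + 2) with h2 | h2
      · omega
      · exact Or.inr (Or.inr (Or.inr ⟨k - 2, by omega, by omega⟩))
  have hb2 : ∀ i, s ≤ i → upCount (insertUp s b) (i + 2) = upCount b (i + 1) + 1 := fun i hi =>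
    upCount_insertUp_succ (by omega)
  have hb1 : upCount (insertUp s b) (s + 1) = upCount b s + 1 := upCount_insertUp_succ le_rfl
  constructor
  · obtain ⟨N, hN⟩ := h.eventually_eq
    refine ⟨max N s + 2, fun k hk => ?_⟩
    obtain ⟨i, rfl⟩ : ∃ i, k = i + 2 := ⟨k - 2, by omega⟩
    have hi : max N s ≤ i := by omega
    have hi1 : s ≤ i := by omega
    obtain ⟨h1, h2, h3⟩ := hN i (by omega)
    obtain ⟨h4, h5, h6⟩ := hN (i + 1) (by omega)
    refine ⟨by rw [insertPeak_add_two hi1, h1], ?_, ?_⟩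
    · rw [show i + 2 = (i + 1) + 1 from rfl, insertUp_succ (by omega), h5]
    · rw [upCount_insertPeak_add_two hi1, hb2 i hi1, ← h6, upCount_succ, h1]; simp
  · intro k
    rcases hcases k with hk | rfl | rfl | ⟨i, hi, rfl⟩
    · rw [upCount_insertPeak_of_le hk.le, upCount_insertUp_of_le hk.le]; exact h.above k
    · rw [upCount_insertPeak_of_le le_rfl, upCount_insertUp_of_le le_rfl]; exact hs
    · rw [upCount_insertPeak_succ, hb1]; omega
    · rw [upCount_insertPeak_add_two hi, hb2 i hi]
      have := h.above i; have := upCount_mono (a := b) (Nat.le_succ i); simp only [Nat.succ_eq_add_one] at this; omega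
  · intro k
    rcases hcases k with hk | rfl | rfl | ⟨i, hi, rfl⟩
    · rw [upCount_insertPeak_of_le hk.le, upCount_insertUp_of_le hk.le, insertTwice_of_lt hk]
      exact h.joint_left k
    · rw [upCount_insertPeak_of_le le_rfl, upCount_insertUp_of_le le_rfl, insertTwice_self]; omega
    · rw [upCount_insertPeak_succ, hb1, insertTwice_succ]; omega
    · rw [upCount_insertPeak_add_two hi, hb2 i hi, insertTwice_add_two hi]
      have := h.joint_left i; have := upCount_mono (a := b) (Nat.le_succ i)
      simp only [Nat.succ_eq_add_one] at this; omega
  · intro k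
    rcases hcases k with hk | rfl | rfl | ⟨i, hi, rfl⟩
    · rw [upCount_insertPeak_of_le (by omega), upCount_insertUp_of_le (by omega),
        insertTwice_of_lt hk]
      exact h.joint_right k
    · rw [upCount_insertPeak_succ, hb1, insertTwice_self]; omega
    · rw [show s + 1 + 1 = s + 2 from rfl, upCount_insertPeak_add_two le_rfl, hb2 s le_rfl,
        insertTwice_succ]
      have := upCount_mono (a := b) (Nat.le_succ s)
      simp only [Nat.succ_eq_add_one] at this; omega
    · rw [show i + 2 + 1 = (i + 1) + 2 from rfl, upCount_insertPeak_add_two (by omega),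
        hb2 (i + 1) (by omega), insertTwice_add_two hi]
      have := h.joint_right i; have := upCount_mono (a := b) (Nat.le_succ (i + 1))
      simp only [Nat.succ_eq_add_one] at this; omega
  -- A run of joints in a layer below `gap a b s` that reaches `s` swallows the whole inserted peak.
  -- In a higher layer, runs are cut at both `s` and `s + 1`. The cases follow the positions of the
  -- two ends.
  · have hJs : J s ≤ gap a b s := h.joint_le_gap s
    intro j p r hpr hp hr hk
    rcases hcases r with h1 | rfl | rfl | ⟨r, h1, rfl⟩
    · rw [insertTwice_of_lt h1] at hr
      rw [insertTwice_of_lt (by omega)] at hp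
      obtain ⟨h2, h3⟩ := h.run j p r hpr hp hr fun k hk1 hk2 => by
        have := hk k hk1 hk2
        rwa [insertTwice_of_lt (by omega)] at this
      rw [ht_insertPeak_of_le (by omega), ht_insertPeak_of_le (by omega)]
      refine ⟨h2, fun k hk1 hk2 => ?_⟩
      rw [ht_insertPeak_of_le (by omega)]; exact h3 k hk1 hk2
    · rw [insertTwice_self] at hr
      rw [insertTwice_of_lt (by omega)] at hp
      obtain ⟨h2, h3⟩ := h.run j p r hpr hp (by omega) fun k hk1 hk2 => by
        have := hk k hk1 hk2
        rwa [insertTwice_of_lt (by omega)] at this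
      rw [ht_insertPeak_of_le (by omega), ht_insertPeak_of_le (by omega)]
      refine ⟨h2, fun k hk1 hk2 => ?_⟩
      rw [ht_insertPeak_of_le (by omega)]; exact h3 k hk1 hk2
    · rw [insertTwice_succ] at hr
      have : p = s := by
        by_contra hne
        have := hk s (by omega) (by omega)
        rw [insertTwice_self] at this; omega
      subst this
      exact ⟨rfl, fun k hk1 hk2 => by rw [show k = p + 1 by omega]⟩
    · rw [insertTwice_add_two h1] at hr
      rcases hcases p with h2 | rfl | rfl | ⟨p, h2, rfl⟩
      · rw [insertTwice_of_lt (by omega)] at hp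
        obtain ⟨h3, h4⟩ := h.run j p r (by omega) hp hr fun k hk1 hk2 => by
          rcases lt_or_ge k s with h5 | h5
          · have := hk k hk1 (by omega)
            rwa [insertTwice_of_lt (by omega)] at this
          · have := hk (k + 2) (by omega) (by omega)
            rwa [insertTwice_add_two h5] at this
        rw [ht_insertPeak_of_le (by omega), ht_insertPeak_add_two h1]
        refine ⟨h3, fun k hk1 hk2 => ?_⟩
        rcases hcases k with h5 | rfl | rfl | ⟨k, h5, rfl⟩
        · rw [ht_insertPeak_of_le (by omega)]; exact h4 k hk1 (by omega)
        · rw [ht_insertPeak_of_le (by omega)]; exact h4 k hk1 (by omega)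
        · rw [ht_insertPeak_succ]; have := h4 s h2 (by omega); omega
        · rw [ht_insertPeak_add_two h5]; exact h4 k (by omega) (by omega)
      · have := hk (p + 1) (by omega) (by omega)
        rw [insertTwice_succ] at this
        rw [insertTwice_self] at hp; omega
      · rw [insertTwice_succ] at hp
        have hkk : ∀ k, s ≤ k → k < r → j < J k := fun k h3 h4 => by
          have := hk (k + 2) (by omega) (by omega)
          rwa [insertTwice_add_two h3] at this
        rw [show s + 1 + 1 = s + 2 from rfl, ht_insertPeak_add_two le_rfl,
          ht_insertPeak_add_two h1]
        -- The layer `j` is at least `gap a b s`, so in `a` it is not joined at `s - 1` either; the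
        -- run of `a` to use starts there. If `s = 0`, the equality `J 0 = 0` forces `r = 0`.
        have key : ht a s = ht a r ∧ ∀ k, s ≤ k → k ≤ r → ht a s ≤ ht a k := by
          rcases Nat.eq_zero_or_pos s with rfl | hs0
          · rcases Nat.eq_zero_or_pos r with rfl | hr0
            · exact ⟨rfl, fun k _ hk2 => by rw [show k = 0 by omega]⟩
            · have := hkk 0 le_rfl hr0
              rw [h.joint_zero] at this; omega
          · obtain ⟨t, rfl⟩ : ∃ t, s = t + 1 := ⟨s - 1, by omega⟩
            have := h.joint_le_gap_succ t
            obtain ⟨h3, h4⟩ := h.run j t r (by omega) (by omega) hr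
              fun k h5 h6 => hkk k (by omega) h6
            exact ⟨h3, fun k h5 h6 => h4 k (by omega) h6⟩
        refine ⟨key.1, fun k hk1 hk2 => ?_⟩
        obtain ⟨i, rfl⟩ : ∃ i, k = i + 2 := ⟨k - 2, by omega⟩
        rw [ht_insertPeak_add_two (by omega)]
        exact key.2 i (by omega) (by omega)
      · rw [insertTwice_add_two h2] at hp
        obtain ⟨h3, h4⟩ := h.run j p r (by omega) hp hr fun k hk1 hk2 => by
          have := hk (k + 2) (by omega) (by omega)
          rwa [insertTwice_add_two (by omega)] at this
        rw [show p + 2 + 1 = (p + 1) + 2 from rfl, ht_insertPeak_add_two (by omega),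
          ht_insertPeak_add_two h1]
        refine ⟨h3, fun k hk1 hk2 => ?_⟩
        obtain ⟨i, rfl⟩ : ∃ i, k = i + 2 := ⟨k - 2, by omega⟩
        rw [ht_insertPeak_add_two (by omega)]
        exact h4 i (by omega) (by omega)

theorem gap_spread_of_le {s k : ℕ} (hk : k ≤ s) :
    gap (insertPeak s a) (insertUp s b) k = gap a b k := by
  rw [gap, upCount_insertPeak_of_le hk, upCount_insertUp_of_le hk, gap]

theorem gap_spread_succ {s : ℕ} :
    gap (insertPeak s a) (insertUp s b) (s + 1) = gap a b s := by
  rw [gap, upCount_insertPeak_succ, upCount_insertUp_succ le_rfl, gap]; omega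

/-- The bottom word is shifted by two steps and the top word only by one, whence the index `k + 1`
on the top: a box is gained wherever `b k` is an up step. -/
theorem gap_spread_add_two {s k : ℕ} (hk : s ≤ k) :
    gap (insertPeak s a) (insertUp s b) (k + 2) = upCount b (k + 1) - upCount a k := by
  rw [gap, upCount_insertPeak_add_two hk, upCount_insertUp_succ (by omega)]; omega

theorem lineWt_spread_of_le {s k j m : ℕ} (hk : k ≤ s) :
    lineWt (insertPeak s a) (insertUp s b) (insertTwice s m J) k j = lineWt a b J k j := by
  induction k generalizing j with
  | zero => rfl
  | succ k ih =>
    rw [lineWt, lineWt, gap_spread_of_le hk, insertPeak_of_lt (by omega),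
      insertTwice_of_lt (by omega), ih (by omega), ih (by omega)]

/-- The hypothesis `hj` says that layer `j` lies in the new region. The extra one is paid at the
inserted down step when the old line reaches that far, since the inserted up step is crossed inside
a joint. A line that was already outside the old region passes through exactly one new box. -/
theorem lineWt_spread_add_two (h : TilingData a b J) {s k j : ℕ} (hk : s ≤ k)
    (hj : j + upCount a k < upCount b (k + 1)) :
    lineWt (insertPeak s a) (insertUp s b) (insertTwice s (gap a b s) J) (k + 2) j =
      lineWt a b J k j + 1 := by
  induction k, hk using Nat.le_induction generalizing j with
  | base =>
    have hs := h.above s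
    rw [lineWt_of_down (by rw [gap_spread_add_two le_rfl]; omega) insertPeak_succ]
    rcases lt_or_ge j (gap a b s) with h1 | h1
    · rw [lineWt_of_joint (by rwa [gap_spread_succ]) insertPeak_self (by rwa [insertTwice_self]),
        lineWt_spread_of_le le_rfl, add_comm]
    · rw [lineWt_eq_zero h1, lineWt_eq_zero (by rwa [gap_spread_succ])]
  | succ k hk ih =>
    have hab := h.above (k + 1)
    have hab' := h.above k
    have hJ := h.joint_right k
    have hJ' := h.joint_left k
    have ha := upCount_succ (a := a) (k := k)
    have hlt : j < gap (insertPeak s a) (insertUp s b) (k + 2 + 1) := by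
      rw [show k + 2 + 1 = (k + 1) + 2 from rfl, gap_spread_add_two (by omega)]; omega
    rw [show k + 1 + 2 = (k + 2) + 1 from rfl]
    cases hak : a k
    · simp only [hak, Bool.false_eq_true, if_false] at ha
      rw [lineWt_of_down hlt (by rw [insertPeak_add_two hk, hak])]
      rcases lt_or_ge j (gap a b (k + 1)) with hg | hg
      · rw [lineWt_of_down hg hak, ih (by unfold gap at hg; omega)]; omega
      · rw [lineWt_eq_zero hg, lineWt_eq_zero]
        rw [gap_spread_add_two hk]; unfold gap at hg; omega
    · simp only [hak, if_true] at ha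
      rcases lt_or_ge j (J k) with hj' | hj'
      · rw [lineWt_of_joint hlt (by rw [insertPeak_add_two hk, hak])
          (by rwa [insertTwice_add_two hk]),
          lineWt_of_joint (by unfold gap; omega) hak hj', ih (by omega)]
      · rw [lineWt_of_not_joint hlt (by rw [insertPeak_add_two hk, hak])
          (by rwa [insertTwice_add_two hk])]
        rcases lt_or_ge j (gap a b (k + 1)) with hg | hg
        · rw [lineWt_of_not_joint hg hak hj', ih (by unfold gap at hg; omega)]; omega
        · rw [lineWt_eq_zero hg, lineWt_eq_zero]
          rw [gap_spread_add_two hk]; unfold gap at hg; omega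

end TilingData

/-! ### Removing the peak of an empty line -/

namespace TilingData

variable {a b : ℕ → Bool} {J : ℕ → ℕ}

/-- Undo a spread: if the line of the up step at the peak `s` is empty and those of the later up
steps are not, then the tiling is obtained by spreading. -/
theorem exists_eq_spread {s : ℕ} (h : TilingData (insertPeak s a) b J)
    (h0 : lineWt (insertPeak s a) b J s (J s) = 0)
    (hpos : ∀ k, s < k → insertPeak s a k = true → lineWt (insertPeak s a) b J k (J k) ≠ 0) :
    ∃ b' J', TilingData a b' J' ∧ b = insertUp s b' ∧ J = insertTwice s (gap a b' s) J' := by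
  have hab := h.above
  have hu0 := upCount_insertPeak_of_le (a := a) (le_refl s)
  have hu1 := upCount_insertPeak_succ (a := a) (s := s)
  -- An empty line means that it starts on the top path, so all boxes above `s` are joined to the
  -- right; there is room for this above `s + 1` only if the top path also goes up at `s`.
  have hbs : b s = true ∧ J s + upCount a s = upCount b s := by
    have h1 : ¬ J s < gap (insertPeak s a) b s := fun hlt => (h.lineWt_pos hlt).ne' h0
    have h2 := h.joint_right s
    have h3 := upCount_succ (a := b) (k := s)
    have h4 := hab s
    have h5 := h.joint_left s
    rw [hu1] at h2
    rw [hu0] at h4 h5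
    unfold gap at h1
    rw [hu0] at h1
    cases hb : b s
    · simp only [hb, Bool.false_eq_true, if_false] at h3; omega
    · exact ⟨rfl, by omega⟩
  obtain ⟨hbs, hJs⟩ := hbs
  have hbs1 : upCount b (s + 1) = upCount b s + 1 := by simp [upCount_succ, hbs]
  have hJ1 : J (s + 1) = J s := by
    have h1 := h.joint_le_of_up insertPeak_self
    have h2 := h.joint_left (s + 1)
    rw [hu1] at h2
    omega
  -- A non-empty line has a box to cross. This spare box at each later up step is what allows the
  -- added strip to be removed.
  have hpos' : ∀ k, s ≤ k → a k = true →
      J (k + 2) + upCount a k + 1 < upCount b (k + 2) := fun k hk hak => by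
    have h1 := hpos (k + 2) (by omega) (by rwa [insertPeak_add_two hk])
    have h2 : ¬ gap (insertPeak s a) b (k + 2) ≤ J (k + 2) := fun h3 => h1 (lineWt_eq_zero h3)
    have h3 := hab (k + 2)
    unfold gap at h2
    rw [upCount_insertPeak_add_two hk] at h2 h3
    omega
  let b' : ℕ → Bool := fun k => if k < s then b k else b (k + 1)
  let J' : ℕ → ℕ := deleteTwo s J
  have hbb : b = insertUp s b' := by
    funext k
    rcases lt_trichotomy k s with hk | rfl | hk
    · rw [insertUp_of_lt hk]; simp [b', hk]
    · rw [insertUp_self, hbs]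
    · obtain ⟨i, rfl⟩ : ∃ i, k = i + 1 := ⟨k - 1, by omega⟩
      rw [insertUp_succ (by omega)]
      simp only [b']
      rw [if_neg (by omega)]
  have hcb : ∀ k, k ≤ s → upCount b k = upCount b' k := fun k hk => by
    rw [hbb, upCount_insertUp_of_le hk]
  have hcb' : ∀ k, s ≤ k → upCount b (k + 1) = upCount b' k + 1 := fun k hk => by
    rw [hbb, upCount_insertUp_succ hk]
  have hJJ : J = insertTwice s (gap a b' s) J' := by
    funext k
    rcases lt_or_ge k s with hk | hk
    · rw [insertTwice_of_lt hk]; exact (deleteTwo_of_lt hk).symm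
    · have hm : gap a b' s = J s := by
        unfold gap; rw [← hcb s le_rfl]; omega
      obtain ⟨i, rfl⟩ := Nat.exists_eq_add_of_le hk
      match i with
      | 0 => rw [Nat.add_zero, insertTwice_self, hm]
      | 1 => rw [insertTwice_succ, hm, hJ1]
      | i + 2 =>
        rw [show s + (i + 2) = (s + i) + 2 by ring, insertTwice_add_two (by omega)]
        exact (deleteTwo_of_le (by omega)).symm
  have hJlt : ∀ k, k < s → J' k = J k := fun k hk => deleteTwo_of_lt hk
  have hJge : ∀ k, s ≤ k → J' k = J (k + 2) := fun k hk => deleteTwo_of_le hk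
  have hright : ∀ k, J' k + upCount a (k + 1) ≤ upCount b' (k + 1) := fun k => by
    rcases lt_or_ge k s with hk | hk
    · rw [hJlt k hk, ← hcb (k + 1) (by omega), ← upCount_insertPeak_of_le (a := a) (s := s)
        (by omega)]
      exact h.joint_right k
    · rw [hJge k hk]
      have h1 := hcb' (k + 1) (by omega)
      have h2 := h.joint_left (k + 2)
      rw [upCount_insertPeak_add_two hk] at h2
      rw [show k + 1 + 1 = k + 2 from rfl] at h1
      cases hak : a k
      · simp only [upCount_succ (a := a), hak, Bool.false_eq_true, if_false]; omega
      · have := hpos' k hk hak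
        simp only [upCount_succ (a := a), hak, if_true]; omega
  have hJs2 : J' s ≤ J s := by
    rw [hJge s le_rfl]
    cases has : a s
    · rw [← hJ1]
      exact h.joint_le_of_down (by
        rw [show s + 1 + 1 = s + 2 from rfl, insertPeak_add_two le_rfl, has])
    · have h1 := hpos' s le_rfl has
      have h2 := upCount_succ (a := b) (k := s + 1)
      rw [show s + 1 + 1 = s + 2 from rfl] at h2
      have : (if b (s + 1) = true then 1 else 0) ≤ 1 := by split_ifs <;> omega
      omega
  refine ⟨b', J', ?_, hbb, hJJ⟩
  constructor
  · obtain ⟨N, hN⟩ := h.eventually_eq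
    refine ⟨max N s, fun k hk => ?_⟩
    have hks : s ≤ k := by omega
    obtain ⟨h1, h2, h3⟩ := hN (k + 2) (by omega)
    obtain ⟨-, h5, -⟩ := hN (k + 1) (by omega)
    rw [insertPeak_add_two hks] at h1
    have hb' : b' k = false := by simp only [b']; rw [if_neg (by omega), h5]
    refine ⟨h1, hb', ?_⟩
    rw [upCount_insertPeak_add_two hks, upCount_succ, h5, hcb' k hks] at h3
    simp at h3; omega
  · intro k
    rcases le_or_gt k s with hk | hk
    · rw [← hcb k hk, ← upCount_insertPeak_of_le (a := a) hk]; exact hab k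
    · obtain ⟨i, rfl⟩ : ∃ i, k = i + 1 := ⟨k - 1, by omega⟩
      have := hright i; omega
  · intro k
    rcases lt_trichotomy k s with hk | rfl | hk
    · rw [hJlt k hk, ← hcb k hk.le, ← upCount_insertPeak_of_le (a := a) (s := s) hk.le]
      exact h.joint_left k
    · rw [← hcb k le_rfl]; omega
    · obtain ⟨i, rfl⟩ : ∃ i, k = i + 1 := ⟨k - 1, by omega⟩
      have h1 := hright i
      cases hai : a (i + 1)
      · have h2 : J' (i + 1) ≤ J' i := by
          rw [hJge _ (by omega), hJge _ (by omega)]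
          exact h.joint_le_of_down (by
            rw [show i + 2 + 1 = (i + 1) + 2 from rfl, insertPeak_add_two (by omega), hai])
        omega
      · have h2 := hright (i + 1)
        simp only [upCount_succ (k := i + 1), hai, if_true] at h2
        have : (if b' (i + 1) = true then 1 else 0) ≤ 1 := by split_ifs <;> omega
        omega
  · exact hright
  · intro j p r hpr hp hr hk
    have between : ∀ k, p < k → k < r → s ≤ k → j < J (k + 2) := fun k h1 h2 h3 => by
      rw [← hJge k h3]; exact hk k h1 h2
    have between' : ∀ k, p < k → k < r → k < s → j < J k := fun k h1 h2 h3 => by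
      rw [← hJlt k h3]; exact hk k h1 h2
    rcases lt_or_ge p s with hps | hps
    · rw [hJlt p hps] at hp
      rcases lt_or_ge r s with hrs | hrs
      · rw [hJlt r hrs] at hr
        obtain ⟨h1, h2⟩ := h.run j p r hpr hp hr fun k h1 h2 => between' k h1 h2 (by omega)
        rw [ht_insertPeak_of_le (by omega), ht_insertPeak_of_le (by omega)] at h1
        refine ⟨h1, fun k h3 h4 => ?_⟩
        have := h2 k h3 h4
        rwa [ht_insertPeak_of_le (by omega), ht_insertPeak_of_le (by omega)] at this
      -- If layer `j` is not joined at `s`, the run has to stop there. Otherwise it runs through the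
      -- peak, and the corresponding run in the larger tiling ends at `r + 2`.
      · rcases le_or_gt (J s) j with hJj | hJj
        · have hrs' : r = s := by
            by_contra hne
            have := hk s hps (by omega); omega
          subst hrs'
          obtain ⟨h1, h2⟩ := h.run j p r hpr hp hJj fun k h1 h2 => between' k h1 h2 (by omega)
          rw [ht_insertPeak_of_le (by omega), ht_insertPeak_of_le (by omega)] at h1
          refine ⟨h1, fun k h3 h4 => ?_⟩
          have := h2 k h3 h4
          rwa [ht_insertPeak_of_le (by omega), ht_insertPeak_of_le (by omega)] at this
        · rw [hJge r hrs] at hr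
          obtain ⟨h1, h2⟩ := h.run j p (r + 2) (by omega) hp hr fun k h1 h2 => by
            rcases lt_or_ge k s with h3 | h3
            · exact between' k h1 (by omega) h3
            · obtain ⟨i, rfl⟩ := Nat.exists_eq_add_of_le h3
              match i with
              | 0 => exact hJj
              | 1 => rw [hJ1]; exact hJj
              | i + 2 => exact between (s + i) (by omega) (by omega) (by omega)
          rw [ht_insertPeak_of_le (by omega), ht_insertPeak_add_two hrs] at h1
          refine ⟨h1, fun k h3 h4 => ?_⟩
          rcases le_or_gt k s with h5 | h5
          · have := h2 k h3 (by omega)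
            rwa [ht_insertPeak_of_le (by omega), ht_insertPeak_of_le (by omega)] at this
          · have := h2 (k + 2) (by omega) (by omega)
            rwa [ht_insertPeak_of_le (by omega), ht_insertPeak_add_two h5.le] at this
    · rw [hJge p hps] at hp
      rw [hJge r (by omega)] at hr
      obtain ⟨h1, h2⟩ := h.run j (p + 2) (r + 2) (by omega) hp hr fun k h1 h2 => by
        obtain ⟨i, rfl⟩ : ∃ i, k = i + 2 := ⟨k - 2, by omega⟩
        exact between i (by omega) (by omega) (by omega)
      rw [show p + 2 + 1 = (p + 1) + 2 from rfl, ht_insertPeak_add_two (by omega),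
        ht_insertPeak_add_two (by omega)] at h1
      refine ⟨h1, fun k h3 h4 => ?_⟩
      have := h2 (k + 2) (by omega) (by omega)
      rwa [show p + 2 + 1 = (p + 1) + 2 from rfl, ht_insertPeak_add_two (by omega),
        ht_insertPeak_add_two (by omega)] at this

end TilingData

/-! ### Decreasing labels of words -/

/-- The number of up steps before `k` with a smaller label. -/
def wordCode (a : ℕ → Bool) (ℓ : ℕ → ℕ) (k : ℕ) : ℕ :=
  upCount (fun i => a i && decide (ℓ i < ℓ k)) k

/-- `ℓ` is a decreasing label of the up steps of `a`. -/
structure IsDecreasing (a : ℕ → Bool) (ℓ : ℕ → ℕ) : Prop where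
  inj : ∀ i k, a i = true → a k = true → ℓ i = ℓ k → i = k
  decr : ∀ i k, i < k → a i = true → a k = true → (∀ t, i < t → t ≤ k → ht a i < ht a t) →
    ℓ k < ℓ i

/-- The smallest label belongs to a leaf: an up step directly after `s` would be a child of it with
a still smaller label. Deleting a leaf keeps the label decreasing. -/
theorem exists_minimal_peak {a : ℕ → Bool} {ℓ : ℕ → ℕ} (h : IsDecreasing a ℓ)
    (hne : ∃ k, a k = true) :
    ∃ s a', a = insertPeak s a' ∧ IsDecreasing a' (deleteTwo s ℓ) ∧
      (∀ k, a k = true → k ≠ s → ℓ s < ℓ k) := by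
  classical
  obtain ⟨s, hs, hmin⟩ : ∃ s, a s = true ∧ ∀ k, a k = true → ℓ s ≤ ℓ k := by
    obtain ⟨k, hk⟩ := hne
    have hex : ∃ m, ∃ k, a k = true ∧ ℓ k = m := ⟨_, k, hk, rfl⟩
    obtain ⟨s, hs, hm⟩ := Nat.find_spec hex
    exact ⟨s, hs, fun k hk => hm ▸ Nat.find_min' hex ⟨k, hk, rfl⟩⟩
  have hs1 : a (s + 1) = false := by
    by_contra hc
    rw [Bool.not_eq_false] at hc
    have := h.decr s (s + 1) (by omega) hs hc fun t h1 h2 => by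
      rw [show t = s + 1 by omega, ht_succ_up hs]; omega
    have := hmin _ hc
    omega
  have ha := insertPeak_deleteTwo hs hs1
  refine ⟨s, deleteTwo s a, ha.symm, ?_, fun k hk hks =>
    lt_of_le_of_ne (hmin k hk) fun he => hks (h.inj _ _ hk hs he.symm)⟩
  set a' := deleteTwo s a with ha'
  let φ : ℕ → ℕ := fun k => if k < s then k else k + 2
  have hφ : ∀ {α : Type} (c : ℕ → α) k, deleteTwo s c k = c (φ k) := fun c k => by
    simp only [φ, deleteTwo]; split_ifs <;> rfl
  constructor
  · intro i k hi hk he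
    rw [hφ] at he
    rw [ha', hφ] at hi hk
    rw [hφ] at he
    have := h.inj _ _ hi hk he
    simp only [φ] at this
    split_ifs at this <;> omega
  · intro i k hik hi hk hbelow
    rw [ha', hφ] at hi hk
    rw [hφ, hφ]
    -- Being an ancestor survives the insertion: the only new height is that of the peak, and it
    -- exceeds the height at `s`.
    refine h.decr _ _ (by simp only [φ]; split_ifs <;> omega) hi hk fun t h1 h2 => ?_
    have hhi : ht a (φ i) = ht a' i := by
      simp only [φ]
      split_ifs with h3
      · rw [← ha, ht_insertPeak_of_le h3.le]
      · rw [← ha, ht_insertPeak_add_two (by omega)]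
    rw [hhi, ← ha]
    rcases le_or_gt t s with h3 | h3
    · rw [ht_insertPeak_of_le h3]
      refine hbelow t ?_ ?_
      · simp only [φ] at h1; split_ifs at h1 <;> omega
      · simp only [φ] at h2; split_ifs at h2 <;> omega
    · rcases Nat.lt_or_ge t (s + 2) with h4 | h4
      · rw [show t = s + 1 by omega, ht_insertPeak_succ]
        have := hbelow s (by simp only [φ] at h1; split_ifs at h1 <;> omega)
          (by simp only [φ] at h2; split_ifs at h2 <;> omega)
        omega
      · obtain ⟨u, rfl⟩ : ∃ u, t = u + 2 := ⟨t - 2, by omega⟩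
        rw [ht_insertPeak_add_two (by omega)]
        refine hbelow u ?_ ?_
        · simp only [φ] at h1; split_ifs at h1 <;> omega
        · simp only [φ] at h2; split_ifs at h2 <;> omega

section Code

variable {a : ℕ → Bool} {ℓ : ℕ → ℕ} {s k : ℕ}

theorem wordCode_insertPeak_of_lt (hk : k < s) :
    wordCode (insertPeak s a) ℓ k = wordCode a (deleteTwo s ℓ) k :=
  upCount_congr fun i hi => by
    rw [insertPeak_of_lt (by omega), deleteTwo_of_lt (by omega), deleteTwo_of_lt (by omega)]

theorem upCount_false (k : ℕ) : upCount (fun _ => false) k = 0 := by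
  induction k with
  | zero => rfl
  | succ k ih => rw [upCount_succ, ih]; rfl

theorem wordCode_insertPeak_self
    (hmin : ∀ k, insertPeak s a k = true → k ≠ s → ℓ s < ℓ k) :
    wordCode (insertPeak s a) ℓ s = 0 := by
  rw [← upCount_false s]
  refine upCount_congr fun i hi => ?_
  cases hai : insertPeak s a i
  · rfl
  · have := hmin i hai (by omega)
    simp [this.le]

/-- The new smallest label is counted once by every later entry; in the word of smaller labels it
appears as an inserted peak. -/
theorem wordCode_insertPeak_add_two (hk : s ≤ k) (hak : a k = true)
    (hmin : ∀ k, insertPeak s a k = true → k ≠ s → ℓ s < ℓ k) :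
    wordCode (insertPeak s a) ℓ (k + 2) = wordCode a (deleteTwo s ℓ) k + 1 := by
  rw [wordCode, wordCode, ← upCount_insertPeak_add_two hk]
  congr 1
  funext i
  have hlt : ℓ s < ℓ (k + 2) := hmin _ (by rwa [insertPeak_add_two hk]) (by omega)
  rcases lt_or_ge i s with hi | hi
  · rw [insertPeak_of_lt hi, insertPeak_of_lt hi, deleteTwo_of_lt hi, deleteTwo_of_le hk]
  · obtain ⟨t, rfl⟩ := Nat.exists_eq_add_of_le hi
    match t with
    | 0 => simp [hlt]
    | 1 => simp
    | t + 2 =>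
      rw [show s + (t + 2) = (s + t) + 2 by ring, insertPeak_add_two (by omega),
        insertPeak_add_two (by omega), deleteTwo_of_le hk, deleteTwo_of_le (by omega)]

end Code

/-- The tiling data have the label `ℓ`. -/
def HasWordLabel (a b : ℕ → Bool) (J ℓ : ℕ → ℕ) : Prop :=
  ∀ k, a k = true → lineWt a b J k (J k) = wordCode a ℓ k

/-- Line weights and code entries change alike: unchanged before `s`, zero at `s`, and increased by
one after it. -/
theorem HasWordLabel.spread {a b : ℕ → Bool} {J ℓ : ℕ → ℕ} {s : ℕ} (h : TilingData a b J)
    (hmin : ∀ k, insertPeak s a k = true → k ≠ s → ℓ s < ℓ k) :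
    HasWordLabel (insertPeak s a) (insertUp s b) (insertTwice s (gap a b s) J) ℓ ↔
      HasWordLabel a b J (deleteTwo s ℓ) := by
  have hlt : ∀ k, a k = true → J k + upCount a k < upCount b (k + 1) := fun k hk => by
    have := h.joint_right k
    rw [upCount_succ, if_pos hk] at this
    omega
  constructor
  · intro hL k hk
    rcases lt_or_ge k s with hks | hks
    · have := hL k (by rwa [insertPeak_of_lt hks])
      rwa [insertTwice_of_lt hks, TilingData.lineWt_spread_of_le hks.le, wordCode_insertPeak_of_lt hks] at this
    · have := hL (k + 2) (by rwa [insertPeak_add_two hks])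
      rw [insertTwice_add_two hks, h.lineWt_spread_add_two hks (hlt k hk),
        wordCode_insertPeak_add_two hks hk hmin] at this
      omega
  · intro hL k hk
    rcases lt_or_ge k s with hks | hks
    · rw [insertPeak_of_lt hks] at hk
      rw [insertTwice_of_lt hks, TilingData.lineWt_spread_of_le hks.le,
        wordCode_insertPeak_of_lt hks]
      exact hL k hk
    · obtain ⟨i, rfl⟩ := Nat.exists_eq_add_of_le hks
      match i with
      | 0 =>
        rw [Nat.add_zero, insertTwice_self, TilingData.lineWt_spread_of_le le_rfl,
          wordCode_insertPeak_self hmin, lineWt_eq_zero le_rfl]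
      | 1 => rw [insertPeak_succ] at hk; exact absurd hk (by simp)
      | i + 2 =>
        rw [show s + (i + 2) = (s + i) + 2 by ring] at hk ⊢
        rw [insertPeak_add_two (by omega)] at hk
        rw [insertTwice_add_two (by omega), h.lineWt_spread_add_two (by omega) (hlt _ hk),
          wordCode_insertPeak_add_two (by omega) hk hmin, hL _ hk]

/-- The word `a` has exactly `n` up steps. -/
def HasUps (a : ℕ → Bool) (n : ℕ) : Prop := ∃ N, (∀ k, N ≤ k → a k = false) ∧ upCount a N = n

theorem HasUps.of_insertPeak {a : ℕ → Bool} {n s : ℕ} (h : HasUps (insertPeak s a) n) :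
    ∃ m, n = m + 1 ∧ HasUps a m := by
  obtain ⟨N, hN, hc⟩ := h
  have hs : s < N := by
    by_contra hle
    have := hN s (by omega)
    simp at this
  refine ⟨upCount a N, ?_, N, fun k hk => ?_, rfl⟩
  · rw [← hc, ← upCount_insertPeak_add_two hs.le, upCount_succ, upCount_succ,
      hN N le_rfl, hN (N + 1) (by omega)]
    rfl
  · rw [← insertPeak_add_two (s := s) (a := a) (k := k) (by omega)]; exact hN _ (by omega)

theorem HasUps.eq_false {a : ℕ → Bool} (h : HasUps a 0) : a = fun _ => false := by
  obtain ⟨N, hN, hc⟩ := h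
  funext k
  rcases lt_or_ge k N with hk | hk
  · have h1 := upCount_mono (a := a) (show k + 1 ≤ N from hk)
    rw [hc, upCount_succ] at h1
    by_contra hne
    rw [Bool.not_eq_false] at hne
    rw [if_pos hne] at h1
    omega
  · exact hN k hk

theorem HasUps.exists_up {a : ℕ → Bool} {n : ℕ} (h : HasUps a (n + 1)) : ∃ k, a k = true := by
  by_contra hne
  obtain ⟨N, hN, hc⟩ := h
  have : a = fun _ => false := by
    funext k
    by_contra hk
    exact hne ⟨k, by simpa using hk⟩
  rw [this, upCount_false] at hc
  omega

theorem tilingData_false : TilingData (fun _ => false) (fun _ => false) (fun _ => 0) where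
  eventually_eq := ⟨0, fun k _ => ⟨rfl, rfl, rfl⟩⟩
  above _ := le_rfl
  joint_left _ := by simp
  joint_right _ := by simp
  run j p r hpr _ _ h := by
    have : r = p + 1 := by
      by_contra hne
      exact absurd (h (p + 1) (by omega) (by omega)) (by simp)
    subst this
    exact ⟨rfl, fun k h1 h2 => by rw [show k = p + 1 by omega]⟩

theorem TilingData.eq_of_false {b : ℕ → Bool} {J : ℕ → ℕ}
    (h : TilingData (fun _ => false) b J) : b = (fun _ => false) ∧ J = fun _ => 0 := by
  obtain ⟨N, hN⟩ := h.eventually_eq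
  have hb : b = fun _ => false := by
    apply HasUps.eq_false
    refine ⟨N, fun k hk => (hN k hk).2.1, ?_⟩
    rw [← (hN N le_rfl).2.2, upCount_false]
  refine ⟨hb, funext fun k => ?_⟩
  have := h.joint_left k
  rw [hb, upCount_false] at this
  omega

/-- Every decreasing label is the label of some tiling. -/
theorem exists_tilingData {n : ℕ} {a : ℕ → Bool} {ℓ : ℕ → ℕ} (hn : HasUps a n)
    (hℓ : IsDecreasing a ℓ) : ∃ b J, TilingData a b J ∧ HasWordLabel a b J ℓ := by
  induction n generalizing a ℓ with
  | zero =>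
    rw [hn.eq_false]
    exact ⟨_, _, tilingData_false, fun k hk => by simp at hk⟩
  | succ n ih =>
    obtain ⟨s, a', rfl, hd, hmin⟩ := exists_minimal_peak hℓ hn.exists_up
    obtain ⟨m, hm, hups⟩ := hn.of_insertPeak
    obtain rfl : n = m := by omega
    obtain ⟨b, J, h, hL⟩ := ih hups hd
    exact ⟨_, _, h.spread s, (HasWordLabel.spread h hmin).2 hL⟩

/-- Tilings whose label is `ℓ` arise by spreading tilings at the smallest label. -/
theorem HasWordLabel.exists_spread {a b : ℕ → Bool} {J ℓ : ℕ → ℕ} {s : ℕ}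
    (h : TilingData (insertPeak s a) b J) (hL : HasWordLabel (insertPeak s a) b J ℓ)
    (hmin : ∀ k, insertPeak s a k = true → k ≠ s → ℓ s < ℓ k) :
    ∃ b' J', TilingData a b' J' ∧ b = insertUp s b' ∧ J = insertTwice s (gap a b' s) J' ∧
      HasWordLabel a b' J' (deleteTwo s ℓ) := by
  obtain ⟨b', J', h', rfl, rfl⟩ := h.exists_eq_spread
    (by rw [hL s insertPeak_self, wordCode_insertPeak_self hmin])
    -- Later up steps count the smallest label, so their code entries, and with them their lines,
    -- are non-zero.
    (fun k hk hak => by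
      obtain ⟨i, rfl⟩ : ∃ i, k = i + 1 := ⟨k - 1, by omega⟩
      rcases Nat.lt_or_ge s i with hi | hi
      · obtain ⟨t, rfl⟩ : ∃ t, i = t + 1 := ⟨i - 1, by omega⟩
        have hat : a t = true := by
          rwa [← insertPeak_add_two (s := s) (a := a) (k := t) (by omega)]
        rw [hL _ hak, show t + 1 + 1 = t + 2 from rfl,
          wordCode_insertPeak_add_two (by omega) hat hmin]
        omega
      · rw [show i = s by omega, insertPeak_succ] at hak
        exact absurd hak (by simp))
  exact ⟨b', J', h', rfl, rfl, (HasWordLabel.spread h' hmin).1 hL⟩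

/-- A tiling is determined by its label. -/
theorem tilingData_unique {n : ℕ} {a b₁ b₂ : ℕ → Bool} {J₁ J₂ ℓ : ℕ → ℕ} (hn : HasUps a n)
    (hℓ : IsDecreasing a ℓ) (h₁ : TilingData a b₁ J₁) (h₂ : TilingData a b₂ J₂)
    (hL₁ : HasWordLabel a b₁ J₁ ℓ) (hL₂ : HasWordLabel a b₂ J₂ ℓ) : b₁ = b₂ ∧ J₁ = J₂ := by
  induction n generalizing a b₁ b₂ J₁ J₂ ℓ with
  | zero =>
    obtain rfl := hn.eq_false
    rw [h₁.eq_of_false.1, h₁.eq_of_false.2, h₂.eq_of_false.1, h₂.eq_of_false.2]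
    exact ⟨rfl, rfl⟩
  | succ n ih =>
    obtain ⟨s, a', rfl, hd, hmin⟩ := exists_minimal_peak hℓ hn.exists_up
    obtain ⟨m, hm, hups⟩ := hn.of_insertPeak
    obtain rfl : n = m := by omega
    obtain ⟨b₁', J₁', h₁', rfl, rfl, hL₁'⟩ := HasWordLabel.exists_spread h₁ hL₁ hmin
    obtain ⟨b₂', J₂', h₂', rfl, rfl, hL₂'⟩ := HasWordLabel.exists_spread h₂ hL₂ hmin
    obtain ⟨rfl, rfl⟩ := ih hups hd h₁' h₂' hL₁' hL₂'
    exact ⟨rfl, rfl⟩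

/-! ### Patterns -/

/-- The chord that opens at `f` is closed before the position `s`. -/
def ClosedBefore (a : ℕ → Bool) (f s : ℕ) : Prop := ∃ t, f < t ∧ t ≤ s ∧ ht a t ≤ ht a f

section Closed

variable {a : ℕ → Bool} {s f p : ℕ}

theorem closedBefore_insertPeak_of_le (hp : p ≤ s) :
    ClosedBefore a f p → ClosedBefore (insertPeak s a) f p := by
  rintro ⟨t, h1, h2, h3⟩
  exact ⟨t, h1, h2, by rwa [ht_insertPeak_of_le (by omega), ht_insertPeak_of_le (by omega)]⟩

theorem closedBefore_insertPeak_of_lt (hf : f < s) :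
    ClosedBefore a f p → ClosedBefore (insertPeak s a) f (p + 2) := by
  rintro ⟨t, h1, h2, h3⟩
  rcases le_or_gt t s with h4 | h4
  · exact ⟨t, h1, by omega, by
      rwa [ht_insertPeak_of_le (by omega), ht_insertPeak_of_le (by omega)]⟩
  · exact ⟨t + 2, by omega, by omega, by
      rwa [ht_insertPeak_add_two (by omega), ht_insertPeak_of_le (by omega)]⟩

theorem closedBefore_insertPeak_of_ge (hf : s ≤ f) :
    ClosedBefore a f p → ClosedBefore (insertPeak s a) (f + 2) (p + 2) := by
  rintro ⟨t, h1, h2, h3⟩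
  exact ⟨t + 2, by omega, by omega, by
    rwa [ht_insertPeak_add_two (by omega), ht_insertPeak_add_two (by omega)]⟩

theorem closedBefore_insertPeak_self (hp : s + 2 ≤ p) : ClosedBefore (insertPeak s a) s p :=
  ⟨s + 2, by omega, hp, by rw [ht_insertPeak_add_two le_rfl, ht_insertPeak_of_le le_rfl]⟩

/-- The position in `insertPeak s a` of the step `k` of `a`. -/
def skipPeak (s k : ℕ) : ℕ := if k < s then k else k + 2

theorem deleteTwo_eq {α : Type*} (c : ℕ → α) (k : ℕ) : deleteTwo s c k = c (skipPeak s k) := by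
  simp only [skipPeak, deleteTwo]; split_ifs <;> rfl

theorem insertPeak_skipPeak (k : ℕ) : insertPeak s a (skipPeak s k) = a k := by
  simp only [skipPeak]
  split_ifs with h
  · exact insertPeak_of_lt h
  · exact insertPeak_add_two (by omega)

theorem closedBefore_skipPeak {k : ℕ} (h : ClosedBefore a f k) :
    ClosedBefore (insertPeak s a) (skipPeak s f) (skipPeak s k) := by
  have hfk : f < k := by obtain ⟨t, h1, h2, -⟩ := h; omega
  simp only [skipPeak]
  split_ifs with h1 h2 h2
  · exact closedBefore_insertPeak_of_le h2.le h
  · exact closedBefore_insertPeak_of_lt h1 h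
  · omega
  · exact closedBefore_insertPeak_of_ge (by omega) h

end Closed

/-- If there are boxes above the position `s`, then some up step `f` whose chord is closed before
`s` has a smaller label than some up step `g` after `s`. -/
theorem exists_ascent_of_gap_pos {n : ℕ} {a b : ℕ → Bool} {J ℓ : ℕ → ℕ} (hn : HasUps a n)
    (hℓ : IsDecreasing a ℓ) (h : TilingData a b J) (hL : HasWordLabel a b J ℓ) {p : ℕ}
    (hp : 0 < gap a b p) :
    ∃ f g, a f = true ∧ a g = true ∧ ClosedBefore a f p ∧ p ≤ g ∧ ℓ f < ℓ g := by
  induction n generalizing a b J ℓ p with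
  | zero =>
    obtain rfl := hn.eq_false
    rw [h.eq_of_false.1, gap] at hp
    omega
  | succ n ih =>
    obtain ⟨s, a', rfl, hd, hmin⟩ := exists_minimal_peak hℓ hn.exists_up
    obtain ⟨m, hm, hups⟩ := hn.of_insertPeak
    obtain rfl : n = m := by omega
    obtain ⟨b', J', h', rfl, rfl, hL'⟩ := HasWordLabel.exists_spread h hL hmin
    have lift : ∀ p', 0 < gap a' b' p' → ∃ f g, a' f = true ∧ a' g = true ∧ ClosedBefore a' f p' ∧
        p' ≤ g ∧ ℓ (skipPeak s f) < ℓ (skipPeak s g) := fun p' hp' => by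
      obtain ⟨f, g, h1, h2, h3, h4, h5⟩ := ih hups hd h' hL' hp'
      rw [deleteTwo_eq, deleteTwo_eq] at h5
      exact ⟨f, g, h1, h2, h3, h4, h5⟩
    rcases le_or_gt p s with hps | hps
    · rw [TilingData.gap_spread_of_le hps] at hp
      obtain ⟨f, g, h1, h2, h3, h4, h5⟩ := lift p hp
      refine ⟨skipPeak s f, skipPeak s g, by rwa [insertPeak_skipPeak],
        by rwa [insertPeak_skipPeak], ?_, ?_, h5⟩
      · have hf : f < s := by obtain ⟨t, h6, h7, -⟩ := h3; omega
        rw [skipPeak, if_pos hf]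
        exact closedBefore_insertPeak_of_le hps h3
      · rw [skipPeak]; split_ifs <;> omega
    · obtain ⟨i, rfl⟩ : ∃ i, p = i + 1 := ⟨p - 1, by omega⟩
      rcases Nat.lt_or_ge s i with hi | hi
      · obtain ⟨t, rfl⟩ : ∃ t, i = t + 1 := ⟨i - 1, by omega⟩
        rw [show t + 1 + 1 = t + 2 from rfl] at hp ⊢
        -- If nothing lay above `t` before, the box is new and `b' t` is an up step. Both words have
        -- equally many up steps in the end, so `a'` still has an up step `g` from `t` on; the new
        -- smallest label at `s` serves as `f`.
        rcases Nat.eq_zero_or_pos (gap a' b' t) with hz | hz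
        · rw [TilingData.gap_spread_add_two (by omega)] at hp
          have hg : ∃ g, t ≤ g ∧ a' g = true := by
            by_contra hne
            obtain ⟨N, hN⟩ := h'.eventually_eq
            have hall : ∀ k, t ≤ k → upCount a' k = upCount a' t := fun k hk => by
              induction k, hk using Nat.le_induction with
              | base => rfl
              | succ k hk ih2 =>
                have : a' k = false := by
                  by_contra hc; exact hne ⟨k, hk, by simpa using hc⟩
                rw [upCount_succ, ih2, this]; rfl
            have h1 := hall (max N (t + 1)) (by omega)
            have h2 := (hN (max N (t + 1)) (le_max_left _ _)).2.2
            have h3 := upCount_mono (a := b') (le_max_right N (t + 1))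
            have h4 := h'.above t
            unfold gap at hz
            omega
          obtain ⟨g, hg1, hg2⟩ := hg
          have hg3 : insertPeak s a' (g + 2) = true := by rwa [insertPeak_add_two (by omega)]
          exact ⟨s, g + 2, insertPeak_self, hg3, closedBefore_insertPeak_self (by omega),
            by omega, hmin _ hg3 (by omega)⟩
        · obtain ⟨f, g, h1, h2, h3, h4, h5⟩ := lift t hz
          refine ⟨skipPeak s f, skipPeak s g, by rwa [insertPeak_skipPeak],
            by rwa [insertPeak_skipPeak], ?_, ?_, h5⟩
          · have := closedBefore_skipPeak (s := s) h3
            rwa [skipPeak.eq_1 s t, if_neg (by omega)] at this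
          · rw [skipPeak]; split_ifs <;> omega
      · obtain rfl : i = s := by omega
        rw [TilingData.gap_spread_succ] at hp
        obtain ⟨f, g, h1, h2, h3, h4, h5⟩ := lift i hp
        refine ⟨skipPeak i f, skipPeak i g, by rwa [insertPeak_skipPeak],
          by rwa [insertPeak_skipPeak], ?_, ?_, h5⟩
        · have hf : f < i := by obtain ⟨t, h6, h7, -⟩ := h3; omega
          rw [skipPeak, if_pos hf]
          obtain ⟨t, h6, h7, h8⟩ := closedBefore_insertPeak_of_le (le_refl i) h3
          exact ⟨t, h6, by omega, h8⟩
        · rw [skipPeak]; split_ifs <;> omega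

/-- The label of a tiling with a non-trivial tile contains a `312`-pattern. -/
theorem exists_pattern_of_joint_pos {n : ℕ} {a b : ℕ → Bool} {J ℓ : ℕ → ℕ} (hn : HasUps a n)
    (hℓ : IsDecreasing a ℓ) (h : TilingData a b J) (hL : HasWordLabel a b J ℓ) {k : ℕ}
    (hk : 0 < J k) :
    ∃ f e g, a f = true ∧ a e = true ∧ a g = true ∧ ClosedBefore a f e ∧ ClosedBefore a e g ∧
      ℓ e < ℓ f ∧ ℓ f < ℓ g := by
  induction n generalizing a b J ℓ k with
  | zero =>
    obtain rfl := hn.eq_false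
    simp [h.eq_of_false.2] at hk
  | succ n ih =>
    obtain ⟨s, a', rfl, hd, hmin⟩ := exists_minimal_peak hℓ hn.exists_up
    obtain ⟨m, hm, hups⟩ := hn.of_insertPeak
    obtain rfl : n = m := by omega
    obtain ⟨b', J', h', rfl, rfl, hL'⟩ := HasWordLabel.exists_spread h hL hmin
    have old : ∀ i, 0 < J' i → ∃ f e g, insertPeak s a' f = true ∧ insertPeak s a' e = true ∧
        insertPeak s a' g = true ∧ ClosedBefore (insertPeak s a') f e ∧
        ClosedBefore (insertPeak s a') e g ∧ ℓ e < ℓ f ∧ ℓ f < ℓ g := fun i hi => by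
      obtain ⟨f, e, g, h1, h2, h3, h4, h5, h6, h7⟩ := ih hups hd h' hL' hi
      simp only [deleteTwo_eq] at h6 h7
      exact ⟨skipPeak s f, skipPeak s e, skipPeak s g, by rwa [insertPeak_skipPeak],
        by rwa [insertPeak_skipPeak], by rwa [insertPeak_skipPeak], closedBefore_skipPeak h4,
        closedBefore_skipPeak h5, h6, h7⟩
    -- New joints require boxes above `s`. They provide an ascent from `f` on the left of `s` to `g`
    -- on its right, and the smallest label in the middle completes the pattern.
    have new : 0 < gap a' b' s → ∃ f e g, insertPeak s a' f = true ∧ insertPeak s a' e = true ∧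
        insertPeak s a' g = true ∧ ClosedBefore (insertPeak s a') f e ∧
        ClosedBefore (insertPeak s a') e g ∧ ℓ e < ℓ f ∧ ℓ f < ℓ g := fun hi => by
      obtain ⟨f, g, h1, h2, h3, h4, h5⟩ := exists_ascent_of_gap_pos hups hd h' hL' hi
      have hf : f < s := by obtain ⟨t, h6, h7, -⟩ := h3; omega
      rw [deleteTwo_of_lt hf, deleteTwo_of_le h4] at h5
      have haf : insertPeak s a' f = true := by rwa [insertPeak_of_lt hf]
      exact ⟨f, s, g + 2, haf, insertPeak_self, by rwa [insertPeak_add_two h4],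
        closedBefore_insertPeak_of_le le_rfl h3, closedBefore_insertPeak_self (by omega),
        hmin f haf (by omega), h5⟩
    rw [insertTwice] at hk
    split_ifs at hk with h1 h2
    · exact old _ hk
    · exact new hk
    · exact old _ hk

/-! ### The weight of a tiling and tilings with trivial tiles -/

namespace TilingData

variable {a b : ℕ → Bool} {J : ℕ → ℕ}

/-- The total weight of the tiles is the sum of the weights of the lines. -/
theorem sum_lineWt (h : TilingData a b J) (N : ℕ) :
    ∑ k ∈ Finset.range N, (if a k then gap a b (k + 1) - J k else gap a b (k + 1)) =
      ∑ k ∈ Finset.range N, (if a k then lineWt a b J k (J k) else 0) +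
        ∑ j ∈ Finset.range (gap a b N), lineWt a b J N j := by
  induction N with
  | zero => simp [gap]
  | succ k ih =>
    have hx : ∀ m, gap a b k ≤ m → ∑ j ∈ Finset.range m, lineWt a b J k j =
        ∑ j ∈ Finset.range (gap a b k), lineWt a b J k j := fun m hm => by
      refine (Finset.sum_subset (Finset.range_mono hm) fun j _ hj => lineWt_eq_zero ?_).symm
      simpa using hj
    have hga := h.above k
    have hga' := h.above (k + 1)
    have ha := upCount_succ (a := a) (k := k)
    have hb := upCount_succ (a := b) (k := k)
    have hb1 : (if b k = true then 1 else 0) ≤ 1 := by split_ifs <;> omega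
    rw [Finset.sum_range_succ, Finset.sum_range_succ, ih]
    cases hak : a k
    · simp only [hak, Bool.false_eq_true, if_false] at ha ⊢
      rw [Finset.sum_congr rfl fun j hj =>
        lineWt_of_down (b := b) (J := J) (Finset.mem_range.1 hj) hak, Finset.sum_add_distrib,
        hx (gap a b (k + 1)) (by unfold gap; omega)]
      simp; ring
    -- The last sum in the induction collects the lines that cross position `N`. At an up step,
    -- layers below `J k` continue from the same layer and the others from one layer higher. Layer
    -- `J k` of position `k` is thus continued by none of them: it carries the line that starts at
    -- this up step.
    · simp only [hak, if_true] at ha ⊢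
      have hJ := h.joint_le_gap_succ k
      have hJ' := h.joint_le_gap k
      rw [← Finset.sum_range_add_sum_Ico _ hJ,
        Finset.sum_congr rfl fun j hj =>
          lineWt_of_joint (lt_of_lt_of_le (Finset.mem_range.1 hj) hJ) hak (Finset.mem_range.1 hj),
        Finset.sum_congr rfl fun j hj => lineWt_of_not_joint (b := b) (J := J)
          (Finset.mem_Ico.1 hj).2 hak (Finset.mem_Ico.1 hj).1, Finset.sum_add_distrib,
        ← hx (gap a b (k + 1) + 1) (by unfold gap; omega),
        ← Finset.sum_range_add_sum_Ico _ (show J k ≤ gap a b (k + 1) + 1 by omega),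
        Finset.sum_eq_sum_Ico_succ_bot (show J k < gap a b (k + 1) + 1 by omega),
        ← Finset.sum_Ico_add' (fun j => lineWt a b J k j)]
      simp; ring

/-- A region between two paths is tiled by single boxes. -/
theorem of_trivial (hab : ∀ k, upCount a k ≤ upCount b k)
    (hN : ∃ N, ∀ k, N ≤ k → a k = false ∧ b k = false ∧ upCount a k = upCount b k) :
    TilingData a b fun _ => 0 where
  eventually_eq := hN
  above := hab
  joint_left k := by simpa using hab k
  joint_right k := by simpa using hab (k + 1)
  run j p r hpr _ _ h := by
    have : r = p + 1 := by
      by_contra hne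
      exact absurd (h (p + 1) (by omega) (by omega)) (by simp)
    subst this
    exact ⟨rfl, fun k h1 h2 => by rw [show k = p + 1 by omega]⟩

/-- In a tiling by single boxes, the weight of a line is the distance to the up step of the top
path in the same row. -/
theorem lineWt_trivial {P k j : ℕ} (hP : b P = true) (hc : upCount b P = upCount a k + j) :
    lineWt a b (fun _ => 0) k j = k - P := by
  have hPb : upCount b (P + 1) = upCount b P + 1 := by rw [upCount_succ, if_pos hP]
  induction k generalizing j with
  | zero => simp [lineWt]
  | succ k ih =>
    have ha := upCount_succ (a := a) (k := k)
    rcases le_or_gt (k + 1) P with hk | hk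
    · rw [lineWt_eq_zero]
      · omega
      · have := upCount_mono (a := b) hk
        unfold gap; omega
    · have hb := upCount_mono (a := b) (show P + 1 ≤ k + 1 by omega)
      have hg : j < gap a b (k + 1) := by unfold gap; omega
      cases hak : a k
      · simp only [hak, Bool.false_eq_true, if_false] at ha
        rw [lineWt_of_down hg hak, ih (by omega)]; omega
      · simp only [hak, if_true] at ha
        rw [lineWt_of_not_joint hg hak (Nat.zero_le _), ih (by omega)]; omega

end TilingData

/-! ### The edges of the tree -/

namespace DyckWord

/-- The steps of a Dyck path, followed by down steps. -/
def isUp (w : DyckWord) (k : ℕ) : Bool := decide (w.toList[k]? = some U)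

theorem count_U_add_count_D (l : List DyckStep) : l.count U + l.count D = l.length := by
  induction l with
  | nil => rfl
  | cons x l ih => cases x <;> simp <;> omega

theorem count_take_eq_upCount (l : List DyckStep) (k : ℕ) :
    (l.take k).count U = upCount (fun i => decide (l[i]? = some U)) k := by
  induction k with
  | zero => simp
  | succ k ih =>
    rw [List.take_add_one, List.count_append, ih, upCount_succ]
    cases h : l[k]? with
    | none => simp
    | some x => cases x <;> simp

variable (w : DyckWord)

theorem count_U_take (k : ℕ) : (w.toList.take k).count U = upCount w.isUp k :=
  count_take_eq_upCount _ _

theorem count_D_take {k : ℕ} (hk : k ≤ w.toList.length) :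
    (w.toList.take k).count D = k - upCount w.isUp k := by
  have h := count_U_add_count_D (w.toList.take k)
  rw [List.length_take, min_eq_left hk, count_U_take] at h
  omega

theorem length_eq : w.toList.length = 2 * w.semilength := w.two_mul_semilength_eq_length.symm

theorem isUp_of_ge {k : ℕ} (hk : w.toList.length ≤ k) : w.isUp k = false := by
  simp [isUp, hk]

theorem lt_length_of_isUp {k : ℕ} (hk : w.isUp k = true) : k < w.toList.length := by
  by_contra h
  rw [w.isUp_of_ge (by omega)] at hk
  simp at hk

theorem upCount_length : upCount w.isUp w.toList.length = w.semilength := by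
  rw [← count_U_take, List.take_length]; rfl

theorem hasUps : HasUps w.isUp w.semilength :=
  ⟨_, fun _ hk => w.isUp_of_ge hk, w.upCount_length⟩

theorem upCount_le_semilength (k : ℕ) : upCount w.isUp k ≤ w.semilength := by
  rw [← count_U_take]
  exact (List.take_sublist _ _).count_le _

theorem ht_nonneg {k : ℕ} (hk : k ≤ w.toList.length) : 0 ≤ ht w.isUp k := by
  have h := w.count_D_le_count_U k
  rw [count_D_take w hk, count_U_take] at h
  unfold ht; omega

theorem ht_length : ht w.isUp w.toList.length = 0 := by
  rw [ht, upCount_length, length_eq]; push_cast; ring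

theorem getElem?_eq_U {k : ℕ} : w.toList[k]? = some U ↔ w.isUp k = true := by
  simp [isUp]

theorem getElem?_eq_D {k : ℕ} :
    w.toList[k]? = some D ↔ k < w.toList.length ∧ w.isUp k = false := by
  rcases lt_or_ge k w.toList.length with hk | hk
  · simp only [isUp, List.getElem?_eq_getElem hk, hk, true_and]
    cases w.toList[k] <;> simp
  · simp [hk]

theorem segment_count (i j : ℕ) (hij : i ≤ j) (hj : j < w.toList.length) :
    ((w.segment i j).count U = (w.segment i j).count D) ↔ ht w.isUp (j + 1) = ht w.isUp i := by
  have h1 : w.toList.take (j + 1) = w.toList.take i ++ w.segment i j := by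
    rw [segment, ← List.take_add]; congr 1; omega
  have hU := congrArg (List.count U) h1
  have hD := congrArg (List.count D) h1
  rw [List.count_append] at hU hD
  rw [count_U_take, count_U_take] at hU
  rw [count_D_take w (by omega), count_D_take w (by omega)] at hD
  have h3 := upCount_le (a := w.isUp) (j + 1)
  have h4 := upCount_le (a := w.isUp) i
  unfold ht
  push_cast
  omega

/-- This is the description of the matching down step as a first return: maximality of `i` among
balanced starts says that the path stays strictly above its height at `i` up to `j`. -/
theorem isChordPair_iff (i j : ℕ) : w.IsChordPair i j ↔
    w.isUp i = true ∧ i < j ∧ j < w.toList.length ∧ w.isUp j = false ∧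
      ht w.isUp (j + 1) = ht w.isUp i ∧ ∀ t, i < t → t ≤ j → ht w.isUp i < ht w.isUp t := by
  rw [IsChordPair, getElem?_eq_D]
  constructor
  · rintro ⟨⟨hj, hjD⟩, hij, ⟨hi, hb⟩, hmax⟩
    rw [getElem?_eq_U] at hi
    rw [segment_count w i j hij.le hj] at hb
    refine ⟨hi, hij, hj, hjD, hb, fun t h1 h2 => ?_⟩
    by_contra hle
    -- Going left from `j`, take the first position that is not above the height at `i`. The step
    -- there is an up step from exactly that height, hence a balanced start after `i`.
    have hlast : ∀ d, d ≤ j - t → ht w.isUp (j - d) ≤ ht w.isUp i → False := by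
      intro d
      induction d with
      | zero =>
        intro _ h3
        have := ht_succ_down hjD
        rw [Nat.sub_zero] at h3
        omega
      | succ d ih =>
        intro h3 h4
        by_cases h5 : ht w.isUp (j - d) ≤ ht w.isUp i
        · exact ih (by omega) h5
        · have h6 : j - d = j - (d + 1) + 1 := by omega
          rw [h6] at h5
          cases hup : w.isUp (j - (d + 1))
          · have := ht_succ_down hup; omega
          · have h7 := ht_succ_up hup
            refine hmax (j - (d + 1)) (by omega) (by omega) ⟨w.getElem?_eq_U.2 hup, ?_⟩
            rw [segment_count w _ j (by omega) hj]
            omega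
    exact hlast (j - t) le_rfl (by rw [show j - (j - t) = t by omega]; omega)
  · rintro ⟨hi, hij, hj, hjD, hb, ht'⟩
    refine ⟨⟨hj, hjD⟩, hij, ⟨w.getElem?_eq_U.2 hi, ?_⟩, fun k h1 h2 h3 => ?_⟩
    · rwa [segment_count w i j hij.le hj]
    · have := h3.2
      rw [segment_count w k j h2.le hj] at this
      have := ht' k h1 h2.le
      omega

end DyckWord

namespace TreeEdge

variable {w : DyckWord}

theorem chord (e : TreeEdge w) : w.isUp e.opening = true ∧ e.opening < e.closing ∧
    e.closing < w.toList.length ∧ w.isUp e.closing = false ∧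
    ht w.isUp (e.closing + 1) = ht w.isUp e.opening ∧
    ∀ t, e.opening < t → t ≤ e.closing → ht w.isUp e.opening < ht w.isUp t :=
  (w.isChordPair_iff _ _).1 e.2

theorem row_eq (e : TreeEdge w) : e.row = upCount w.isUp e.opening := w.count_U_take _

/-- The matching down step leads to the first later position at which the path is back at its height
at `k`; the end of the path bounds the search. -/
theorem exists_opening {k : ℕ} (hk : w.isUp k = true) : ∃ e : TreeEdge w, e.opening = k := by
  classical
  have hlen := w.lt_length_of_isUp hk
  have hex : ∃ t, k < t ∧ ht w.isUp t ≤ ht w.isUp k :=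
    ⟨w.toList.length, hlen, by rw [w.ht_length]; exact w.ht_nonneg hlen.le⟩
  obtain ⟨h1, h2⟩ := Nat.find_spec hex
  have hmin : ∀ t, k < t → t < Nat.find hex → ht w.isUp k < ht w.isUp t := fun t h3 h4 => by
    have := Nat.find_min hex h4
    push Not at this
    exact this h3
  have hle : Nat.find hex ≤ w.toList.length :=
    Nat.find_min' hex ⟨hlen, by rw [w.ht_length]; exact w.ht_nonneg hlen.le⟩
  obtain ⟨j, hj⟩ : ∃ j, Nat.find hex = j + 1 := ⟨Nat.find hex - 1, by omega⟩
  rw [hj] at h1 h2 hmin hle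
  have hkj : k < j := by
    rcases Nat.lt_succ_iff_lt_or_eq.1 h1 with h | rfl
    · exact h
    · rw [ht_succ_up hk] at h2; omega
  have h3 := hmin j hkj (by omega)
  have hjD : w.isUp j = false := by
    by_contra hc
    rw [Bool.not_eq_false] at hc
    rw [ht_succ_up hc] at h2
    omega
  refine ⟨⟨(⟨k, hlen⟩, ⟨j, by omega⟩), (w.isChordPair_iff k j).2
    ⟨hk, hkj, by omega, hjD, ?_, fun t h4 h5 => hmin t h4 (by omega)⟩⟩, rfl⟩
  have := ht_succ_down hjD
  omega

theorem opening_injective : Function.Injective (opening : TreeEdge w → ℕ) := by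
  intro e f h
  obtain ⟨-, h1, -, -, h2, h3⟩ := e.chord
  obtain ⟨-, h4, -, -, h5, h6⟩ := f.chord
  have hc : e.closing = f.closing := by
    rcases lt_trichotomy e.closing f.closing with h7 | h7 | h7
    · have := h6 (e.closing + 1) (by omega) (by omega)
      rw [h2, h] at this; omega
    · exact h7
    · have := h3 (f.closing + 1) (by omega) (by omega)
      rw [h5, h] at this; omega
  exact Subtype.ext (Prod.ext (Fin.ext h) (Fin.ext hc))

/-- Chords do not cross: an up step inside the chord `f` starts above the base of `f` and so is
matched before `f` closes. -/
theorem below_or_left {e f : TreeEdge w} (h : f.opening < e.opening) :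
    e.IsBelow f ∨ f.StrictlyLeft e := by
  obtain ⟨h0, h1, -, h1', h2, h3⟩ := e.chord
  obtain ⟨-, h4, -, h4', h5, h6⟩ := f.chord
  rcases lt_trichotomy f.closing e.opening with h7 | h7 | h7
  · exact Or.inr h7
  · rw [h7, h0] at h4'; simp at h4'
  · refine Or.inl ⟨h, ?_⟩
    have h8 := h6 e.opening h h7.le
    by_contra hle
    rcases Nat.eq_or_lt_of_le (not_lt.1 hle) with h9 | h9
    · rw [← h9] at h2; omega
    · have := h3 (f.closing + 1) (by omega) (by omega)
      omega

theorem StrictlyLeft.opening_lt {e f : TreeEdge w} (h : e.StrictlyLeft f) :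
    e.opening < f.opening := e.chord.2.1.trans h

theorem IsBelow.not_left {e f : TreeEdge w} (h : e.IsBelow f) : ¬ f.StrictlyLeft e := fun h' => by
  have := e.chord.2.1
  unfold StrictlyLeft at h'
  have := h.2
  omega

theorem strictlyLeft_iff_closedBefore {e f : TreeEdge w} :
    e.StrictlyLeft f ↔ ClosedBefore w.isUp e.opening f.opening := by
  obtain ⟨h0, h1, -, h1', h2, h3⟩ := e.chord
  constructor
  · intro h
    exact ⟨e.closing + 1, by omega, h, h2.le⟩
  · rintro ⟨t, h4, h5, h6⟩
    by_contra hle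
    have := h3 t h4 (by unfold StrictlyLeft at hle; omega)
    omega

/-- The edges are numbered by their up steps. -/
theorem row_lt (e : TreeEdge w) : e.row < w.semilength := by
  rw [row_eq]
  have h1 := e.chord.1
  have h2 := upCount_succ (a := w.isUp) (k := e.opening)
  rw [if_pos h1] at h2
  have := w.upCount_le_semilength (e.opening + 1)
  omega

theorem row_lt_row {e f : TreeEdge w} (h : e.opening < f.opening) : e.row < f.row := by
  rw [row_eq, row_eq]
  have h1 := upCount_succ (a := w.isUp) (k := e.opening)
  rw [if_pos e.chord.1] at h1
  have := upCount_mono (a := w.isUp) (show e.opening + 1 ≤ f.opening from h)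
  omega

theorem row_lt_row_iff {e f : TreeEdge w} : e.row < f.row ↔ e.opening < f.opening := by
  refine ⟨fun h => ?_, row_lt_row⟩
  by_contra hle
  rcases Nat.eq_or_lt_of_le (not_lt.1 hle) with h1 | h1
  · rw [opening_injective h1] at h; omega
  · have := row_lt_row h1; omega

theorem row_injective : Function.Injective (row : TreeEdge w → ℕ) := by
  intro e f h
  apply opening_injective
  rcases lt_trichotomy e.opening f.opening with h1 | h1 | h1
  · have := row_lt_row h1; omega
  · exact h1
  · have := row_lt_row h1; omega

theorem exists_row {r : ℕ} (hr : r < w.semilength) : ∃ e : TreeEdge w, e.row = r := by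
  classical
  have hex : ∃ k, r < upCount w.isUp k := ⟨w.toList.length, by rwa [w.upCount_length]⟩
  have h1 := Nat.find_spec hex
  obtain ⟨k, hk⟩ : ∃ k, Nat.find hex = k + 1 := by
    refine ⟨Nat.find hex - 1, ?_⟩
    have : Nat.find hex ≠ 0 := fun h => by rw [h] at h1; simp at h1
    omega
  have h2 := Nat.find_min hex (show k < Nat.find hex by omega)
  rw [hk, upCount_succ] at h1
  have hup : w.isUp k = true := by
    by_contra hc
    rw [if_neg hc] at h1
    omega
  rw [if_pos hup] at h1
  obtain ⟨e, rfl⟩ := exists_opening hup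
  exact ⟨e, by rw [row_eq]; omega⟩

/-- The edges correspond to the rows. -/
noncomputable def rowEquiv (w : DyckWord) : TreeEdge w ≃ Fin w.semilength :=
  Equiv.ofBijective (fun e => ⟨e.row, e.row_lt⟩)
    ⟨fun _ _ h => row_injective (Fin.mk.inj_iff.1 h),
      fun r => (exists_row r.2).imp fun _ he => Fin.ext he⟩

/-- A function on the up steps of `w` as a function on the positions. -/
noncomputable def onSteps (g : TreeEdge w → ℕ) (k : ℕ) : ℕ :=
  open Classical in if h : ∃ e : TreeEdge w, e.opening = k then g h.choose else 0

theorem onSteps_opening (g : TreeEdge w → ℕ) (e : TreeEdge w) : onSteps g e.opening = g e := by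
  have h : ∃ f : TreeEdge w, f.opening = e.opening := ⟨e, rfl⟩
  rw [onSteps, dif_pos h, opening_injective h.choose_spec]

/-- Sums over the up steps. -/
theorem sum_opening (g : ℕ → ℕ) :
    ∑ k ∈ Finset.range w.toList.length, (if w.isUp k then g k else 0) =
      ∑ e : TreeEdge w, g e.opening := by
  rw [← Finset.sum_filter]
  refine (Finset.sum_bij (fun e _ => opening e) ?_ ?_ ?_ ?_).symm
  · intro e _
    simp [e.chord.1, w.lt_length_of_isUp e.chord.1]
  · intro e _ f _ h
    exact opening_injective h
  · intro k hk
    obtain ⟨e, he⟩ := exists_opening (Finset.mem_filter.1 hk).2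
    exact ⟨e, Finset.mem_univ _, he⟩
  · intro e _; rfl

theorem upCount_eq_card (k : ℕ) (p : TreeEdge w → Prop) [DecidablePred p] (c : ℕ → Bool)
    (hc : ∀ e : TreeEdge w, c e.opening = true ↔ p e) :
    upCount (fun i => w.isUp i && c i) k =
      (Finset.univ.filter fun e : TreeEdge w => e.opening < k ∧ p e).card := by
  have h1 : ∀ (a : ℕ → Bool), upCount a k = ((Finset.range k).filter fun i => a i = true).card := by
    intro a
    induction k with
    | zero => rfl
    | succ k ih =>
      rw [upCount_succ, ih, Finset.range_add_one, Finset.filter_insert]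
      split_ifs
      · rw [Finset.card_insert_of_notMem (by simp)]
      · rfl
  rw [h1]
  refine (Finset.card_bij (fun e _ => opening e) ?_ ?_ ?_).symm
  · intro e he
    simp only [Finset.mem_filter, Finset.mem_univ, true_and, Finset.mem_range,
      Bool.and_eq_true] at he ⊢
    exact ⟨he.1, e.chord.1, (hc e).2 he.2⟩
  · intro e _ f _ h
    exact opening_injective h
  · intro i hi
    simp only [Finset.mem_filter, Finset.mem_range, Bool.and_eq_true] at hi
    obtain ⟨e, rfl⟩ := exists_opening hi.2.1
    exact ⟨e, by simpa using ⟨hi.1, (hc e).1 hi.2.2⟩, rfl⟩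

end TreeEdge

/-! ### Labels of trees as labels of words -/

namespace DecreasingLabel

variable {w : DyckWord}

/-- The label as a function on the positions of the up steps. -/
noncomputable def wordLabel (L : DecreasingLabel w) : ℕ → ℕ := TreeEdge.onSteps fun e => (L e : ℕ)

theorem isDecreasing (L : DecreasingLabel w) : IsDecreasing w.isUp L.wordLabel := by
  constructor
  · intro i k hi hk h
    obtain ⟨e, rfl⟩ := TreeEdge.exists_opening hi
    obtain ⟨f, rfl⟩ := TreeEdge.exists_opening hk
    rw [wordLabel, TreeEdge.onSteps_opening, TreeEdge.onSteps_opening] at h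
    rw [L.1.injective (Fin.ext h)]
  · intro i k hik hi hk h
    obtain ⟨e, rfl⟩ := TreeEdge.exists_opening hi
    obtain ⟨f, rfl⟩ := TreeEdge.exists_opening hk
    rw [wordLabel, TreeEdge.onSteps_opening, TreeEdge.onSteps_opening]
    refine L.2 f e ((TreeEdge.below_or_left hik).resolve_right fun hl => ?_)
    have h1 := h (e.closing + 1) (by have := e.chord.2.1; omega) hl
    have h2 := e.chord.2.2.2.2.1
    omega

theorem wordCode_eq_code (L : DecreasingLabel w) (e : TreeEdge w) :
    wordCode w.isUp L.wordLabel e.opening = L.code e := by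
  classical
  rw [wordCode, TreeEdge.upCount_eq_card _ (fun f => L f < L e)]
  · unfold code; congr
  · intro f
    simp only [wordLabel, TreeEdge.onSteps_opening, decide_eq_true_eq, Fin.lt_def]

end DecreasingLabel

/-! ### Counting the edges on the left -/

namespace TreeEdge

variable {w : DyckWord}

open Classical in
/-- The number of edges strictly left to `e`. -/
noncomputable def leftCount (e : TreeEdge w) : ℕ :=
  (Finset.univ.filter fun f : TreeEdge w => f.StrictlyLeft e).card

theorem closing_injective : Function.Injective (closing : TreeEdge w → ℕ) := by
  intro e f h
  have key : ∀ e f : TreeEdge w, e.closing = f.closing → ¬ e.opening < f.opening := by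
    intro e f h hlt
    rcases below_or_left hlt with h1 | h1
    · have := h1.2; omega
    · have := f.chord.2.1
      unfold StrictlyLeft at h1; omega
  exact opening_injective (by have := key e f h; have := key f e h.symm; omega)

theorem card_edges (w : DyckWord) : Fintype.card (TreeEdge w) = w.semilength := by
  rw [Fintype.card_congr (rowEquiv w), Fintype.card_fin]

theorem card_not_up (w : DyckWord) {k : ℕ} :
    ((Finset.range k).filter fun i => w.isUp i = false).card = k - upCount w.isUp k := by
  induction k with
  | zero => rfl
  | succ k ih =>
    have := upCount_le (a := w.isUp) k
    rw [upCount_succ, Finset.range_add_one, Finset.filter_insert]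
    cases h : w.isUp k
    · simp only [if_true]
      rw [Finset.card_insert_of_notMem (by simp), ih]; simp; omega
    · simp only [Bool.true_eq_false, if_false, if_true]
      rw [ih]; omega

/-- By counting: closing positions are distinct, and there are as many edges as down steps. -/
theorem exists_closing {k : ℕ} (hk : k < w.toList.length) (hD : w.isUp k = false) :
    ∃ e : TreeEdge w, e.closing = k := by
  classical
  have himg : (Finset.univ.image (closing : TreeEdge w → ℕ)) =
      (Finset.range w.toList.length).filter fun i => w.isUp i = false := by
    apply Finset.eq_of_subset_of_card_le
    · intro i hi
      obtain ⟨e, -, rfl⟩ := Finset.mem_image.1 hi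
      simp [e.chord.2.2.1, e.chord.2.2.2.1]
    · rw [card_not_up, w.upCount_length, Finset.card_image_of_injective _ closing_injective,
        Finset.card_univ, card_edges, w.length_eq]
      omega
  have : k ∈ Finset.univ.image (closing : TreeEdge w → ℕ) := by
    rw [himg]; simp [hk, hD]
  obtain ⟨e, -, he⟩ := Finset.mem_image.1 this
  exact ⟨e, he⟩

/-- An edge is strictly left to `e` when its down step precedes the up step of `e`, so the count is
the `x`-coordinate of that up step. -/
theorem leftCount_eq (e : TreeEdge w) : e.leftCount = e.opening - e.row := by
  classical
  rw [row_eq, ← card_not_up]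
  refine Finset.card_bij (fun f _ => closing f) ?_ ?_ ?_
  · intro f hf
    simp only [Finset.mem_filter, Finset.mem_univ, true_and, Finset.mem_range] at hf ⊢
    exact ⟨hf, f.chord.2.2.2.1⟩
  · intro f _ g _ h
    exact closing_injective h
  · intro i hi
    simp only [Finset.mem_filter, Finset.mem_range] at hi
    obtain ⟨f, rfl⟩ := exists_closing (hi.1.trans (w.lt_length_of_isUp e.chord.1)) hi.2
    exact ⟨f, by simpa using (show f.StrictlyLeft e from hi.1), rfl⟩

end TreeEdge

/-! ### Lehmer codes and the order on labels -/

namespace DecreasingLabel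

variable {w : DyckWord}

open Classical

theorem ne_of_ne (L : DecreasingLabel w) {e f : TreeEdge w} (h : e ≠ f) : L e ≠ L f :=
  fun h' => h (L.1.injective h')

/-- An earlier edge that is not strictly left is an ancestor, and ancestors carry larger labels. -/
theorem mem_code {L : DecreasingLabel w} {e f : TreeEdge w} :
    (f.opening < e.opening ∧ L f < L e) ↔ (f.StrictlyLeft e ∧ L f < L e) := by
  constructor
  · rintro ⟨h1, h2⟩
    refine ⟨(TreeEdge.below_or_left h1).resolve_left fun h => ?_, h2⟩
    exact absurd (L.2 e f h) (not_lt.2 h2.le)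
  · rintro ⟨h1, h2⟩
    exact ⟨h1.opening_lt, h2⟩

theorem code_eq_left (L : DecreasingLabel w) (e : TreeEdge w) :
    L.code e = (Finset.univ.filter fun f : TreeEdge w => f.StrictlyLeft e ∧ L f < L e).card := by
  unfold code
  congr 1
  ext f
  simp only [Finset.mem_filter, Finset.mem_univ, true_and]
  exact mem_code

/-- The number of edges strictly left to `e` with a larger label. -/
noncomputable def leftLarger (L : DecreasingLabel w) (e : TreeEdge w) : ℕ :=
  (Finset.univ.filter fun f : TreeEdge w => f.StrictlyLeft e ∧ L e < L f).card

theorem code_add_leftLarger (L : DecreasingLabel w) (e : TreeEdge w) :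
    L.code e + L.leftLarger e = e.leftCount := by
  rw [code_eq_left, leftLarger, TreeEdge.leftCount, ← Finset.card_union_of_disjoint]
  · congr 1
    ext f
    simp only [Finset.mem_union, Finset.mem_filter, Finset.mem_univ, true_and]
    constructor
    · rintro (h | h) <;> exact h.1
    · intro h
      have hne : f ≠ e := by rintro rfl; exact absurd h.opening_lt (lt_irrefl _)
      rcases lt_or_gt_of_ne (L.ne_of_ne hne) with h1 | h1
      · exact Or.inl ⟨h, h1⟩
      · exact Or.inr ⟨h, h1⟩
  · rw [Finset.disjoint_left]
    intro f h1 h2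
    simp only [Finset.mem_filter, Finset.mem_univ, true_and] at h1 h2
    exact absurd h1.2 (not_lt.2 h2.2.le)

theorem card_lt (L : DecreasingLabel w) (v : Fin w.semilength) :
    (Finset.univ.filter fun f : TreeEdge w => L f < v).card = v := by
  rw [← Fin.card_Iio v]
  refine Finset.card_bij (fun f _ => L f) ?_ ?_ ?_
  · intro f hf; simpa using hf
  · intro f _ g _ h; exact L.1.injective h
  · intro x hx
    exact ⟨L.1.symm x, by simpa using hx, by simp⟩

/-- A label is determined by its code. -/
theorem code_injective {L L' : DecreasingLabel w} (h : ∀ e, L.code e = L'.code e) : L = L' := by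
  have key : ∀ n, ∀ e : TreeEdge w, e.opening = n → ∀ f : TreeEdge w, f.opening < e.opening →
      (L f < L e ↔ L' f < L' e) := by
    intro n
    induction n using Nat.strong_induction_on with
    | _ n ih =>
      intro e he
      have hsets : (Finset.univ.filter fun f : TreeEdge w => f.opening < e.opening ∧ L f < L e) =
          Finset.univ.filter fun f : TreeEdge w => f.opening < e.opening ∧ L' f < L' e := by
        -- Two different sets of the same size yield an `f` only in the first and a `g` only in the
        -- second. Then `L f < L g` while `L' g < L' f`, although the two labels already agree on
        -- pairs before `e`.
        by_contra hne
        have hcard := h e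
        unfold code at hcard
        obtain ⟨f, hf, hf'⟩ := Finset.not_subset.1 fun hs =>
          hne (Finset.eq_of_subset_of_card_le hs hcard.ge)
        obtain ⟨g, hg, hg'⟩ := Finset.not_subset.1 fun hs =>
          hne (Finset.eq_of_subset_of_card_le hs hcard.le).symm
        simp only [Finset.mem_filter, Finset.mem_univ, true_and, not_and, not_lt] at hf hf' hg hg'
        have h1 : L f < L g := lt_of_lt_of_le hf.2 (hg' hg.1)
        have h2 : L' g < L' f := lt_of_lt_of_le hg.2 (hf' hf.1)
        rcases lt_trichotomy f.opening g.opening with h3 | h3 | h3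
        · have := (ih g.opening (by omega) g rfl f h3).1 h1
          exact absurd this (not_lt.2 h2.le)
        · rw [TreeEdge.opening_injective h3] at h1; exact lt_irrefl _ h1
        · have := (ih f.opening (by omega) f rfl g h3).2 h2
          exact absurd this (not_lt.2 h1.le)
      intro f hf
      have := Finset.ext_iff.1 hsets f
      simpa [hf] using this
  have key2 : ∀ e f : TreeEdge w, L f < L e ↔ L' f < L' e := by
    intro e f
    rcases lt_trichotomy f.opening e.opening with h3 | h3 | h3
    · exact key _ e rfl f h3
    · rw [TreeEdge.opening_injective h3]; simp
    · have hne : f ≠ e := by rintro rfl; exact lt_irrefl _ h3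
      have := key _ f rfl e h3
      have h1 := L.ne_of_ne hne
      have h2 := L'.ne_of_ne hne
      constructor
      · intro h4
        exact lt_of_le_of_ne (not_lt.1 fun h5 => absurd (this.2 h5) (not_lt.2 h4.le)) h2
      · intro h4
        exact lt_of_le_of_ne (not_lt.1 fun h5 => absurd (this.1 h5) (not_lt.2 h4.le)) h1
  apply Subtype.ext
  apply Equiv.ext
  intro e
  apply Fin.ext
  have h1 := L.card_lt (L e)
  have h2 := L'.card_lt (L' e)
  simp only [key2 e] at h1
  exact (h1.symm.trans h2)

/-- A cover moves the larger label to the left. In a set of edges closed under passing to the left,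
the number of small labels can therefore only drop. -/
theorem card_filter_le_of_coveredBy {L L' : DecreasingLabel w} (h : L.CoveredBy L')
    (S : TreeEdge w → Prop) (hS : ∀ l r : TreeEdge w, l.StrictlyLeft r → S r → S l)
    (v : Fin w.semilength) :
    (Finset.univ.filter fun f : TreeEdge w => S f ∧ L' f < v).card ≤
      (Finset.univ.filter fun f : TreeEdge w => S f ∧ L f < v).card := by
  obtain ⟨l, r, hlr, hother, hlt, h1, h2, -⟩ := h
  have hne : l ≠ r := by rintro rfl; exact lt_irrefl _ hlt
  have hL' : ∀ f, L' f = L (Equiv.swap l r f) := by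
    intro f
    by_cases hfl : f = l
    · rw [hfl, Equiv.swap_apply_left, h2]
    · by_cases hfr : f = r
      · rw [hfr, Equiv.swap_apply_right, h1]
      · rw [Equiv.swap_apply_of_ne_of_ne hfl hfr, hother f hfl hfr]
  by_cases hr : S r
  · have hl := hS l r hlr hr
    refine Finset.card_le_card_of_injOn (Equiv.swap l r) ?_ (Equiv.injective _).injOn
    intro f hf
    simp only [Finset.coe_filter, Finset.mem_univ, true_and, Set.mem_ofPred_eq] at hf ⊢
    refine ⟨?_, by rw [← hL']; exact hf.2⟩
    by_cases hfl : f = l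
    · rw [hfl, Equiv.swap_apply_left]; exact hr
    · by_cases hfr : f = r
      · rw [hfr, Equiv.swap_apply_right]; exact hl
      · rw [Equiv.swap_apply_of_ne_of_ne hfl hfr]; exact hf.1
  · refine Finset.card_le_card fun f hf => ?_
    simp only [Finset.mem_filter, Finset.mem_univ, true_and] at hf ⊢
    refine ⟨hf.1, ?_⟩
    by_cases hfl : f = l
    · rw [hfl] at hf ⊢
      exact hlt.trans (h2 ▸ hf.2)
    · have hfr : f ≠ r := by rintro rfl; exact hr hf.1
      rw [hother f hfl hfr]; exact hf.2

theorem card_filter_le_of_le {L L' : DecreasingLabel w} (h : L.Le L')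
    (S : TreeEdge w → Prop) (hS : ∀ l r : TreeEdge w, l.StrictlyLeft r → S r → S l)
    (v : Fin w.semilength) :
    (Finset.univ.filter fun f : TreeEdge w => S f ∧ L' f < v).card ≤
      (Finset.univ.filter fun f : TreeEdge w => S f ∧ L f < v).card := by
  induction h with
  | refl => exact le_rfl
  | tail _ h2 ih => exact (card_filter_le_of_coveredBy h2 S hS v).trans ih

/-- The code of a label above a `312`-avoiding label is smaller. -/
theorem code_le_of_le {L₀ L : DecreasingLabel w} (h0 : ¬ L₀.Contains312) (h : L₀.Le L)
    (e : TreeEdge w) : L.code e ≤ L₀.code e := by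
  rw [code_eq_left, code_eq_left]
  -- This passes to `L₀` but keeps the threshold `L e`. It remains to exclude an `f` strictly left
  -- to `e` with `L₀ e < L₀ f < L e`.
  refine (card_filter_le_of_le h (fun f => f.StrictlyLeft e)
    (fun l r h1 h2 => by
      have := r.chord.2.1
      unfold TreeEdge.StrictlyLeft at *; omega) (L e)).trans ?_
  refine Finset.card_le_card fun f hf => ?_
  simp only [Finset.mem_filter, Finset.mem_univ, true_and] at hf ⊢
  refine ⟨hf.1, ?_⟩
  by_contra hle
  have hfe : f ≠ e := by rintro rfl; exact absurd hf.1.opening_lt (lt_irrefl _)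
  have hlt : L₀ e < L₀ f := lt_of_le_of_ne (not_lt.1 hle) (L₀.ne_of_ne hfe.symm)
  -- From `e` on, a label above `L₀ f` would make a `312`-pattern with `e` and `f`, or would belong
  -- to a descendant of `e`, which is impossible.
  have hsmall : ∀ g : TreeEdge w, ¬ g.opening < e.opening → L₀ g < L₀ f := by
    intro g hg
    rcases Nat.eq_or_lt_of_le (not_lt.1 hg) with h1 | h1
    · rw [← TreeEdge.opening_injective h1]; exact hlt
    · rcases TreeEdge.below_or_left h1 with h2 | h2
      · exact (L₀.2 g e h2).trans hlt
      · by_contra h3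
        have hgf : g ≠ f := by
          rintro rfl
          have := hf.1.opening_lt
          omega
        exact h0 ⟨g, e, f, h2, hf.1, hlt,
          lt_of_le_of_ne (not_lt.1 h3) (L₀.ne_of_ne hgf.symm)⟩
  -- Every label has exactly `L₀ f` values below `L₀ f`; they are split into those before `e` and
  -- those from `e` on.
  have hsplit : ∀ M : DecreasingLabel w,
      (Finset.univ.filter fun g : TreeEdge w => g.opening < e.opening ∧ M g < L₀ f).card +
      (Finset.univ.filter fun g : TreeEdge w => ¬ g.opening < e.opening ∧ M g < L₀ f).card =
        L₀ f := by
    intro M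
    rw [← M.card_lt (L₀ f), ← Finset.card_filter_add_card_filter_not
      (s := Finset.univ.filter fun g : TreeEdge w => M g < L₀ f) (fun g => g.opening < e.opening),
      Finset.filter_filter, Finset.filter_filter]
    simp only [and_comm]
  have h1 := hsplit L
  have h2 := hsplit L₀
  have h3 : (Finset.univ.filter fun g : TreeEdge w => g.opening < e.opening ∧ L g < L₀ f).card ≤
      (Finset.univ.filter fun g : TreeEdge w => g.opening < e.opening ∧ L₀ g < L₀ f).card := by
    convert card_filter_le_of_le h (fun g => g.opening < e.opening)
      (fun l r h1 h2 => h1.opening_lt.trans h2) (L₀ f)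
  have h4 : (Finset.univ.filter fun g : TreeEdge w => ¬ g.opening < e.opening ∧ L₀ g < L₀ f) =
      Finset.univ.filter fun g : TreeEdge w => ¬ g.opening < e.opening := by
    ext g
    simp only [Finset.mem_filter, Finset.mem_univ, true_and]
    exact ⟨fun h => h.1, fun h => ⟨h, hsmall g h⟩⟩
  -- The part before `e` cannot have grown and the other part was already full under `L₀`, so it
  -- stays full under `L`. This gives `L e < L₀ f`.
  have h5 : (Finset.univ.filter fun g : TreeEdge w => ¬ g.opening < e.opening ∧ L g < L₀ f) =
      Finset.univ.filter fun g : TreeEdge w => ¬ g.opening < e.opening := by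
    apply Finset.eq_of_subset_of_card_le
    · intro g hg
      simp only [Finset.mem_filter, Finset.mem_univ, true_and] at hg ⊢
      exact hg.1
    · rw [← h4]; omega
  have h6 : e ∈ Finset.univ.filter fun g : TreeEdge w => ¬ g.opening < e.opening := by simp
  rw [← h5] at h6
  simp only [Finset.mem_filter, Finset.mem_univ, true_and] at h6
  exact absurd (h6.2.trans hf.2) (lt_irrefl _)

/-- The number of boxes in the rows of a region between `w` and a path above `w` (in terms of the
edges, whose up steps are in the rows). -/
def RowMonotone (c : TreeEdge w → ℕ) : Prop :=
  ∀ e f : TreeEdge w, e.opening < f.opening → e.leftCount + c f ≤ f.leftCount + c e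

/-- Decrease one entry of the code by one. -/
theorem exists_coveredBy_code (M : DecreasingLabel w) {c : TreeEdge w → ℕ}
    (hc : RowMonotone c) {r : TreeEdge w} (hr : c r < M.code r)
    (hlast : ∀ g : TreeEdge w, r.opening < g.opening → c g = M.code g) :
    ∃ M' : DecreasingLabel w, M.CoveredBy M' ∧ M'.code r + 1 = M.code r ∧
      ∀ e, e ≠ r → M'.code e = M.code e := by
  -- The partner `l` has the next smaller label among the edges before `r`, so the swap affects no
  -- other comparison there.
  obtain ⟨l, hl, hmax⟩ := Finset.exists_max_image
    (Finset.univ.filter fun f : TreeEdge w => f.opening < r.opening ∧ M f < M r) M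
    (by
      rw [← Finset.card_pos]
      exact lt_of_le_of_lt (Nat.zero_le _) hr)
  simp only [Finset.mem_filter, Finset.mem_univ, true_and, and_imp] at hl hmax
  obtain ⟨hlr, hMlr⟩ := hl
  have hleft : l.StrictlyLeft r := (mem_code.1 ⟨hlr, hMlr⟩).1
  have hne : l ≠ r := by rintro rfl; exact lt_irrefl _ hMlr
  have hgapl : ∀ f : TreeEdge w, f.opening < r.opening → M l < M f → M r < M f := by
    intro f h1 h2
    by_contra h3
    have hfr : f ≠ r := by rintro rfl; exact lt_irrefl _ h1
    exact absurd (hmax f h1 (lt_of_le_of_ne (not_lt.1 h3) (M.ne_of_ne hfr))) (not_le.2 h2)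
  -- The swap is a decreasing label only if the descendants of `r` lie below `M l`. For the first
  -- descendant `g` that violates this, `g` and `r` have equal `leftLarger`, hence equal `leftCount
  -- - code`. Since `c` equals the code at `g` but is smaller at `r`, this contradicts the row
  -- monotonicity of `c`.
  have hbelow : ∀ g : TreeEdge w, g.IsBelow r → M g < M l := by
    intro g0 hg0
    by_contra hcon
    have hcon' : M l < M g0 := by
      refine lt_of_le_of_ne (not_lt.1 hcon) (M.ne_of_ne ?_)
      rintro rfl
      have := hg0.1
      omega
    obtain ⟨g, hg, hgmin⟩ := Finset.exists_min_image
      (Finset.univ.filter fun f : TreeEdge w => f.IsBelow r ∧ M l < M f) TreeEdge.opening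
      ⟨g0, by simpa using ⟨hg0, hcon'⟩⟩
    simp only [Finset.mem_filter, Finset.mem_univ, true_and, and_imp] at hg hgmin
    obtain ⟨hgr, hlg⟩ := hg
    have hy : M.leftLarger g = M.leftLarger r := by
      unfold leftLarger
      congr 1
      ext f
      simp only [Finset.mem_filter, Finset.mem_univ, true_and]
      have hg1 := hgr.1
      have hg2 := hgr.2
      have hg3 := g.chord.2.1
      constructor
      · rintro ⟨h1, h2⟩
        have h1' : f.closing < g.opening := h1
        rcases lt_trichotomy f.opening r.opening with h3 | h3 | h3
        · rcases TreeEdge.below_or_left h3 with h4 | h4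
          · have := h4.2; omega
          · exact ⟨h4, hgapl f h3 (hlg.trans h2)⟩
        · rw [TreeEdge.opening_injective h3] at h1'; omega
        · rcases TreeEdge.below_or_left h3 with h4 | h4
          · have := hgmin f h4 (hlg.trans h2)
            have := h1.opening_lt
            omega
          · have h4' : r.closing < f.opening := h4
            have := h1.opening_lt
            omega
      · rintro ⟨h1, h2⟩
        have h1' : f.closing < r.opening := h1
        exact ⟨show f.closing < g.opening by omega, (M.2 g r hgr).trans h2⟩
    have h1 := M.code_add_leftLarger g
    have h2 := M.code_add_leftLarger r
    have h3 := hc r g hgr.1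
    have h4 := hlast g hgr.1
    omega
  have hother : ∀ e, e ≠ l → e ≠ r → Equiv.swap l r e = e := fun e h1 h2 =>
    Equiv.swap_apply_of_ne_of_ne h1 h2
  let M' : DecreasingLabel w := ⟨(Equiv.swap l r).trans M.1, by
    intro e f hef
    change M (Equiv.swap l r e) < M (Equiv.swap l r f)
    by_cases hel : e = l
    · have hfl : f ≠ l := by
        rintro rfl; rw [hel] at hef; exact lt_irrefl _ hef.1
      have hfr : f ≠ r := by
        rintro rfl; rw [hel] at hef; have := hef.1; omega
      rw [hel, Equiv.swap_apply_left, hother f hfl hfr]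
      rw [hel] at hef
      exact hgapl f (hef.1.trans hlr) (M.2 l f hef)
    · by_cases her : e = r
      · have hfr : f ≠ r := by
          rintro rfl; rw [her] at hef; exact lt_irrefl _ hef.1
        have hfl : f ≠ l := by
          rintro rfl; rw [her] at hef; exact hef.not_left hleft
        rw [her, Equiv.swap_apply_right, hother f hfl hfr]
        rw [her] at hef
        exact hMlr.trans (M.2 r f hef)
      · rw [hother e hel her]
        by_cases hfl : f = l
        · rw [hfl, Equiv.swap_apply_left]
          rw [hfl] at hef
          exact (M.2 e l hef).trans hMlr
        · by_cases hfr : f = r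
          · rw [hfr, Equiv.swap_apply_right]
            rw [hfr] at hef
            exact hbelow e hef
          · rw [hother f hfl hfr]; exact M.2 e f hef⟩
  have hM' : ∀ e, M' e = M (Equiv.swap l r e) := fun e => rfl
  have hM'l : M' l = M r := by rw [hM', Equiv.swap_apply_left]
  have hM'r : M' r = M l := by rw [hM', Equiv.swap_apply_right]
  have hM'o : ∀ e, e ≠ l → e ≠ r → M' e = M e := fun e h1 h2 => by rw [hM', hother e h1 h2]
  refine ⟨M', ⟨l, r, hleft, fun e h1 h2 => (hM'o e h1 h2).symm, hMlr, hM'r, hM'l, ?_⟩, ?_, ?_⟩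
  · rintro ⟨f, h1, h2, h3, h4⟩
    have hfl : f ≠ l := by rintro rfl; exact lt_irrefl _ h1.opening_lt
    exact absurd (hgapl f h2.opening_lt (lt_of_le_of_ne h3 (M.ne_of_ne hfl.symm)))
      (not_lt.2 h4)
  · unfold code
    rw [← Finset.card_erase_add_one (s := Finset.univ.filter fun f : TreeEdge w =>
      f.opening < r.opening ∧ M f < M r) (a := l) (by simpa using ⟨hlr, hMlr⟩)]
    congr 2
    ext f
    simp only [Finset.mem_erase, Finset.mem_filter, Finset.mem_univ, true_and]
    by_cases hfl : f = l
    · rw [hfl, hM'l, hM'r]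
      simp [hMlr.le]
    · constructor
      · rintro ⟨h1, h2⟩
        have hfr : f ≠ r := by rintro rfl; exact lt_irrefl _ h1
        rw [hM'o f hfl hfr, hM'r] at h2
        exact ⟨hfl, h1, h2.trans hMlr⟩
      · rintro ⟨-, h1, h2⟩
        have hfr : f ≠ r := by rintro rfl; exact lt_irrefl _ h1
        rw [hM'o f hfl hfr, hM'r]
        exact ⟨h1, lt_of_le_of_ne (hmax f h1 h2) (M.ne_of_ne hfl)⟩
  · intro e her
    unfold code
    rcases lt_or_ge e.opening r.opening with h1 | h1
    -- Before `r` no label lies strictly between `M l` and `M r`, so replacing one by the other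
    -- changes no comparison.
    · congr 1
      ext f
      simp only [Finset.mem_filter, Finset.mem_univ, true_and]
      refine and_congr_right fun h2 => ?_
      have hfr : f ≠ r := by rintro rfl; omega
      by_cases hel : e = l
      · have hfl : f ≠ l := by rintro rfl; rw [hel] at h2; exact lt_irrefl _ h2
        rw [hM'o f hfl hfr, hel, hM'l]
        constructor
        · intro h3
          exact lt_of_le_of_ne (hmax f (h2.trans h1) h3) (M.ne_of_ne hfl)
        · intro h3; exact h3.trans hMlr
      · rw [hM'o e hel her]
        by_cases hfl : f = l
        · rw [hfl, hM'l]
          exact ⟨fun h3 => hMlr.trans h3, fun h3 => hgapl e h1 h3⟩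
        · rw [hM'o f hfl hfr]
    · have h2 : r.opening < e.opening := lt_of_le_of_ne h1 fun h =>
        her (TreeEdge.opening_injective h).symm
      have hel : e ≠ l := by rintro rfl; omega
      rw [hM'o e hel her]
      -- After `r` both swapped edges precede `e`, so the set of earlier labels is the same.
      refine Finset.card_bij (fun f _ => Equiv.swap l r f) ?_ ?_ ?_
      · intro f hf
        simp only [Finset.mem_filter, Finset.mem_univ, true_and, hM'] at hf ⊢
        refine ⟨?_, hf.2⟩
        rw [Equiv.swap_apply_def]
        split_ifs <;> omega
      · intro f _ g _ h
        exact (Equiv.swap l r).injective h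
      · intro f hf
        simp only [Finset.mem_filter, Finset.mem_univ, true_and] at hf
        refine ⟨Equiv.swap l r f, ?_, Equiv.swap_apply_self _ _ _⟩
        simp only [Finset.mem_filter, Finset.mem_univ, true_and, hM', Equiv.swap_apply_self]
        refine ⟨?_, hf.2⟩
        rw [Equiv.swap_apply_def]
        split_ifs <;> omega

/-- Every smaller row monotone sequence is the code of a label above `M`. -/
theorem exists_le_code_eq (M : DecreasingLabel w) {c : TreeEdge w → ℕ}
    (hc : RowMonotone c) (hle : ∀ e, c e ≤ M.code e) :
    ∃ L : DecreasingLabel w, M.Le L ∧ ∀ e, L.code e = c e := by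
  induction hn : ∑ e, M.code e using Nat.strong_induction_on generalizing M with
  | _ n ih =>
    by_cases heq : ∀ e, M.code e = c e
    · exact ⟨M, Relation.ReflTransGen.refl, heq⟩
    · push Not at heq
      obtain ⟨r0, hr0⟩ := heq
      -- Lowering the last entry that is too large ensures that the later entries already agree with
      -- `c`.
      obtain ⟨r, hr, hmax⟩ := Finset.exists_max_image
        (Finset.univ.filter fun f : TreeEdge w => c f < M.code f) TreeEdge.opening
        ⟨r0, by simpa using lt_of_le_of_ne (hle r0) hr0.symm⟩
      simp only [Finset.mem_filter, Finset.mem_univ, true_and] at hr hmax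
      obtain ⟨M', h1, h2, h3⟩ := M.exists_coveredBy_code hc hr fun g hg => by
        by_contra hne
        have := hmax g (lt_of_le_of_ne (hle g) hne)
        omega
      obtain ⟨L, hL, hL'⟩ := ih (∑ e, M'.code e) (by
        rw [← hn]
        refine Finset.sum_lt_sum (fun e _ => ?_) ⟨r, Finset.mem_univ _, by omega⟩
        by_cases her : e = r
        · rw [her]; omega
        · exact (h3 e her).le) M' (fun e => by
        by_cases her : e = r
        · rw [her]; omega
        · rw [h3 e her]; exact hle e) rfl
      exact ⟨L, Relation.ReflTransGen.head h1 hL, hL'⟩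

end DecreasingLabel

/-! ### Boxes above a path -/

namespace DyckWord

theorem upCount_le_row_iff {w : DyckWord} (e : TreeEdge w) (k : ℕ) :
    upCount w.isUp k ≤ e.row ↔ k ≤ e.opening := by
  rw [e.row_eq]
  constructor
  · intro h
    by_contra hlt
    have h1 := upCount_mono (a := w.isUp) (show e.opening + 1 ≤ k by omega)
    rw [upCount_succ, if_pos e.chord.1] at h1
    omega
  · exact fun h => upCount_mono h

theorem upCol_row {w : DyckWord} (e : TreeEdge w) : w.upCol e.row = e.opening - e.row := by
  classical
  rw [e.row_eq, ← TreeEdge.card_not_up, ← e.row_eq]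
  refine Finset.card_bij (fun j _ => (j : ℕ)) ?_ ?_ ?_
  · intro j hj
    simp only [Finset.mem_filter, Finset.mem_univ, true_and, Finset.mem_range] at hj ⊢
    rw [count_U_take, upCount_le_row_iff] at hj
    have h1 : w.isUp j = false := (w.getElem?_eq_D.1 (by simpa using hj.1)).2
    refine ⟨lt_of_le_of_ne hj.2 fun h => ?_, h1⟩
    rw [h, e.chord.1] at h1
    simp at h1
  · intro i _ j _ h
    exact Fin.ext h
  · intro i hi
    simp only [Finset.mem_filter, Finset.mem_range] at hi
    have hlen := hi.1.trans (w.lt_length_of_isUp e.chord.1)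
    refine ⟨⟨i, hlen⟩, ?_, rfl⟩
    simp only [Finset.mem_filter, Finset.mem_univ, true_and]
    rw [count_U_take, upCount_le_row_iff]
    refine ⟨?_, hi.1.le⟩
    have := w.getElem?_eq_D.2 ⟨hlen, hi.2⟩
    simpa [hlen] using this

variable (w : DyckWord)

/-- The box `b` sits above position `b.1 + b.2 + 1`, which turns the condition on rows into one on
positions. Negative positions are truncated to `0`, where the count vanishes. -/
theorem boxAbove_iff (b : ℤ × ℤ) : w.BoxAbove b ↔
    0 ≤ b.2 ∧ b.2 < w.semilength ∧ (upCount w.isUp (b.1 + b.2 + 1).toNat : ℤ) ≤ b.2 := by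
  have key : ∀ r : ℕ, r < w.semilength → b.2 = r →
      (b.1 < w.upCol r ↔ (upCount w.isUp (b.1 + b.2 + 1).toNat : ℤ) ≤ b.2) := by
    intro r hr hb
    obtain ⟨e, rfl⟩ := TreeEdge.exists_row hr
    rw [upCol_row, hb, Nat.cast_le, upCount_le_row_iff]
    have : e.row ≤ e.opening := by rw [e.row_eq]; exact upCount_le _
    omega
  constructor
  · rintro ⟨r, hr, hb, h⟩
    exact ⟨by omega, by omega, (key r hr hb).1 h⟩
  · rintro ⟨h1, h2, h3⟩
    obtain ⟨r, hr⟩ : ∃ r : ℕ, b.2 = r := ⟨b.2.toNat, by omega⟩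
    exact ⟨r, by omega, hr, (key r (by omega) hr).2 h3⟩

/-- The box in the layer `j` above the position `k` of `w`. -/
def cell (k j : ℕ) : ℤ × ℤ :=
  ((k : ℤ) - upCount w.isUp k - 1 - j, (upCount w.isUp k : ℤ) + j)

variable {w}

theorem cell_fst (k j : ℕ) : (w.cell k j).1 = (k : ℤ) - upCount w.isUp k - 1 - j := rfl

theorem cell_snd (k j : ℕ) : (w.cell k j).2 = (upCount w.isUp k : ℤ) + j := rfl

theorem cell_sum (k j : ℕ) : (w.cell k j).1 + (w.cell k j).2 + 1 = k := by
  rw [cell_fst, cell_snd]; ring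

theorem cell_inj {k j k' j' : ℕ} (h : w.cell k j = w.cell k' j') : k = k' ∧ j = j' := by
  have h1 := cell_sum (w := w) k j
  rw [h, cell_sum] at h1
  have hk : k = k' := by omega
  subst hk
  have h2 := congrArg Prod.snd h
  rw [cell_snd, cell_snd] at h2
  exact ⟨rfl, by omega⟩

theorem cell_down (k j : ℕ) : w.cell k (j + 1) + (1, -1) = w.cell k j := by
  ext
  · simp only [Prod.fst_add, cell_fst]; push_cast; ring
  · simp only [Prod.snd_add, cell_snd]; push_cast; ring

theorem cell_zero_down (k : ℕ) : ¬ w.BoxAbove (w.cell k 0 + (1, -1)) := by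
  rw [boxAbove_iff]
  rintro ⟨-, -, h⟩
  simp only [Prod.fst_add, Prod.snd_add] at h
  rw [show (w.cell k 0).1 + 1 + ((w.cell k 0).2 + -1) + 1 = (w.cell k 0).1 + (w.cell k 0).2 + 1 by
    ring, cell_sum, cell_snd, Int.toNat_natCast] at h
  simp at h

theorem cell_boxAbove {k j : ℕ} (h : upCount w.isUp k + j < w.semilength) :
    w.BoxAbove (w.cell k j) := by
  rw [boxAbove_iff, cell_sum, cell_snd, Int.toNat_natCast]
  omega

theorem mem_region_iff {top : DyckWord} (hs : top.semilength = w.semilength) (b : ℤ × ℤ) :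
    (w.BoxAbove b ∧ ¬ top.BoxAbove b) ↔
      ∃ k j, j < gap w.isUp top.isUp k ∧ b = w.cell k j := by
  rw [boxAbove_iff, boxAbove_iff]
  constructor
  · rintro ⟨⟨h1, h2, h3⟩, h4⟩
    have h5 : b.2 < upCount top.isUp (b.1 + b.2 + 1).toNat := by
      by_contra h6
      exact h4 ⟨h1, by omega, by omega⟩
    have h6 : 0 ≤ b.1 + b.2 + 1 := by
      by_contra h7
      rw [Int.toNat_of_nonpos (by omega)] at h5
      simp at h5
      omega
    obtain ⟨k, hk⟩ : ∃ k : ℕ, b.1 + b.2 + 1 = k := ⟨(b.1 + b.2 + 1).toNat, by omega⟩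
    rw [hk, Int.toNat_natCast] at h3 h5
    refine ⟨k, (b.2 - upCount w.isUp k).toNat, by unfold gap; omega, ?_⟩
    ext
    · rw [cell_fst]; omega
    · rw [cell_snd]; omega
  · rintro ⟨k, j, hj, rfl⟩
    unfold gap at hj
    have := top.upCount_le_semilength k
    rw [cell_sum, cell_snd, Int.toNat_natCast]
    omega

end DyckWord

/-! ### Tiles as runs of boxes -/

namespace DyckTile

variable {w : DyckWord} {t : DyckTile}

/-- The number of steps of the tile. -/
def len (t : DyckTile) : ℕ := t.path.toList.length

theorem len_eq (t : DyckTile) : t.len = 2 * t.size := t.path.length_eq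

/-- The box number `i` of the tile. -/
def box (t : DyckTile) (i : ℕ) : ℤ × ℤ :=
  t.start + ((i : ℤ) - upCount t.path.isUp i, (upCount t.path.isUp i : ℤ))

theorem mem_boxes {b : ℤ × ℤ} : b ∈ t.boxes ↔ ∃ i ≤ t.len, b = t.box i := by
  have h : ∀ i ≤ t.len, t.start + (((t.path.toList.take i).count D : ℤ),
      ((t.path.toList.take i).count U : ℤ)) = t.box i := by
    intro i hi
    rw [DyckWord.count_U_take, DyckWord.count_D_take _ hi, box,
      Nat.cast_sub (upCount_le _)]
  constructor
  · rintro ⟨i, hi, rfl⟩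
    exact ⟨i, hi, h i hi⟩
  · rintro ⟨i, hi, rfl⟩
    exact ⟨i, hi, (h i hi).symm⟩

theorem box_sum (i : ℕ) : (t.box i).1 + (t.box i).2 = t.start.1 + t.start.2 + i := by
  simp only [box, Prod.fst_add, Prod.snd_add]; ring

theorem box_mem {i : ℕ} (hi : i ≤ t.len) : t.box i ∈ t.boxes := mem_boxes.2 ⟨i, hi, rfl⟩

theorem box_zero : t.box 0 = t.start := by simp [box]

theorem box_snd_ge (i : ℕ) : t.start.2 ≤ (t.box i).2 := by
  simp [box]

/-- The tile consists of the boxes in the layer `j` above the positions `p, ..., p + t.len`. -/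
def IsRun (w : DyckWord) (t : DyckTile) (p j : ℕ) : Prop :=
  ∀ i ≤ t.len, t.box i = w.cell (p + i) j

namespace IsRun

variable {p j : ℕ}

theorem start_eq (h : IsRun w t p j) : t.start = w.cell p j := by
  have := h 0 (Nat.zero_le _)
  rwa [box_zero] at this

theorem upCount_eq (h : IsRun w t p j) {i : ℕ} (hi : i ≤ t.len) :
    upCount w.isUp (p + i) = upCount w.isUp p + upCount t.path.isUp i := by
  have h1 := congrArg Prod.snd (h i hi)
  simp only [box, Prod.snd_add, h.start_eq, DyckWord.cell_snd] at h1
  omega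

theorem isUp_eq (h : IsRun w t p j) {i : ℕ} (hi : i < t.len) :
    t.path.isUp i = w.isUp (p + i) := by
  have h1 := h.upCount_eq hi.le
  have h2 := h.upCount_eq (i := i + 1) hi
  rw [← add_assoc, upCount_succ, upCount_succ] at h2
  cases h3 : t.path.isUp i <;> cases h4 : w.isUp (p + i) <;> simp [h3, h4] at h2 ⊢ <;> omega

theorem mem_boxes_iff (h : IsRun w t p j) {k j' : ℕ} :
    w.cell k j' ∈ t.boxes ↔ j' = j ∧ p ≤ k ∧ k ≤ p + t.len := by
  rw [mem_boxes]
  constructor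
  · rintro ⟨i, hi, h1⟩
    rw [h i hi] at h1
    obtain ⟨rfl, rfl⟩ := DyckWord.cell_inj h1
    exact ⟨rfl, by omega, by omega⟩
  · rintro ⟨rfl, h1, h2⟩
    exact ⟨k - p, by omega, by rw [h _ (by omega)]; congr 1; omega⟩

theorem entryEdge_eq (h : IsRun w t p j) : t.entryEdge = w.cell (p + t.len) j + (1, 0) := by
  rw [← h t.len le_rfl, box, entryEdge, len, DyckWord.upCount_length, DyckWord.length_eq]
  ext
  · simp only [Prod.fst_add, size]; push_cast; ring
  · simp only [Prod.snd_add, size]; ring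

theorem ht_eq (h : IsRun w t p j) {i : ℕ} (hi : i ≤ t.len) :
    ht w.isUp (p + i) = ht w.isUp p + ht t.path.isUp i := by
  unfold ht
  rw [h.upCount_eq hi]
  push_cast; ring

end IsRun

theorem eq_of_run {t₁ t₂ : DyckTile} {p j : ℕ} (h₁ : IsRun w t₁ p j) (h₂ : IsRun w t₂ p j)
    (hl : t₁.len = t₂.len) : t₁ = t₂ := by
  have hs : t₁.start = t₂.start := h₁.start_eq.trans h₂.start_eq.symm
  have hp : t₁.path = t₂.path := by
    apply DyckWord.ext
    apply List.ext_getElem?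
    intro i
    have hl' : t₁.path.toList.length = t₂.path.toList.length := hl
    rcases lt_or_ge i t₁.path.toList.length with hi | hi
    · have h3 := h₁.isUp_eq hi
      rw [← h₂.isUp_eq (hl ▸ (show i < t₁.len from hi))] at h3
      cases h4 : t₂.path.isUp i
      · rw [h4] at h3
        rw [t₁.path.getElem?_eq_D.2 ⟨hi, h3⟩, t₂.path.getElem?_eq_D.2 ⟨hl' ▸ hi, h4⟩]
      · rw [h4] at h3
        rw [t₁.path.getElem?_eq_U.2 h3, t₂.path.getElem?_eq_U.2 h4]
    · rw [List.getElem?_eq_none hi, List.getElem?_eq_none (hl' ▸ hi)]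
  cases t₁; cases t₂
  simp only at hs hp
  rw [hs, hp]

end DyckTile

/-! ### From tilings to layered data -/

namespace DyckTiling

variable {w : DyckWord}

theorem ext' {D₁ D₂ : DyckTiling w} (h : D₁.top = D₂.top) (h' : D₁.tiles = D₂.tiles) :
    D₁ = D₂ := by
  cases D₁; cases D₂
  simp only at h h'
  subst h h'
  rfl

variable (D : DyckTiling w)

theorem above (k : ℕ) : upCount w.isUp k ≤ upCount D.top.isUp k := by
  have := D.top_above k
  rwa [DyckWord.count_U_take, DyckWord.count_U_take] at this

theorem mem_union_iff (b : ℤ × ℤ) :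
    (∃ t ∈ D.tiles, b ∈ t.boxes) ↔ ∃ k j, j < gap w.isUp D.top.isUp k ∧ b = w.cell k j := by
  rw [← DyckWord.mem_region_iff D.semilength_top]
  have := Set.ext_iff.1 D.union b
  simpa using this

theorem cell_mem_iff {k j : ℕ} :
    (∃ t ∈ D.tiles, w.cell k j ∈ t.boxes) ↔ j < gap w.isUp D.top.isUp k := by
  rw [mem_union_iff]
  constructor
  · rintro ⟨k', j', h, h'⟩
    obtain ⟨rfl, rfl⟩ := DyckWord.cell_inj h'
    exact h
  · exact fun h => ⟨k, j, h, rfl⟩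

theorem tile_unique {t t' : DyckTile} (ht : t ∈ D.tiles) (ht' : t' ∈ D.tiles) {b : ℤ × ℤ}
    (hb : b ∈ t.boxes) (hb' : b ∈ t'.boxes) : t = t' := by
  by_contra hne
  exact Set.disjoint_left.1 (D.disjoint ht ht' hne) hb hb'

/-- Induction on the height of the first box. A tile over another tile is one layer above a part of
a run. A tile whose downward shift is below `w` is in layer `0`, since any box of a higher layer
moves down onto a box above `w`. -/
theorem exists_isRun {t : DyckTile} (ht : t ∈ D.tiles) : ∃ p j, DyckTile.IsRun w t p j := by
  induction hn : t.start.2.toNat using Nat.strong_induction_on generalizing t with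
  | _ n ih =>
    have hbox : ∀ i, i ≤ t.len → ∃ k j, j < gap w.isUp D.top.isUp k ∧ t.box i = w.cell k j :=
      fun i hi => (D.mem_union_iff _).1 ⟨t, ht, DyckTile.box_mem hi⟩
    obtain ⟨p, j₀, hgap, hp⟩ := hbox 0 (Nat.zero_le _)
    rw [DyckTile.box_zero] at hp
    have hpos : ∀ i k j, t.box i = w.cell k j → k = p + i := by
      intro i k j h
      have h1 := DyckTile.box_sum (t := t) i
      rw [h, hp] at h1
      have h2 := DyckWord.cell_sum (w := w) k j
      have h3 := DyckWord.cell_sum (w := w) p j₀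
      omega
    rcases D.cover_inclusive t ht with ⟨t', ht', hsub⟩ | hbelow
    · have hstart : t'.start.2 < t.start.2 ∧ 0 ≤ t'.start.2 := by
        constructor
        · obtain ⟨i, hi, h1⟩ := DyckTile.mem_boxes.1
            (hsub t.start (by rw [← DyckTile.box_zero]; exact DyckTile.box_mem (Nat.zero_le _)))
          have h2 := DyckTile.box_snd_ge (t := t') i
          have h3 := congrArg Prod.snd h1
          simp only [Prod.snd_add] at h3
          omega
        · obtain ⟨k, j, -, h1⟩ := (D.mem_union_iff _).1
            ⟨t', ht', DyckTile.box_mem (t := t') (Nat.zero_le _)⟩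
          rw [DyckTile.box_zero] at h1
          rw [h1, DyckWord.cell_snd]; omega
      obtain ⟨p', j', hrun⟩ := ih _ (by omega) ht' rfl
      refine ⟨p, j' + 1, fun i hi => ?_⟩
      obtain ⟨i', hi', h1⟩ := DyckTile.mem_boxes.1 (hsub _ (DyckTile.box_mem hi))
      rw [hrun i' hi', ← DyckWord.cell_down] at h1
      have h2 := add_right_cancel h1
      rw [h2, hpos i _ _ h2]
    · refine ⟨p, 0, fun i hi => ?_⟩
      obtain ⟨k, j, hj, h1⟩ := hbox i hi
      rcases Nat.eq_zero_or_pos j with rfl | hj0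
      · rw [h1, hpos i _ _ h1]
      · exfalso
        obtain ⟨j, rfl⟩ : ∃ m, j = m + 1 := ⟨j - 1, by omega⟩
        have h2 := hbelow _ (DyckTile.box_mem hi)
        rw [h1, DyckWord.cell_down] at h2
        refine h2 (DyckWord.cell_boxAbove ?_)
        have h3 := D.top.upCount_le_semilength k
        have h4 := D.semilength_top
        unfold gap at hj
        omega

/-- The boxes above the positions `k` and `k + 1` in the layer `j` are in the same tile. -/
def Joint (k j : ℕ) : Prop := ∃ t ∈ D.tiles, w.cell k j ∈ t.boxes ∧ w.cell (k + 1) j ∈ t.boxes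

theorem Joint.lt_gap {k j : ℕ} (h : D.Joint k j) : j < gap w.isUp D.top.isUp k := by
  obtain ⟨t, ht, h1, -⟩ := h
  exact D.cell_mem_iff.1 ⟨t, ht, h1⟩

theorem Joint.lt_gap_succ {k j : ℕ} (h : D.Joint k j) : j < gap w.isUp D.top.isUp (k + 1) := by
  obtain ⟨t, ht, -, h1⟩ := h
  exact D.cell_mem_iff.1 ⟨t, ht, h1⟩

/-- The tile moved down lies in another tile by cover-inclusiveness; it cannot be below `w`, because
layer `j` is above it. -/
theorem Joint.of_succ {k j : ℕ} (h : D.Joint k (j + 1)) : D.Joint k j := by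
  have hlt := h.lt_gap
  obtain ⟨t, ht, h1, h2⟩ := h
  rcases D.cover_inclusive t ht with ⟨t', ht', hsub⟩ | hbelow
  · refine ⟨t', ht', ?_, ?_⟩
    · rw [← DyckWord.cell_down]; exact hsub _ h1
    · rw [← DyckWord.cell_down]; exact hsub _ h2
  · exfalso
    have h3 := hbelow _ h1
    rw [DyckWord.cell_down] at h3
    refine h3 (DyckWord.cell_boxAbove ?_)
    have h3 := D.top.upCount_le_semilength k
    have h4 := D.semilength_top
    unfold gap at hlt
    omega

theorem Joint.mono {k j j' : ℕ} (h : D.Joint k j) (hj : j' ≤ j) : D.Joint k j' := by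
  induction j, hj using Nat.le_induction with
  | base => exact h
  | succ j hj ih => exact ih h.of_succ

theorem exists_not_joint (k : ℕ) : ∃ j, ¬ D.Joint k j :=
  ⟨gap w.isUp D.top.isUp k, fun h => lt_irrefl _ h.lt_gap⟩

open Classical in
/-- The number of layers in which the boxes above `k` and `k + 1` are in the same tile. -/
noncomputable def jointCount (k : ℕ) : ℕ := Nat.find (D.exists_not_joint k)

theorem joint_iff {k j : ℕ} : D.Joint k j ↔ j < D.jointCount k := by
  classical
  constructor
  · intro h
    by_contra hle
    exact Nat.find_spec (D.exists_not_joint k) (h.mono D (not_lt.1 hle))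
  · intro h
    exact not_not.1 (Nat.find_min (D.exists_not_joint k) h)

theorem tile_ends {t : DyckTile} {p j : ℕ} (ht : t ∈ D.tiles) (h : DyckTile.IsRun w t p j) :
    D.jointCount (p + t.len) ≤ j ∧ (∀ k, p ≤ k → k < p + t.len → j < D.jointCount k) := by
  constructor
  · by_contra hlt
    obtain ⟨t', ht', h1, h2⟩ := D.joint_iff.2 (not_le.1 hlt)
    have := D.tile_unique ht ht' (h.mem_boxes_iff.2 ⟨rfl, by omega, le_rfl⟩) h1
    subst this
    have := (h.mem_boxes_iff.1 h2).2.2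
    omega
  · intro k h1 h2
    exact D.joint_iff.1 ⟨t, ht, h.mem_boxes_iff.2 ⟨rfl, h1, h2.le⟩,
      h.mem_boxes_iff.2 ⟨rfl, by omega, by omega⟩⟩

theorem tile_starts {t : DyckTile} {p j : ℕ} (ht : t ∈ D.tiles) (h : DyckTile.IsRun w t (p + 1) j) :
    D.jointCount p ≤ j := by
  by_contra hlt
  obtain ⟨t', ht', h1, h2⟩ := D.joint_iff.2 (not_le.1 hlt)
  have := D.tile_unique ht ht' (h.mem_boxes_iff.2 ⟨rfl, le_rfl, by omega⟩) h2
  subst this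
  have := (h.mem_boxes_iff.1 h1).2.1
  omega

theorem tilingData : TilingData w.isUp D.top.isUp D.jointCount := by
  constructor
  · refine ⟨w.toList.length, fun k hk => ?_⟩
    have hlen : D.top.toList.length = w.toList.length := by
      rw [DyckWord.length_eq, DyckWord.length_eq, D.semilength_top]
    refine ⟨w.isUp_of_ge hk, D.top.isUp_of_ge (by omega), ?_⟩
    have h1 := upCount_mono (a := w.isUp) hk
    have h2 := upCount_mono (a := D.top.isUp) (hlen ▸ hk)
    have h3 := D.top.upCount_le_semilength k
    have h4 := w.upCount_le_semilength k
    rw [DyckWord.upCount_length] at h1 h2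
    have := D.semilength_top
    omega
  · exact D.above
  · intro k
    rcases Nat.eq_zero_or_pos (D.jointCount k) with h | h
    · rw [h]; simpa using D.above k
    · have h1 := (D.joint_iff.2 (show D.jointCount k - 1 < D.jointCount k by omega)).lt_gap
      unfold gap at h1; omega
  · intro k
    rcases Nat.eq_zero_or_pos (D.jointCount k) with h | h
    · rw [h]; simpa using D.above (k + 1)
    · have h1 := (D.joint_iff.2 (show D.jointCount k - 1 < D.jointCount k by omega)).lt_gap_succ
      unfold gap at h1; omega
  · intro j p r hpr hp hr hk
    rcases Nat.eq_or_lt_of_le (show p + 1 ≤ r from hpr) with rfl | hlt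
    · exact ⟨rfl, fun k h1 h2 => by rw [show k = p + 1 by omega]⟩
    -- The tile through the first joint has the same ends as the run, so the conditions on heights
    -- come from its Dyck path.
    · obtain ⟨t, ht, h1, h2⟩ := D.joint_iff.2 (hk (p + 1) (by omega) hlt)
      obtain ⟨q, j', hrun⟩ := D.exists_isRun ht
      obtain ⟨rfl, h3, h4⟩ := hrun.mem_boxes_iff.1 h1
      obtain ⟨h5, h6⟩ := D.tile_ends ht hrun
      have hq : q = p + 1 := by
        by_contra hne
        have := h6 p (by omega) (by omega)
        omega
      subst hq
      have hr' : r = p + 1 + t.len := by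
        rcases lt_trichotomy r (p + 1 + t.len) with h7 | h7 | h7
        · have := h6 r (by omega) h7; omega
        · exact h7
        · have := hk _ (by omega) h7; omega
      subst hr'
      constructor
      · rw [hrun.ht_eq le_rfl]
        have := t.path.ht_length
        unfold DyckTile.len
        omega
      · intro k h7 h8
        obtain ⟨i, rfl⟩ := Nat.exists_eq_add_of_le (show p + 1 ≤ k from h7)
        rw [hrun.ht_eq (by omega)]
        have := t.path.ht_nonneg (k := i) (by unfold DyckTile.len at h8; omega)
        omega

theorem isTrivial_iff : D.IsTrivial ↔ ∀ k, D.jointCount k = 0 := by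
  constructor
  · intro h k
    by_contra hne
    obtain ⟨t, ht, h1, h2⟩ := D.joint_iff.2 (Nat.pos_of_ne_zero hne)
    obtain ⟨p, j, hrun⟩ := D.exists_isRun ht
    have h3 := hrun.mem_boxes_iff.1 h1
    have h4 := hrun.mem_boxes_iff.1 h2
    have := h t ht
    have := t.len_eq
    omega
  · intro h t ht
    by_contra hne
    obtain ⟨p, j, hrun⟩ := D.exists_isRun ht
    have := t.len_eq
    have h1 := (D.tile_ends ht hrun).2 p le_rfl (by omega)
    rw [h] at h1
    omega

/-- A tiling is determined by its data. -/
theorem eq_of_data {D₁ D₂ : DyckTiling w} (ht : D₁.top.isUp = D₂.top.isUp)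
    (hJ : D₁.jointCount = D₂.jointCount) : D₁ = D₂ := by
  have htop : D₁.top = D₂.top := by
    apply DyckWord.ext
    apply List.ext_getElem?
    intro i
    have hl : D₁.top.toList.length = D₂.top.toList.length := by
      rw [DyckWord.length_eq, DyckWord.length_eq, D₁.semilength_top, D₂.semilength_top]
    rcases lt_or_ge i D₁.top.toList.length with hi | hi
    · have h3 := congrFun ht i
      cases h4 : D₂.top.isUp i
      · rw [h4] at h3
        rw [DyckWord.getElem?_eq_D _ |>.2 ⟨hi, h3⟩, DyckWord.getElem?_eq_D _ |>.2 ⟨hl ▸ hi, h4⟩]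
      · rw [h4] at h3
        rw [DyckWord.getElem?_eq_U _ |>.2 h3, DyckWord.getElem?_eq_U _ |>.2 h4]
    · rw [List.getElem?_eq_none hi, List.getElem?_eq_none (hl ▸ hi)]
  refine ext' htop ?_
  have key : ∀ D₁ D₂ : DyckTiling w, D₁.top = D₂.top → D₁.jointCount = D₂.jointCount →
      ∀ t ∈ D₁.tiles, t ∈ D₂.tiles := by
    intro D₁ D₂ htop hJ t ht
    obtain ⟨p, j, hrun⟩ := D₁.exists_isRun ht
    have hmem : w.cell p j ∈ t.boxes := hrun.mem_boxes_iff.2 ⟨rfl, le_rfl, by omega⟩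
    have hgap := D₁.cell_mem_iff.1 ⟨t, ht, hmem⟩
    rw [htop] at hgap
    obtain ⟨t', ht', hmem'⟩ := D₂.cell_mem_iff.2 hgap
    obtain ⟨p', j', hrun'⟩ := D₂.exists_isRun ht'
    obtain ⟨rfl, h1, h2⟩ := hrun'.mem_boxes_iff.1 hmem'
    obtain ⟨h3, h4⟩ := D₁.tile_ends ht hrun
    obtain ⟨h5, h6⟩ := D₂.tile_ends ht' hrun'
    rw [hJ] at h3 h4
    have hp : p' = p := by
      by_contra hne
      obtain ⟨q, rfl⟩ : ∃ q, p = q + 1 := ⟨p - 1, by omega⟩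
      have h7 := D₁.tile_starts ht hrun
      rw [hJ] at h7
      have := h6 q (by omega) (by omega)
      omega
    subst hp
    have hl : t'.len = t.len := by
      rcases lt_trichotomy t'.len t.len with h7 | h7 | h7
      · have := h4 (p' + t'.len) (by omega) (by omega); omega
      · exact h7
      · have := h6 (p' + t.len) (by omega) (by omega); omega
    rwa [← DyckTile.eq_of_run hrun' hrun hl]
  ext t
  exact ⟨key D₁ D₂ htop hJ t, key D₂ D₁ htop.symm hJ.symm t⟩

end DyckTiling

/-! ### The lines of the Hermite history -/

namespace DyckWord

/-- The right side of the box in the layer `j` above the position `k`. -/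
def rightEdge (w : DyckWord) (k j : ℕ) : ℤ × ℤ := w.cell k j + (1, 0)

variable {w : DyckWord}

theorem rightEdge_inj {k j k' j' : ℕ} (h : w.rightEdge k j = w.rightEdge k' j') :
    k = k' ∧ j = j' := cell_inj (add_right_cancel h)

theorem rightEdge_left (k j : ℕ) : w.rightEdge k j + (-1, 0) = w.cell k j := by
  rw [rightEdge, add_assoc]; simp

theorem rightEdge_lift (k j : ℕ) : w.rightEdge k j + (-1, 1) = w.rightEdge k (j + 1) := by
  ext
  · simp only [rightEdge, Prod.fst_add, cell_fst]; push_cast; ring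
  · simp only [rightEdge, Prod.snd_add, cell_snd]; push_cast; ring

theorem cell_succ_up {k j : ℕ} (h : w.isUp k = true) :
    w.cell (k + 1) j = w.rightEdge k (j + 1) := by
  ext
  · simp only [rightEdge, Prod.fst_add, cell_fst, upCount_succ, h, if_true]; push_cast; ring
  · simp only [rightEdge, Prod.snd_add, cell_snd, upCount_succ, h, if_true]; push_cast; ring

theorem cell_succ_down {k j : ℕ} (h : w.isUp k = false) :
    w.cell (k + 1) j = w.rightEdge k j := by
  ext
  · simp only [rightEdge, Prod.fst_add, cell_fst, upCount_succ, h]; push_cast; ring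
  · simp only [rightEdge, Prod.snd_add, cell_snd, upCount_succ, h]; push_cast; ring

theorem rightEdge_opening (e : TreeEdge w) :
    ((w.upCol e.row : ℤ), (e.row : ℤ)) = w.rightEdge e.opening 0 := by
  have h := upCount_le (a := w.isUp) e.opening
  rw [upCol_row, e.row_eq, Nat.cast_sub h]
  ext
  · simp only [rightEdge, Prod.fst_add, cell_fst]; push_cast; ring
  · simp only [rightEdge, Prod.snd_add, cell_snd]; push_cast; ring

end DyckWord

namespace DyckTiling

variable {w : DyckWord} (D : DyckTiling w)

theorem exists_isRun_succ {t : DyckTile} (ht : t ∈ D.tiles) :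
    ∃ p j, DyckTile.IsRun w t (p + 1) j := by
  obtain ⟨p, j, h⟩ := D.exists_isRun ht
  have h1 := D.cell_mem_iff.1 ⟨t, ht, h.mem_boxes_iff.2 ⟨rfl, le_rfl, Nat.le_add_right _ _⟩⟩
  cases p with
  | zero => simp [gap] at h1
  | succ p => exact ⟨p, j, h⟩

theorem entry_unique {t t' : DyckTile} (ht : t ∈ D.tiles) (ht' : t' ∈ D.tiles)
    (h : t.entryEdge = t'.entryEdge) : t = t' := by
  obtain ⟨p, j, hr⟩ := D.exists_isRun ht
  obtain ⟨p', j', hr'⟩ := D.exists_isRun ht'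
  rw [hr.entryEdge_eq, hr'.entryEdge_eq] at h
  refine D.tile_unique ht ht' (hr.mem_boxes_iff.2 ⟨rfl, Nat.le_add_right p t.len, le_rfl⟩) ?_
  rw [add_right_cancel h]
  exact hr'.mem_boxes_iff.2 ⟨rfl, Nat.le_add_right _ _, le_rfl⟩

theorem mem_boxes_of_entry {t : DyckTile} {k j : ℕ} (ht : t ∈ D.tiles)
    (h : t.entryEdge = w.rightEdge k j) :
    w.cell k j ∈ t.boxes ∧ w.cell (k + 1) j ∉ t.boxes := by
  obtain ⟨p, j', hr⟩ := D.exists_isRun ht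
  rw [hr.entryEdge_eq] at h
  obtain ⟨rfl, rfl⟩ := DyckWord.rightEdge_inj h
  rw [hr.mem_boxes_iff, hr.mem_boxes_iff]
  exact ⟨⟨rfl, by omega, le_rfl⟩, by omega⟩

open Classical in
/-- The total weight of the tiles which are met after the edge `v`. -/
noncomputable def crossSum (v : ℤ × ℤ) : ℕ :=
  ∑ t ∈ D.tiles.filter fun t => Relation.ReflTransGen D.Cross v t.entryEdge, t.weight

theorem crossSum_of_not_entry {v : ℤ × ℤ} (h : ∀ t ∈ D.tiles, t.entryEdge ≠ v) :
    D.crossSum v = 0 := by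
  classical
  unfold crossSum
  rw [Finset.filter_eq_empty_iff.2, Finset.sum_empty]
  intro t ht hc
  rcases Relation.ReflTransGen.cases_head hc with h1 | ⟨v', ⟨t', ht', h1, -⟩, -⟩
  · exact h t ht h1.symm
  · exact h t' ht' h1

theorem cross_decreasing {v v' : ℤ × ℤ} (h : Relation.ReflTransGen D.Cross v v') :
    v'.1 ≤ v.1 := by
  induction h with
  | refl => exact le_rfl
  | tail _ h ih =>
    obtain ⟨t, -, h1, h2⟩ := h
    rw [← h1] at ih
    rw [← h2]
    simp only [DyckTile.entryEdge, Prod.fst_add] at ih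
    unfold DyckTile.exitEdge
    omega

theorem crossSum_of_entry {t : DyckTile} (ht : t ∈ D.tiles) :
    D.crossSum t.entryEdge = t.weight + D.crossSum t.exitEdge := by
  classical
  unfold crossSum
  rw [← Finset.sum_insert]
  · congr 1
    ext t'
    simp only [Finset.mem_filter, Finset.mem_insert]
    constructor
    · rintro ⟨h1, h2⟩
      rcases Relation.ReflTransGen.cases_head h2 with h3 | ⟨v', ⟨t'', ht'', h3, rfl⟩, h4⟩
      · exact Or.inl (D.entry_unique h1 ht h3.symm)
      · rw [D.entry_unique ht'' ht h3] at h4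
        exact Or.inr ⟨h1, h4⟩
    · rintro (rfl | ⟨h1, h2⟩)
      · exact ⟨ht, Relation.ReflTransGen.refl⟩
      · exact ⟨h1, Relation.ReflTransGen.head ⟨t, ht, rfl, rfl⟩ h2⟩
  · simp only [Finset.mem_filter, not_and]
    intro _ hc
    have := D.cross_decreasing hc
    simp only [DyckTile.entryEdge, DyckTile.exitEdge, Prod.fst_add] at this
    omega

/-- Within the tile only the down steps are paid for, which gives its size; leaving it costs one
more. No joint at `p` in this layer lets the line leave. -/
theorem lineWt_tile {t : DyckTile} {p j : ℕ} (ht : t ∈ D.tiles)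
    (h : DyckTile.IsRun w t (p + 1) j) :
    lineWt w.isUp D.top.isUp D.jointCount (p + 1 + t.len) j = t.weight +
      (if w.isUp p then lineWt w.isUp D.top.isUp D.jointCount p (j + 1)
        else lineWt w.isUp D.top.isUp D.jointCount p j) := by
  have hgap : ∀ i, i ≤ t.len → j < gap w.isUp D.top.isUp (p + 1 + i) := fun i hi =>
    D.cell_mem_iff.1 ⟨t, ht, h.mem_boxes_iff.2 ⟨rfl, by omega, by omega⟩⟩
  have key : ∀ i, i ≤ t.len → lineWt w.isUp D.top.isUp D.jointCount (p + 1 + i) j +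
      upCount t.path.isUp i = i + lineWt w.isUp D.top.isUp D.jointCount (p + 1) j := by
    intro i
    induction i with
    | zero => intro _; simp
    | succ i ih =>
      intro hi
      have h1 := ih (by omega)
      have h2 := (D.tile_ends ht h).2 (p + 1 + i) (by omega) (by omega)
      have h3 := hgap (i + 1) hi
      have h4 := h.isUp_eq (show i < t.len by omega)
      rw [← add_assoc] at h3 ⊢
      rw [upCount_succ]
      cases h5 : w.isUp (p + 1 + i)
      · rw [lineWt_of_down h3 h5, h4, h5]; simp; omega
      · rw [lineWt_of_joint h3 h5 h2, h4, h5]; simp; omega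
  have h1 := key t.len le_rfl
  have h2 : upCount t.path.isUp t.len = t.size := t.path.upCount_length
  have h3 := t.len_eq
  have h4 := D.tile_starts ht h
  have h5 := hgap 0 (Nat.zero_le _)
  unfold DyckTile.weight
  cases h6 : w.isUp p
  · rw [lineWt_of_down h5 h6] at h1
    simp; omega
  · rw [lineWt_of_not_joint h5 h6 h4] at h1
    simp; omega

/-- The hypothesis says that a tile containing the box at `k` in layer `j` ends there, so the line
enters it at this edge. Both sides then drop by the weight of the tile and continue from its exit.
-/
theorem crossSum_eq_lineWt {k j : ℕ} (hk : D.jointCount k ≤ j) :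
    D.crossSum (w.rightEdge k j) = lineWt w.isUp D.top.isUp D.jointCount k j := by
  induction k using Nat.strong_induction_on generalizing j with
  | _ k ih =>
    rcases lt_or_ge j (gap w.isUp D.top.isUp k) with hg | hg
    · obtain ⟨t, ht, hmem⟩ := D.cell_mem_iff.2 hg
      obtain ⟨p, j', hr⟩ := D.exists_isRun_succ ht
      obtain ⟨rfl, h1, h2⟩ := hr.mem_boxes_iff.1 hmem
      have h3 : k = p + 1 + t.len := by
        by_contra hne
        have := (D.tile_ends ht hr).2 k h1 (by omega)
        omega
      subst h3
      have h4 := D.tile_starts ht hr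
      have hentry : w.rightEdge (p + 1 + t.len) j = t.entryEdge := hr.entryEdge_eq.symm
      rw [D.lineWt_tile ht hr, hentry, D.crossSum_of_entry ht, DyckTile.exitEdge, hr.start_eq]
      cases h6 : w.isUp p
      · rw [DyckWord.cell_succ_down h6, ih p (by omega) h4]; simp
      · rw [DyckWord.cell_succ_up h6, ih p (by omega) (by omega)]; simp
    · rw [lineWt_eq_zero hg, D.crossSum_of_not_entry]
      intro t ht he
      have := D.cell_mem_iff.1 ⟨t, ht, (D.mem_boxes_of_entry ht he).1⟩
      omega

theorem lift_iff {k j : ℕ} {v : ℤ × ℤ} :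
    D.Lift (w.rightEdge k j) v ↔ j < D.jointCount k ∧ v = w.rightEdge k (j + 1) := by
  unfold Lift
  rw [DyckWord.rightEdge_left, DyckWord.rightEdge_lift]
  refine and_congr_left fun _ => ?_
  rw [← joint_iff]
  constructor
  · rintro ⟨t, ht, h1, h2⟩
    obtain ⟨p, j', hr⟩ := D.exists_isRun ht
    obtain ⟨rfl, h3, h4⟩ := hr.mem_boxes_iff.1 h1
    refine ⟨t, ht, h1, hr.mem_boxes_iff.2 ⟨rfl, by omega, ?_⟩⟩
    by_contra hlt
    rw [hr.entryEdge_eq, show p + t.len = k by omega] at h2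
    exact h2 rfl
  · rintro ⟨t, ht, h1, h2⟩
    exact ⟨t, ht, h1, fun he => (D.mem_boxes_of_entry ht he).2 h2⟩

theorem lift_reach {k : ℕ} : ∀ i ≤ D.jointCount k,
    Relation.ReflTransGen D.Lift (w.rightEdge k 0) (w.rightEdge k i) := by
  intro i
  induction i with
  | zero => intro _; exact Relation.ReflTransGen.refl
  | succ i ih => intro hi; exact (ih (by omega)).tail (D.lift_iff.2 ⟨hi, rfl⟩)

theorem lift_reach_only {k : ℕ} {v : ℤ × ℤ}
    (h : Relation.ReflTransGen D.Lift (w.rightEdge k 0) v) :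
    ∃ i ≤ D.jointCount k, v = w.rightEdge k i := by
  induction h with
  | refl => exact ⟨0, Nat.zero_le _, rfl⟩
  | tail _ h ih =>
    obtain ⟨i, hi, rfl⟩ := ih
    obtain ⟨h1, rfl⟩ := D.lift_iff.1 h
    exact ⟨i + 1, h1, rfl⟩

/-- Although `LineMeets` allows stopping at any lifted up step, no tile is entered at a stage below
`jointCount k`, because the box there is joined to the right. -/
theorem lineMeets_iff {t : DyckTile} (ht : t ∈ D.tiles) (k : ℕ) :
    D.LineMeets (w.rightEdge k 0) t ↔
      Relation.ReflTransGen D.Cross (w.rightEdge k (D.jointCount k)) t.entryEdge := by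
  constructor
  · rintro ⟨v', h1, h2⟩
    obtain ⟨i, hi, rfl⟩ := D.lift_reach_only h1
    rcases Nat.eq_or_lt_of_le hi with rfl | hlt
    · exact h2
    · exfalso
      have hno : ∀ t' ∈ D.tiles, t'.entryEdge ≠ w.rightEdge k i := fun t' ht' he => by
        obtain ⟨h3, h4⟩ := D.mem_boxes_of_entry ht' he
        obtain ⟨t'', ht'', h5, h6⟩ := D.joint_iff.2 hlt
        rw [D.tile_unique ht' ht'' h3 h5] at h4
        exact h4 h6
      rcases Relation.ReflTransGen.cases_head h2 with h3 | ⟨v', ⟨t', ht', h3, -⟩, -⟩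
      · exact hno t ht h3.symm
      · exact hno t' ht' h3
  · exact fun h => ⟨_, D.lift_reach _ le_rfl, h⟩

theorem sum_lineTiles (e : TreeEdge w) : ∑ t ∈ D.lineTiles e.row, t.weight =
    lineWt w.isUp D.top.isUp D.jointCount e.opening (D.jointCount e.opening) := by
  classical
  rw [← D.crossSum_eq_lineWt le_rfl]
  unfold lineTiles crossSum
  congr 1
  ext t
  simp only [Finset.mem_filter, DyckWord.rightEdge_opening]
  exact and_congr_right fun ht => D.lineMeets_iff ht _

theorem hasLabel_iff (L : DecreasingLabel w) :
    D.HasLabel L ↔ HasWordLabel w.isUp D.top.isUp D.jointCount L.wordLabel := by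
  constructor
  · intro h k hk
    obtain ⟨e, rfl⟩ := TreeEdge.exists_opening hk
    rw [L.wordCode_eq_code, ← D.sum_lineTiles, h e]
  · intro h e
    rw [D.sum_lineTiles, h _ e.chord.1, L.wordCode_eq_code]

/-- The weight of the tiling in terms of its data. -/
theorem weight_eq : D.weight = ∑ k ∈ Finset.range w.toList.length,
    (if w.isUp k then gap w.isUp D.top.isUp (k + 1) - D.jointCount k
      else gap w.isUp D.top.isUp (k + 1)) := by
  classical
  -- A box counts zero exactly when it is reached inside its tile by an up step. Of the `2m + 1`
  -- boxes of a tile of size `m` there remain `m + 1`, its weight.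
  let G : ℤ × ℤ → ℕ := fun b =>
    if w.isUp (b.1 + b.2).toNat = true ∧
      b.2 < (upCount w.isUp ((b.1 + b.2).toNat + 1) : ℤ) + D.jointCount (b.1 + b.2).toNat
    then 0 else 1
  have hG : ∀ k j, G (w.cell (k + 1) j) = if w.isUp k = true ∧ j < D.jointCount k then 0 else 1 := by
    intro k j
    have h1 : (w.cell (k + 1) j).1 + (w.cell (k + 1) j).2 = k := by
      have := DyckWord.cell_sum (w := w) (k + 1) j
      push_cast at this; omega
    simp only [G, h1, Int.toNat_natCast]
    rw [DyckWord.cell_snd]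
    simp only [add_lt_add_iff_left, Nat.cast_lt]
  have htile : ∀ t ∈ D.tiles, ∑ b ∈ (Finset.range (t.len + 1)).image t.box, G b = t.weight := by
    intro t ht
    obtain ⟨p, j, hr⟩ := D.exists_isRun_succ ht
    have hinj : Set.InjOn t.box (Finset.range (t.len + 1) : Finset ℕ) := by
      intro i _ i' _ h
      have h1 := DyckTile.box_sum (t := t) i
      have h2 := DyckTile.box_sum (t := t) i'
      rw [h] at h1; omega
    rw [Finset.sum_image hinj]
    have h1 : ∀ i ∈ Finset.range (t.len + 1), G (t.box i) =
        if w.isUp (p + i) = true ∧ j < D.jointCount (p + i) then 0 else 1 := by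
      intro i hi
      rw [hr i (by simpa [Nat.lt_succ_iff] using hi), show p + 1 + i = p + i + 1 by ring, hG]
    rw [Finset.sum_congr rfl h1, Finset.sum_range_succ']
    have h2 : ¬ (w.isUp (p + 0) = true ∧ j < D.jointCount (p + 0)) := by
      have := D.tile_starts ht hr
      rw [Nat.add_zero]; omega
    rw [if_neg h2]
    have h3 : ∀ m, m ≤ t.len → ∑ i ∈ Finset.range m, (if w.isUp (p + (i + 1)) = true ∧
        j < D.jointCount (p + (i + 1)) then 0 else 1) + upCount t.path.isUp m = m := by
      intro m
      induction m with
      | zero => intro _; simp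
      | succ m ih =>
        intro hm
        have h4 := ih (by omega)
        have h5 := (D.tile_ends ht hr).2 (p + 1 + m) (by omega) (by omega)
        have h6 := hr.isUp_eq (show m < t.len by omega)
        rw [Finset.sum_range_succ, upCount_succ, h6, show p + (m + 1) = p + 1 + m by ring]
        simp only [h5, and_true]
        split_ifs <;> omega
    have h4 := h3 t.len le_rfl
    have h5 : upCount t.path.isUp t.len = t.size := t.path.upCount_length
    have h6 := t.len_eq
    unfold DyckTile.weight
    omega
  have hlast : ∀ k, w.toList.length ≤ k → gap w.isUp D.top.isUp k = 0 := fun k hk => by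
    have h1 := upCount_mono (a := w.isUp) hk
    have h2 := D.top.upCount_le_semilength k
    rw [DyckWord.upCount_length] at h1
    have := D.semilength_top
    unfold gap; omega
  have hright : ∀ k, (if w.isUp k then gap w.isUp D.top.isUp (k + 1) - D.jointCount k
      else gap w.isUp D.top.isUp (k + 1)) =
      ∑ j ∈ Finset.range (gap w.isUp D.top.isUp (k + 1)), G (w.cell (k + 1) j) := by
    intro k
    simp only [hG]
    have hJ := D.tilingData.joint_le_gap_succ k
    cases h : w.isUp k
    · simp
    · simp only [true_and, if_true]
      rw [← Finset.sum_range_add_sum_Ico _ hJ, Finset.sum_eq_zero, Finset.sum_congr rfl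
        (g := fun _ => 1)]
      · simp
      · intro j hj
        rw [if_neg]; have := (Finset.mem_Ico.1 hj).1; omega
      · intro j hj
        rw [if_pos (Finset.mem_range.1 hj)]
  unfold weight
  rw [Finset.sum_congr rfl fun t ht => (htile t ht).symm, ← Finset.sum_biUnion,
    Finset.sum_congr rfl fun k _ => hright k, Finset.sum_sigma']
  · have himg : (D.tiles.biUnion fun t => (Finset.range (t.len + 1)).image t.box) =
        ((Finset.range w.toList.length).sigma fun k =>
          Finset.range (gap w.isUp D.top.isUp (k + 1))).image
          fun x : (_ : ℕ) × ℕ => w.cell (x.1 + 1) x.2 := by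
      ext b
      simp only [Finset.mem_biUnion, Finset.mem_image, Finset.mem_range, Finset.mem_sigma]
      have h1 := D.mem_union_iff b
      have h2 : (∃ t ∈ D.tiles, b ∈ t.boxes) ↔
          ∃ t ∈ D.tiles, ∃ i < t.len + 1, t.box i = b := by
        simp only [DyckTile.mem_boxes, Nat.lt_succ_iff, eq_comm]
      rw [← h2, h1]
      constructor
      · rintro ⟨k, j, hj, rfl⟩
        cases k with
        | zero => simp [gap] at hj
        | succ k =>
          refine ⟨⟨k, j⟩, ⟨?_, hj⟩, rfl⟩
          simp only
          by_contra hle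
          rw [hlast (k + 1) (by omega)] at hj
          omega
      · rintro ⟨⟨k, j⟩, ⟨-, hj⟩, rfl⟩
        exact ⟨k + 1, j, hj, rfl⟩
    rw [himg, Finset.sum_image]
    rintro ⟨k, j⟩ _ ⟨k', j'⟩ _ h
    obtain ⟨h1, h2⟩ := DyckWord.cell_inj h
    simp only at h1 h2
    obtain rfl : k = k' := by omega
    subst h2
    rfl
  · intro t ht t' ht' hne
    rw [Function.onFun, Finset.disjoint_left]
    intro b hb hb'
    simp only [Finset.mem_image, Finset.mem_range, Nat.lt_succ_iff] at hb hb'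
    obtain ⟨i, hi, rfl⟩ := hb
    obtain ⟨i', hi', h⟩ := hb'
    exact hne (D.tile_unique ht ht' (DyckTile.box_mem hi) (h ▸ DyckTile.box_mem hi'))

/-- All boxes have ended at the last position, so in `sum_lineWt` only the lines starting at up
steps remain, and these are the code entries. -/
theorem weight_eq_inv {L : DecreasingLabel w} (h : D.HasLabel L) : D.weight = L.inv := by
  have hlast : gap w.isUp D.top.isUp w.toList.length = 0 := by
    have h2 := D.top.upCount_le_semilength w.toList.length
    have := D.semilength_top
    have := w.upCount_length
    unfold gap; omega
  rw [D.weight_eq, D.tilingData.sum_lineWt, hlast, Finset.range_zero, Finset.sum_empty,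
    Nat.add_zero,
    TreeEdge.sum_opening (fun k => lineWt w.isUp D.top.isUp D.jointCount k (D.jointCount k))]
  exact Finset.sum_congr rfl fun e _ => by rw [← D.sum_lineTiles, h e]

end DyckTiling

/-! ### Construction of tilings from their data -/

theorem exists_dyckWord (c : ℕ → Bool) (m : ℕ) (h0 : ht c m = 0)
    (hpos : ∀ i ≤ m, 0 ≤ ht c i) :
    ∃ x : DyckWord, x.toList.length = m ∧ ∀ i < m, x.isUp i = c i := by
  let l : List DyckStep := (List.range m).map fun i => if c i then U else D
  have hlen : l.length = m := by simp [l]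
  have hl : ∀ i < m, decide (l[i]? = some U) = c i := by
    intro i hi
    have : l[i]? = some (if c i then U else D) := by simp [l, hi]
    rw [this]
    cases c i <;> simp
  have hcount : ∀ i ≤ m, (l.take i).count U = upCount c i := by
    intro i hi
    rw [DyckWord.count_take_eq_upCount]
    exact upCount_congr fun k hk => hl k (by omega)
  have hcountD : ∀ i ≤ m, (l.take i).count D = i - upCount c i := by
    intro i hi
    have h1 := DyckWord.count_U_add_count_D (l.take i)
    rw [hcount i hi, List.length_take, hlen, min_eq_left hi] at h1
    omega
  have h1 := hcount m le_rfl
  have h2 := hcountD m le_rfl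
  have hall : l.take m = l := by rw [← hlen, List.take_length]
  rw [hall] at h1 h2
  unfold ht at h0
  refine ⟨⟨l, by omega, fun i => ?_⟩, hlen, fun i hi => ?_⟩
  · rcases le_or_gt i m with hi | hi
    · rw [hcount i hi, hcountD i hi]
      have := hpos i hi
      unfold ht at this
      omega
    · rw [List.take_of_length_le (by omega)]; omega
  · exact hl i hi

theorem upCount_shift (a : ℕ → Bool) (p i : ℕ) :
    upCount a (p + i) = upCount a p + upCount (fun k => a (p + k)) i := by
  induction i with
  | zero => rfl
  | succ i ih => rw [← add_assoc, upCount_succ, upCount_succ, ih, add_assoc]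

theorem ht_shift (a : ℕ → Bool) (p i : ℕ) :
    ht a (p + i) = ht a p + ht (fun k => a (p + k)) i := by
  unfold ht; rw [upCount_shift]; push_cast; ring

namespace TilingData

variable {w : DyckWord} {b : ℕ → Bool} {J : ℕ → ℕ}

theorem upCount_top_le (h : TilingData w.isUp b J) (k : ℕ) : upCount b k ≤ w.semilength := by
  obtain ⟨N, hN⟩ := h.eventually_eq
  have h1 := upCount_mono (a := b) (le_max_left k N)
  have h2 := (hN (max k N) (le_max_right _ _)).2.2
  have h3 := w.upCount_le_semilength (max k N)
  omega

theorem exists_top (h : TilingData w.isUp b J) :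
    ∃ x : DyckWord, x.semilength = w.semilength ∧ x.isUp = b := by
  have hN : ∀ k, w.toList.length ≤ k → upCount b k = w.semilength := fun k hk => by
    have h1 := h.upCount_top_le k
    have h2 := h.above k
    have h3 := upCount_mono (a := w.isUp) hk
    rw [w.upCount_length] at h3
    omega
  obtain ⟨x, hlen, hx⟩ := exists_dyckWord b w.toList.length
    (by rw [ht, hN _ le_rfl, w.length_eq]; push_cast; ring)
    (fun i hi => by
      have h1 := w.ht_nonneg hi
      have h2 := h.above i
      unfold ht at *; omega)
  refine ⟨x, by have := x.length_eq; have := w.length_eq; omega, funext fun k => ?_⟩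
  rcases lt_or_ge k w.toList.length with hk | hk
  · exact hx k hk
  · rw [x.isUp_of_ge (by omega)]
    have h1 := hN k hk
    have h2 := hN (k + 1) (by omega)
    rw [upCount_succ] at h2
    by_contra hne
    rw [if_pos (by simpa using Ne.symm hne)] at h2
    omega

/-- The tile `t` is the run of boxes in the layer `j` after the position `p`. -/
def IsTile (w : DyckWord) (b : ℕ → Bool) (J : ℕ → ℕ) (p j : ℕ) (t : DyckTile) : Prop :=
  j < gap w.isUp b (p + 1) ∧ J p ≤ j ∧ J (p + 1 + t.len) ≤ j ∧
    (∀ k, p < k → k < p + 1 + t.len → j < J k) ∧ DyckTile.IsRun w t (p + 1) j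

theorem IsTile.lt_gap (h : TilingData w.isUp b J) {p j : ℕ} {t : DyckTile}
    (ht : IsTile w b J p j t) {k : ℕ} (h1 : p < k) (h2 : k ≤ p + 1 + t.len) :
    j < gap w.isUp b k := by
  rcases Nat.eq_or_lt_of_le (show p + 1 ≤ k from h1) with rfl | h3
  · exact ht.1
  · obtain ⟨i, rfl⟩ : ∃ i, k = i + 1 := ⟨k - 1, by omega⟩
    exact (ht.2.2.2.1 i (by omega) (by omega)).trans_le (h.joint_le_gap_succ i)

theorem IsTile.unique {p j p' k : ℕ} {t t' : DyckTile} (ht : IsTile w b J p j t)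
    (ht' : IsTile w b J p' j t') (h1 : p < k) (h2 : k ≤ p + 1 + t.len) (h1' : p' < k)
    (h2' : k ≤ p' + 1 + t'.len) : t = t' := by
  obtain ⟨-, h3, h4, h5, h6⟩ := ht
  obtain ⟨-, h3', h4', h5', h6'⟩ := ht'
  have hp : p = p' := by
    rcases lt_trichotomy p p' with h | h | h
    · have := h5 p' h (by omega); omega
    · exact h
    · have := h5' p h (by omega); omega
  subst hp
  refine DyckTile.eq_of_run h6 h6' ?_
  rcases lt_trichotomy t.len t'.len with h | h | h
  · have := h5' (p + 1 + t.len) (by omega) (by omega); omega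
  · exact h
  · have := h5 (p + 1 + t'.len) (by omega) (by omega); omega

/-- Extend the box to the maximal run of joints in its layer; the field `run` makes this run a Dyck
path. -/
theorem exists_isTile (h : TilingData w.isUp b J) {k j : ℕ} (hj : j < gap w.isUp b k) :
    ∃ p t, IsTile w b J p j t ∧ p < k ∧ k ≤ p + 1 + t.len := by
  have hk : 0 < k := by
    rcases Nat.eq_zero_or_pos k with rfl | hk
    · simp [gap] at hj
    · exact hk
  obtain ⟨p, hpk, hp, hpj⟩ := h.exists_run_start k j hk
  obtain ⟨r, hkr, hr, hrj⟩ := h.exists_run_end k j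
  have hrun : ∀ i, p < i → i < r → j < J i := fun i h1 h2 => by
    rcases lt_or_ge i k with h3 | h3
    · exact hpj i h1 h3
    · exact hrj i h3 h2
  obtain ⟨m, rfl⟩ := Nat.exists_eq_add_of_le (show p + 1 ≤ r by omega)
  obtain ⟨h1, h2⟩ := h.run j p _ (by omega) hp hr hrun
  obtain ⟨x, hlen, hx⟩ := exists_dyckWord (fun i => w.isUp (p + 1 + i)) m
    (by rw [ht_shift w.isUp (p + 1) m] at h1; omega)
    (fun i hi => by
      have := h2 (p + 1 + i) (by omega) (by omega)
      rw [ht_shift w.isUp (p + 1) i] at this; omega)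
  let t : DyckTile := ⟨w.cell (p + 1) j, x⟩
  have htlen : t.len = m := hlen
  refine ⟨p, t, ⟨?_, hp, by rwa [htlen], by rwa [htlen], fun i hi => ?_⟩, hpk, by omega⟩
  · rcases Nat.eq_or_lt_of_le (show p + 1 ≤ k from hpk) with h3 | h3
    · rwa [h3]
    · exact (hrun (p + 1) (by omega) (by omega)).trans_le (h.joint_le_gap (p + 1))
  · have h3 : upCount x.isUp i = upCount (fun k => w.isUp (p + 1 + k)) i :=
      upCount_congr fun k hk => hx k (by omega)
    have h4 := upCount_shift w.isUp (p + 1) i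
    ext
    · simp only [DyckTile.box, t, Prod.fst_add, DyckWord.cell_fst, h3, h4]; push_cast; ring
    · simp only [DyckTile.box, t, Prod.snd_add, DyckWord.cell_snd, h3, h4]; push_cast; ring

theorem finite_isTile (h : TilingData w.isUp b J) :
    {t | ∃ p j, IsTile w b J p j t}.Finite := by
  have hsub : {t | ∃ p j, IsTile w b J p j t} ⊆
      ⋃ x ∈ (Finset.range w.toList.length ×ˢ Finset.range w.toList.length : Finset (ℕ × ℕ)),
        {t | IsTile w b J x.1 x.2 t} := by
    rintro t ⟨p, j, ht⟩
    have h1 := ht.1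
    have h2 : p + 1 < w.toList.length := by
      by_contra hle
      have h3 := upCount_mono (a := w.isUp) (not_lt.1 hle)
      have h4 := h.upCount_top_le (p + 1)
      rw [w.upCount_length] at h3
      unfold gap at h1; omega
    have h3 := upCount_le (a := b) (p + 1)
    simp only [Set.mem_iUnion]
    exact ⟨(p, j), by
      simp only [Finset.mem_product, Finset.mem_range]
      unfold gap at h1; omega, ht⟩
  refine Set.Finite.subset (Set.Finite.biUnion (Finset.finite_toSet _) fun x _ => ?_) hsub
  exact Set.Subsingleton.finite fun t ht t' ht' =>
    IsTile.unique ht ht' (k := x.1 + 1) (by omega) (by omega) (by omega) (by omega)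

/-- The tiling with given data. -/
theorem exists_dyckTiling (h : TilingData w.isUp b J) :
    ∃ D : DyckTiling w, D.top.isUp = b ∧ D.jointCount = J := by
  classical
  obtain ⟨top, hs, htop⟩ := h.exists_top
  have hmem : ∀ t, t ∈ h.finite_isTile.toFinset ↔ ∃ p j, IsTile w b J p j t := fun t => by simp
  have hboxes : ∀ {p j t}, IsTile w b J p j t → ∀ {x}, x ∈ t.boxes ↔
      ∃ k, p < k ∧ k ≤ p + 1 + t.len ∧ x = w.cell k j := by
    intro p j t ht x
    rw [DyckTile.mem_boxes]
    constructor
    · rintro ⟨i, hi, rfl⟩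
      exact ⟨p + 1 + i, by omega, by omega, ht.2.2.2.2 i hi⟩
    · rintro ⟨k, h1, h2, rfl⟩
      refine ⟨k - (p + 1), by omega, ?_⟩
      rw [ht.2.2.2.2 _ (by omega)]
      congr 1; omega
  let D : DyckTiling w :=
    { top := top
      tiles := h.finite_isTile.toFinset
      semilength_top := hs
      top_above := fun k => by
        rw [DyckWord.count_U_take, DyckWord.count_U_take, htop]; exact h.above k
      disjoint := by
        intro t ht t' ht' hne
        obtain ⟨p, j, hT⟩ := (hmem t).1 ht
        obtain ⟨p', j', hT'⟩ := (hmem t').1 ht'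
        refine Set.disjoint_left.2 fun x hx hx' => hne ?_
        obtain ⟨k, h1, h2, rfl⟩ := (hboxes hT).1 hx
        obtain ⟨k', h1', h2', h3⟩ := (hboxes hT').1 hx'
        obtain ⟨rfl, rfl⟩ := DyckWord.cell_inj h3
        exact hT.unique hT' h1 h2 h1' h2'
      union := by
        ext x
        simp only [Set.mem_iUnion, exists_prop, hmem]
        refine Iff.trans ?_ (DyckWord.mem_region_iff hs x).symm
        rw [htop]
        constructor
        · rintro ⟨t, ⟨p, j, hT⟩, hx⟩
          obtain ⟨k, h1, h2, rfl⟩ := (hboxes hT).1 hx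
          exact ⟨k, j, hT.lt_gap h h1 h2, rfl⟩
        · rintro ⟨k, j, hj, rfl⟩
          obtain ⟨p, t, hT, h1, h2⟩ := h.exists_isTile hj
          exact ⟨t, ⟨p, j, hT⟩, (hboxes hT).2 ⟨k, h1, h2, rfl⟩⟩
      cover_inclusive := by
        intro t ht
        obtain ⟨p, j, hT⟩ := (hmem t).1 ht
        cases j with
        | zero =>
          right
          intro x hx
          obtain ⟨k, -, -, rfl⟩ := (hboxes hT).1 hx
          exact DyckWord.cell_zero_down k
        | succ j =>
          left
          obtain ⟨q, t', hT', h1, h2⟩ := h.exists_isTile (k := p + 1) (j := j)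
            (by have := hT.1; omega)
          refine ⟨t', (hmem t').2 ⟨q, j, hT'⟩, fun x hx => ?_⟩
          obtain ⟨k, h3, h4, rfl⟩ := (hboxes hT).1 hx
          rw [DyckWord.cell_down]
          refine (hboxes hT').2 ⟨k, by omega, ?_, rfl⟩
          -- If the tile underneath ended earlier, layer `j` would not be joined at its end, whereas
          -- layer `j + 1` is.
          by_contra hlt
          have h5 := hT.2.2.2.1 (q + 1 + t'.len) (by omega) (by omega)
          have h6 := hT'.2.2.1
          omega }
  refine ⟨D, htop, funext fun k => ?_⟩
  have key : ∀ j, D.Joint k j ↔ j < J k := by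
    intro j
    constructor
    · rintro ⟨t, ht, h1, h2⟩
      obtain ⟨p, j', hT⟩ := (hmem t).1 ht
      obtain ⟨k1, h3, h4, h5⟩ := (hboxes hT).1 h1
      obtain ⟨k2, h6, h7, h8⟩ := (hboxes hT).1 h2
      obtain ⟨rfl, rfl⟩ := DyckWord.cell_inj h5
      obtain ⟨rfl, -⟩ := DyckWord.cell_inj h8
      exact hT.2.2.2.1 k h3 (by omega)
    · intro hj
      obtain ⟨p, t, hT, h1, h2⟩ := h.exists_isTile (hj.trans_le (h.joint_le_gap k))
      have h3 : k ≠ p + 1 + t.len := by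
        rintro rfl
        have := hT.2.2.1
        omega
      exact ⟨t, (hmem t).2 ⟨p, j, hT⟩, (hboxes hT).2 ⟨k, h1, h2, rfl⟩,
        (hboxes hT).2 ⟨k + 1, by omega, by omega, rfl⟩⟩
  -- Both numbers are thresholds of the same predicate; testing it at each of them gives equality.
  have h1 := key (J k)
  have h2 := key (D.jointCount k)
  rw [D.joint_iff] at h1 h2
  omega

end TilingData

/-! ### The bijection between labels and tilings -/

namespace DyckTiling

variable {w : DyckWord}

theorem existsUnique_hasLabel (L : DecreasingLabel w) : ∃! D : DyckTiling w, D.HasLabel L := by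
  obtain ⟨b, J, h, hL⟩ := exists_tilingData w.hasUps L.isDecreasing
  obtain ⟨D, rfl, rfl⟩ := h.exists_dyckTiling
  refine ⟨D, (D.hasLabel_iff L).2 hL, fun D' hD' => ?_⟩
  obtain ⟨h1, h2⟩ := tilingData_unique w.hasUps L.isDecreasing D'.tilingData h
    ((D'.hasLabel_iff L).1 hD') hL
  exact eq_of_data h1 h2

theorem label_unique {D : DyckTiling w} {L L' : DecreasingLabel w} (h : D.HasLabel L)
    (h' : D.HasLabel L') : L = L' :=
  DecreasingLabel.code_injective fun e => (h e).trans (h' e).symm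

theorem contains312_of_not_isTrivial {D : DyckTiling w} {L : DecreasingLabel w}
    (h : D.HasLabel L) (hD : ¬ D.IsTrivial) : L.Contains312 := by
  rw [D.isTrivial_iff] at hD
  push Not at hD
  obtain ⟨k, hk⟩ := hD
  obtain ⟨f, e, g, hf, he, hg, h1, h2, h3, h4⟩ := exists_pattern_of_joint_pos w.hasUps
    L.isDecreasing D.tilingData ((D.hasLabel_iff L).1 h) (Nat.pos_of_ne_zero hk)
  obtain ⟨f, rfl⟩ := TreeEdge.exists_opening hf
  obtain ⟨e, rfl⟩ := TreeEdge.exists_opening he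
  obtain ⟨g, rfl⟩ := TreeEdge.exists_opening hg
  simp only [DecreasingLabel.wordLabel, TreeEdge.onSteps_opening] at h3 h4
  exact ⟨g, e, f, TreeEdge.strictlyLeft_iff_closedBefore.2 h2,
    TreeEdge.strictlyLeft_iff_closedBefore.2 h1, h3, h4⟩

theorem card_lineTiles {D : DyckTiling w} {L : DecreasingLabel w} (h : D.HasLabel L)
    (hD : D.IsTrivial) (e : TreeEdge w) : (D.lineTiles e.row).card = L.code e := by
  classical
  rw [h e, Finset.card_eq_sum_ones]
  refine Finset.sum_congr rfl fun t ht => ?_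
  unfold lineTiles at ht
  rw [DyckTile.weight, hD t (Finset.mem_filter.1 ht).1]

/-- The code of a tiling by single boxes is row monotone. -/
theorem rowMonotone_of_isTrivial {D : DyckTiling w} {L : DecreasingLabel w} (h : D.HasLabel L)
    (hD : D.IsTrivial) : DecreasingLabel.RowMonotone L.code := by
  have hJ : D.jointCount = fun _ => 0 := funext (D.isTrivial_iff.1 hD)
  -- Here `f` is the up step of the top path in the row of `e`. By `lineWt_trivial` the code entry
  -- is the distance between these up steps, so `leftCount - code` is the `x`-coordinate of `f`.
  have key : ∀ e : TreeEdge w, ∃ f : TreeEdge D.top, f.row = e.row ∧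
      e.leftCount = L.code e + (f.opening - f.row) ∧ f.row ≤ f.opening := by
    intro e
    obtain ⟨f, hf⟩ := TreeEdge.exists_row (w := D.top) (r := e.row)
      (by rw [D.semilength_top]; exact e.row_lt)
    have h1 := (D.hasLabel_iff L).1 h _ e.chord.1
    rw [L.wordCode_eq_code, hJ, TilingData.lineWt_trivial f.chord.1
      (by rw [← f.row_eq, hf, e.row_eq]; rfl)] at h1
    have h2 : f.opening ≤ e.opening := by
      rw [← DyckWord.upCount_le_row_iff e, ← hf, f.row_eq]
      exact D.above _
    have h3 := upCount_le (a := D.top.isUp) f.opening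
    rw [← f.row_eq] at h3
    refine ⟨f, hf, ?_, h3⟩
    rw [e.leftCount_eq]
    omega
  intro e f hef
  obtain ⟨e', h1, h2, h3⟩ := key e
  obtain ⟨f', h4, h5, h6⟩ := key f
  have hrow := TreeEdge.row_lt_row hef
  have h7 : e'.opening < f'.opening := TreeEdge.row_lt_row_iff.1 (by omega)
  have h8 : f'.row - e'.row ≤ f'.opening - e'.opening := by
    have h9 := upCount_shift D.top.isUp e'.opening (f'.opening - e'.opening)
    rw [show e'.opening + (f'.opening - e'.opening) = f'.opening by omega, ← f'.row_eq,
      ← e'.row_eq] at h9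
    have := upCount_le (a := fun k => D.top.isUp (e'.opening + k)) (f'.opening - e'.opening)
    omega
  omega

/-- A tiling with a row monotone code consists of single boxes. -/
theorem isTrivial_of_rowMonotone {D : DyckTiling w} {L : DecreasingLabel w} (h : D.HasLabel L)
    (hmono : DecreasingLabel.RowMonotone L.code) : D.IsTrivial := by
  classical
  -- The up step of the top path in the row of `e` is at the position `P e`.
  let P : TreeEdge w → ℕ := fun e => e.opening - L.code e
  have hcode : ∀ e : TreeEdge w, L.code e ≤ e.opening - e.row := fun e => by
    have := L.code_add_leftLarger e
    rw [e.leftCount_eq] at this; omega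
  have hrow : ∀ e : TreeEdge w, e.row ≤ e.opening := fun e => by
    rw [e.row_eq]; exact upCount_le _
  have hP : ∀ e f : TreeEdge w, e.opening < f.opening → P e < P f := by
    intro e f hef
    have h1 := hmono e f hef
    rw [e.leftCount_eq, f.leftCount_eq] at h1
    have h2 := TreeEdge.row_lt_row hef
    have h3 := hcode e
    have h4 := hcode f
    have h5 := hrow e
    have h6 := hrow f
    simp only [P]
    omega
  have hPiff : ∀ e f : TreeEdge w, P e < P f ↔ e.opening < f.opening := by
    intro e f
    refine ⟨fun h1 => ?_, hP e f⟩
    by_contra h2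
    rcases Nat.eq_or_lt_of_le (not_lt.1 h2) with h3 | h3
    · rw [TreeEdge.opening_injective h3] at h1; exact lt_irrefl _ h1
    · have := hP f e h3; omega
  have hPinj : Function.Injective P := fun e f h1 => TreeEdge.opening_injective (by
    have := hPiff e f; have := hPiff f e; omega)
  let b : ℕ → Bool := fun k => decide (∃ e : TreeEdge w, P e = k)
  have hbP : ∀ e, b (P e) = true := fun e => by simp [b]
  have hcount : ∀ k, upCount b k =
      (Finset.univ.filter fun e : TreeEdge w => P e < k).card := by
    intro k
    induction k with
    | zero => simp
    | succ k ih =>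
      rw [upCount_succ, ih]
      by_cases hk : ∃ e : TreeEdge w, P e = k
      · obtain ⟨e, rfl⟩ := hk
        rw [if_pos (hbP e), ← Finset.card_insert_of_notMem (a := e)
          (s := Finset.univ.filter fun f : TreeEdge w => P f < P e) (by simp)]
        congr 1
        ext f
        simp only [Finset.mem_insert, Finset.mem_filter, Finset.mem_univ, true_and,
          Nat.lt_succ_iff_lt_or_eq]
        rw [hPinj.eq_iff, or_comm]
      · rw [if_neg (by simpa [b] using hk), Nat.add_zero]
        congr 1
        ext f
        simp only [Finset.mem_filter, Finset.mem_univ, true_and, Nat.lt_succ_iff_lt_or_eq]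
        exact ⟨Or.inl, fun h1 => h1.resolve_right fun h2 => hk ⟨f, h2⟩⟩
  have hcountw : ∀ k, upCount w.isUp k =
      (Finset.univ.filter fun e : TreeEdge w => e.opening < k).card := by
    intro k
    have := TreeEdge.upCount_eq_card (w := w) k (fun _ => True) (fun _ => true) (by simp)
    simpa using this
  have hPrank : ∀ e, upCount b (P e) = upCount w.isUp e.opening := by
    intro e
    rw [hcount, hcountw]
    simp only [hPiff]
  have hdata : TilingData w.isUp b fun _ => 0 := by
    refine TilingData.of_trivial (fun k => ?_) ⟨w.toList.length, fun k hk => ?_⟩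
    · rw [hcount, hcountw]
      refine Finset.card_le_card fun e he => ?_
      simp only [Finset.mem_filter, Finset.mem_univ, true_and, P] at he ⊢
      omega
    · have hlt : ∀ e : TreeEdge w, e.opening < k := fun e =>
        (w.lt_length_of_isUp e.chord.1).trans_le hk
      refine ⟨w.isUp_of_ge hk, ?_, ?_⟩
      · simp only [b, decide_eq_false_iff_not, not_exists, P]
        intro e
        have := hlt e
        omega
      · rw [hcount, hcountw]
        congr 1
        ext e
        have := hlt e
        simp only [Finset.mem_filter, Finset.mem_univ, true_and, P]
        omega
  have hlabel : HasWordLabel w.isUp b (fun _ => 0) L.wordLabel := by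
    intro k hk
    obtain ⟨e, rfl⟩ := TreeEdge.exists_opening hk
    rw [L.wordCode_eq_code, TilingData.lineWt_trivial (hbP e) (by rw [hPrank]; rfl)]
    have h1 := hcode e
    have h2 := hrow e
    simp only [P]
    omega
  -- The region under the path with up steps `P e`, cut into single boxes, has the label `L` as
  -- well. Uniqueness leaves no joints in `D`.
  obtain ⟨-, hJ⟩ := tilingData_unique w.hasUps L.isDecreasing D.tilingData hdata
    ((D.hasLabel_iff L).1 h) hlabel
  exact D.isTrivial_iff.2 fun k => by rw [hJ]

end DyckTiling

/-! ### Evaluation of the determinant -/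

namespace LatticePath

/-- The sum of `q ^ (u₁ + ⋯ + uₘ)` over all chains `x ≤ u₁ ≤ ⋯ ≤ uₘ ≤ τ`. -/
noncomputable def chain (τ : ℤ) : ℕ → ℤ → ℤ[T;T⁻¹]
  | 0, x => if x ≤ τ then 1 else 0
  | m + 1, x => ∑ u ∈ Finset.Icc x τ, T u * chain τ m u

theorem chain_of_lt {τ x : ℤ} (h : τ < x) (m : ℕ) : chain τ m x = 0 := by
  cases m with
  | zero => rw [chain, if_neg (by omega)]
  | succ m => rw [chain, Finset.Icc_eq_empty (by omega), Finset.sum_empty]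

theorem chain_succ {τ x : ℤ} (h : x ≤ τ) (m : ℕ) :
    chain τ (m + 1) x = T x * chain τ m x + chain τ (m + 1) (x + 1) := by
  rw [chain, chain, ← Finset.insert_Icc_add_one_left_eq_Icc h, Finset.sum_insert (by simp)]

theorem sum_chain {τ σ x : ℤ} (h : τ ≤ σ) (m : ℕ) :
    ∑ u ∈ Finset.Icc x σ, T u * chain τ m u = chain τ (m + 1) x := by
  rw [chain]
  refine (Finset.sum_subset (Finset.Icc_subset_Icc_right h) fun u hu hu' => ?_).symm
  rw [Finset.mem_Icc] at hu hu'
  rw [chain_of_lt (by omega), mul_zero]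

/-- A path is given by the abscissas `u₁ ≤ ⋯ ≤ u_b` of its down steps. Since the weight drops by one
power of `q` per unit of height, summation by parts turns the exponent into the sum of the `uᵢ` plus
a term depending only on the end points. -/
theorem sum_rdPaths (τ : ℤ) (a b : ℕ) (y : ℤ) :
    ((rdPaths a b).map (rdWeight y)).sum =
      T ((y - b + 1) * τ - (y + 1) * (τ - a)) * chain τ b (τ - a) := by
  have hmapr : ∀ (l : List (List RDStep)) (y : ℤ),
      ((l.map (RDStep.right :: ·)).map (rdWeight y)).sum =
        T (y + 1) * (l.map (rdWeight y)).sum := by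
    intro l y
    rw [List.map_map, ← List.sum_map_mul_left]
    rfl
  have hmapd : ∀ (l : List (List RDStep)) (y : ℤ),
      ((l.map (RDStep.down :: ·)).map (rdWeight y)).sum = (l.map (rdWeight (y - 1))).sum := by
    intro l y
    rw [List.map_map]
    rfl
  induction a, b using rdPaths.induct generalizing y with
  | case1 => simp [rdPaths, rdWeight, chain]
  | case2 a ih =>
    rw [rdPaths, hmapr, ih, chain, chain, if_pos (by omega), if_pos (by omega), mul_one,
      mul_one, ← T_add]
    congr 1
    push_cast; ring
  | case3 b ih =>
    rw [rdPaths, hmapd, ih, chain_succ (by simp), chain_of_lt (x := τ - ((0 : ℕ) : ℤ) + 1) (by simp),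
      add_zero, ← mul_assoc, ← T_add]
    congr 2
    push_cast; ring
  | case4 a b ih1 ih2 =>
    rw [rdPaths, List.map_append, List.sum_append, hmapr, hmapd, ih1, ih2,
      chain_succ (x := τ - ((a + 1 : ℕ) : ℤ)) (by push_cast; omega), mul_add, ← mul_assoc,
      ← mul_assoc, ← T_add, ← T_add, add_comm]
    have h1 : τ - ((a + 1 : ℕ) : ℤ) + 1 = τ - a := by push_cast; ring
    rw [h1]
    congr 3
    · push_cast; ring
    · push_cast; ring

theorem rdWeightSum_eq (x y τ : ℤ) (m : ℕ) :
    rdWeightSum (x, y) (τ, y - m) = T ((y - m + 1) * τ - (y + 1) * x) * chain τ m x := by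
  unfold rdWeightSum
  by_cases h : x ≤ τ
  · rw [if_pos ⟨h, by simp⟩]
    have h1 : τ - (((τ - x).toNat : ℕ) : ℤ) = x := by omega
    have h2 : (y - (y - m)).toNat = m := by omega
    simp only [h2]
    rw [sum_rdPaths τ, h1]
  · rw [if_neg (fun h' => h h'.1), chain_of_lt (by omega), mul_zero]

theorem rdWeightSum_eq_zero {x y τ z : ℤ} (h : y < z) : rdWeightSum (x, y) (τ, z) = 0 := by
  unfold rdWeightSum
  rw [if_neg]
  rintro ⟨-, h'⟩
  simp only at h'
  omega

/-! ### Increasing sequences between bounds and a Hessenberg determinant -/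

variable (s t : ℕ → ℤ)

/-- The generating function of the sequences `u₀ < ⋯ < u_{b-1} < v` with `sᵢ ≤ uᵢ ≤ tᵢ`. -/
noncomputable def below : ℕ → ℤ → ℤ[T;T⁻¹]
  | 0, _ => 1
  | b + 1, v => ∑ u ∈ (Finset.Icc (s b) (t b)).filter (· < v), T u * below b u

/-- The generating function of the sequences `u₀ < ⋯ < u_{b-1}` with `sᵢ ≤ uᵢ ≤ tᵢ`. -/
noncomputable def total : ℕ → ℤ[T;T⁻¹]
  | 0 => 1
  | b + 1 => ∑ u ∈ Finset.Icc (s b) (t b), T u * below s t b u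

variable {s t} {n : ℕ}

/-- Summing over one more `u` lengthens each chain by one; monotonicity of `t` lets the sum up to `t
b` stop at `t a`. -/
theorem sum_alternating (ht : ∀ i j, i ≤ j → j < n → t i ≤ t j) {b : ℕ} (hb : b < n) {v : ℤ}
    (h : ∀ u, v ≤ u → u ≤ t b → below s t b u =
      ∑ a ∈ Finset.range (b + 1), (-1) ^ (b - a) * total s t a * chain (t a) (b - a) u) :
    ∑ u ∈ Finset.Icc v (t b), T u * below s t b u =
      ∑ a ∈ Finset.range (b + 1),
        (-1) ^ (b - a) * total s t a * chain (t a) (b + 1 - a) v := by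
  have h1 : ∀ u ∈ Finset.Icc v (t b), T u * below s t b u = ∑ a ∈ Finset.range (b + 1),
      (-1) ^ (b - a) * total s t a * (T u * chain (t a) (b - a) u) := by
    intro u hu
    rw [Finset.mem_Icc] at hu
    rw [h u hu.1 hu.2, Finset.mul_sum]
    exact Finset.sum_congr rfl fun a _ => by ring
  rw [Finset.sum_congr rfl h1, Finset.sum_comm]
  refine Finset.sum_congr rfl fun a ha => ?_
  have ha' : a ≤ b := by simpa [Nat.lt_succ_iff] using ha
  rw [← Finset.mul_sum, sum_chain (ht a b ha' hb), show b + 1 - a = b - a + 1 by omega]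

/-- Inclusion–exclusion on the last condition: sequences ending below `v` are all sequences minus
those whose last entry is at least `v`, and induction applies to the latter. The bound `v ≤ t b`
makes the term `a = b` equal to `total s t b`. -/
theorem below_eq (hs : ∀ i j, i ≤ j → j < n → s i ≤ s j) (ht : ∀ i j, i ≤ j → j < n → t i ≤ t j)
    {b : ℕ} (hb : b < n) {v : ℤ} (hv : ∀ c, b = c + 1 → s c ≤ v) (hvt : v ≤ t b) :
    below s t b v =
      ∑ a ∈ Finset.range (b + 1), (-1) ^ (b - a) * total s t a * chain (t a) (b - a) v := by
  induction b generalizing v with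
  | zero => simp [below, total, chain, hvt]
  | succ c ih =>
    have hv' := hv c rfl
    have h1 : ∑ u ∈ Finset.Icc v (t c), T u * below s t c u = _ :=
      sum_alternating (s := s) ht (by omega) fun u hu hu' => ih (by omega) (fun d hd => by
        have := hs d c (by omega) (by omega); omega) hu'
    have h2 : total s t (c + 1) = below s t (c + 1) v +
        ∑ u ∈ Finset.Icc v (t c), T u * below s t c u := by
      rw [total, below, ← Finset.sum_filter_add_sum_filter_not _ (· < v)]
      congr 2
      ext u
      simp only [Finset.mem_filter, Finset.mem_Icc, not_lt]
      omega
    rw [Finset.sum_range_succ, eq_sub_of_add_eq h2.symm, h1, Nat.sub_self, pow_zero, one_mul,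
      chain, if_pos hvt, mul_one, sub_eq_add_neg, add_comm, ← Finset.sum_neg_distrib]
    congr 1
    refine Finset.sum_congr rfl fun a ha => ?_
    have ha' : a ≤ c := by simpa [Nat.lt_succ_iff] using ha
    rw [show c + 1 - a = c - a + 1 by omega, pow_succ]
    ring

theorem total_succ (hs : ∀ i j, i ≤ j → j < n → s i ≤ s j)
    (ht : ∀ i j, i ≤ j → j < n → t i ≤ t j) {b : ℕ} (hb : b < n) :
    total s t (b + 1) = ∑ a ∈ Finset.range (b + 1),
      (-1) ^ (b - a) * total s t a * chain (t a) (b + 1 - a) (s b) := by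
  rw [total]
  refine sum_alternating ht hb fun u hu hu' => below_eq hs ht hb (fun c hc => ?_) hu'
  have := hs c b (by omega) hb
  omega

/-- The matrix of the chain generating functions. -/
noncomputable def chainMatrix (s t : ℕ → ℤ) (n : ℕ) : Matrix (Fin n) (Fin n) ℤ[T;T⁻¹] :=
  Matrix.of fun i j => if (j : ℕ) ≤ i + 1 then chain (t j) (i + 1 - j) (s i) else 0

/-- The recursion `total_succ` is a linear relation between the columns in every row but the last.
Adding the columns with coefficients `z` to column `0` leaves only the last entry there, and its
minor is lower triangular with ones on the diagonal. -/
theorem det_chainMatrix (hs : ∀ i j, i ≤ j → j < n → s i ≤ s j)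
    (ht : ∀ i j, i ≤ j → j < n → t i ≤ t j) (hst : ∀ i, i + 1 < n → s i ≤ t (i + 1)) :
    (chainMatrix s t n).det = total s t n := by
  cases n with
  | zero => simp [total]
  | succ N =>
    -- As `z 0 = 1`, replacing column `0` by this combination keeps the determinant.
    let z : Fin (N + 1) → ℤ[T;T⁻¹] := fun j => (-1) ^ (j : ℕ) * total s t j
    have hrow : ∀ i : Fin (N + 1), ∑ j, z j • chainMatrix s t (N + 1) i j =
        if i = Fin.last N then (-1) ^ N * total s t (N + 1) else 0 := by
      intro i
      have hsum : ∑ j, z j • chainMatrix s t (N + 1) i j = ∑ j ∈ Finset.range (N + 1),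
          (-1) ^ j * total s t j * (if j ≤ i + 1 then chain (t j) (i + 1 - j) (s i) else 0) := by
        rw [Finset.sum_range]; rfl
      have hhead : ∑ j ∈ Finset.range ((i : ℕ) + 1), (-1) ^ j * total s t j *
          (if j ≤ i + 1 then chain (t j) (i + 1 - j) (s i) else 0) =
          (-1) ^ (i : ℕ) * total s t (i + 1) := by
        rw [total_succ hs ht i.2, Finset.mul_sum]
        refine Finset.sum_congr rfl fun j hj => ?_
        have hj' : j ≤ i := by simpa [Nat.lt_succ_iff] using hj
        rw [if_pos (by omega), ← mul_assoc, ← mul_assoc, ← pow_add,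
          show (i : ℕ) + (i - j) = 2 * (i - j) + j by omega, pow_add, pow_mul]
        simp
      rw [hsum]
      by_cases hi : i = Fin.last N
      · rw [if_pos hi]
        have hiN : (i : ℕ) = N := by rw [hi]; rfl
        rw [hiN] at hhead ⊢
        exact hhead
      · rw [if_neg hi]
        have hiN : (i : ℕ) < N := by
          have := i.2
          have : (i : ℕ) ≠ N := fun h => hi (Fin.ext h)
          omega
        have hsub : Finset.range ((i : ℕ) + 2) ⊆ Finset.range (N + 1) :=
          Finset.range_mono (by omega)
        rw [← Finset.sum_subset hsub fun j _ hj => by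
          rw [if_neg (by simp at hj; omega), mul_zero], Finset.sum_range_succ, hhead,
          if_pos le_rfl, Nat.sub_self, chain, if_pos (hst i (by omega)), pow_succ]
        ring
    have hdet := Matrix.det_updateCol_sum (chainMatrix s t (N + 1)) 0 z
    have hz : z 0 = 1 := by simp [z, total]
    rw [hz, one_smul] at hdet
    rw [← hdet, Matrix.det_succ_column_zero, Finset.sum_eq_single (Fin.last N)]
    · rw [Matrix.updateCol_self, hrow, if_pos rfl]
      have htri : ((chainMatrix s t (N + 1)).updateCol 0 fun k =>
          ∑ i, z i • chainMatrix s t (N + 1) k i).submatrix (Fin.last N).succAbove Fin.succ =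
          Matrix.of fun i j : Fin N =>
            if (j : ℕ) ≤ i then chain (t (j + 1)) (i - j) (s i) else 0 := by
        ext i j
        rw [Matrix.submatrix_apply, Matrix.updateCol_ne (Fin.succ_ne_zero j),
          Fin.succAbove_last_apply]
        simp [chainMatrix]
      rw [htri, Matrix.det_of_isLowerTriangular]
      -- The cofactor sign `(-1) ^ N` cancels the sign of the remaining entry.
      · rw [Finset.prod_eq_one, mul_one, ← mul_assoc, ← pow_add]
        · simp
        · intro i _
          simp [chain, hst i (by omega)]
      · intro i j hij
        have : (i : ℕ) < j := hij
        simp only [Matrix.of_apply]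
        rw [if_neg (by omega)]
    · intro i _ hi
      rw [Matrix.updateCol_self, hrow, if_neg hi, mul_zero, zero_mul]
    · intro h
      exact absurd (Finset.mem_univ _) h

/-- The increasing sequences `u₀ < ⋯ < u_{b-1}` with `sᵢ ≤ uᵢ ≤ tᵢ`. -/
noncomputable def increasing (s t : ℕ → ℤ) (b : ℕ) : Finset (Fin b → ℤ) :=
  open Classical in (Fintype.piFinset fun i : Fin b => Finset.Icc (s i) (t i)).filter StrictMono

theorem mem_increasing {b : ℕ} {u : Fin b → ℤ} :
    u ∈ increasing s t b ↔ (∀ i : Fin b, s i ≤ u i ∧ u i ≤ t i) ∧ StrictMono u := by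
  simp [increasing]

theorem strictMono_snoc {b : ℕ} {u : Fin b → ℤ} {x : ℤ} :
    StrictMono (Fin.snoc u x : Fin (b + 1) → ℤ) ↔ StrictMono u ∧ ∀ i, u i < x := by
  constructor
  · intro h
    constructor
    · intro i j hij
      have := h (show i.castSucc < j.castSucc from hij)
      simpa using this
    · intro i
      have := h (Fin.castSucc_lt_last i)
      simpa using this
  · rintro ⟨h1, h2⟩ i j
    induction i using Fin.lastCases with
    | last => intro hij; exact absurd hij (not_lt.2 (Fin.le_last j))
    | cast i =>
      induction j using Fin.lastCases with
      | last => intro _; simpa using h2 i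
      | cast j => intro hij; simpa using h1 (show i < j from hij)

open Classical in
theorem sum_snoc {b : ℕ} (P : ℤ → Prop)
    (h : ∀ v, below s t b v =
      ∑ u ∈ (increasing s t b).filter (fun u => ∀ i, u i < v), ∏ i, T (u i)) :
    ∑ x ∈ (Finset.Icc (s b) (t b)).filter P, T x * below s t b x =
      ∑ u ∈ (increasing s t (b + 1)).filter (fun u => P (u (Fin.last b))), ∏ i, T (u i) := by
  simp_rw [h, Finset.mul_sum]
  rw [Finset.sum_sigma']
  refine Finset.sum_bij' (fun x _ => Fin.snoc x.2 x.1)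
    (fun u _ => ⟨u (Fin.last b), Fin.init u⟩) ?_ ?_ ?_ ?_ ?_
  · rintro ⟨x, u⟩ hx
    simp only [Finset.mem_sigma, Finset.mem_filter, Finset.mem_Icc, mem_increasing] at hx ⊢
    refine ⟨⟨fun i => ?_, strictMono_snoc.2 ⟨hx.2.1.2, hx.2.2⟩⟩, by simpa using hx.1.2⟩
    induction i using Fin.lastCases with
    | last => simpa using hx.1.1
    | cast i => simpa using hx.2.1.1 i
  · intro u hu
    simp only [Finset.mem_sigma, Finset.mem_filter, Finset.mem_Icc, mem_increasing] at hu ⊢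
    have h1 := hu.1.2
    rw [← Fin.snoc_init_self u] at h1
    obtain ⟨h2, h3⟩ := strictMono_snoc.1 h1
    exact ⟨⟨by simpa using hu.1.1 (Fin.last b), hu.2⟩,
      ⟨fun i => by simpa [Fin.init] using hu.1.1 i.castSucc, h2⟩, h3⟩
  · rintro ⟨x, u⟩ _
    simp
  · intro u _
    exact Fin.snoc_init_self u
  · rintro ⟨x, u⟩ _
    rw [Fin.prod_univ_castSucc, mul_comm]
    simp

open Classical in
theorem below_eq_sum (b : ℕ) (v : ℤ) : below s t b v =
    ∑ u ∈ (increasing s t b).filter (fun u => ∀ i, u i < v), ∏ i, T (u i) := by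
  induction b generalizing v with
  | zero =>
    have : (increasing s t 0).filter (fun u => ∀ i, u i < v) = {default} := by
      ext u
      simp only [Finset.mem_filter, mem_increasing, Finset.mem_singleton]
      exact ⟨fun _ => Subsingleton.elim _ _, fun _ => ⟨⟨fun i => i.elim0, fun i => i.elim0⟩,
        fun i => i.elim0⟩⟩
    rw [this, below]
    simp
  | succ b ih =>
    rw [below]
    have h1 := sum_snoc (s := s) (t := t) (· < v) fun v => ih v
    refine Eq.trans ?_ (h1.trans ?_)
    · exact Finset.sum_congr (Finset.ext fun _ => by simp) fun _ _ => rfl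
    · refine Finset.sum_congr (Finset.ext fun u => ?_) fun _ _ => rfl
      simp only [Finset.mem_filter]
      refine and_congr_right fun hu => ?_
      exact ⟨fun h i => lt_of_le_of_lt ((mem_increasing.1 hu).2.monotone (Fin.le_last i)) h,
        fun h => h _⟩

theorem total_eq_sum (b : ℕ) : total s t b = ∑ u ∈ increasing s t b, T (∑ i, u i) := by
  classical
  have hprod : ∀ (b : ℕ) (u : Fin b → ℤ), (∏ i, T (u i) : ℤ[T;T⁻¹]) = T (∑ i, u i) := by
    intro b u
    induction b with
    | zero => simp
    | succ b ih => rw [Fin.prod_univ_succ, Fin.sum_univ_succ, T_add, ih]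
  simp_rw [← hprod]
  cases b with
  | zero =>
    have := below_eq_sum (s := s) (t := t) 0 0
    rw [below] at this
    rw [total, this]
    refine Finset.sum_congr (Finset.filter_true_of_mem fun u _ i => i.elim0) fun _ _ => rfl
  | succ b =>
    have h1 := sum_snoc (s := s) (t := t) (fun _ => True) (below_eq_sum b)
    simp only [Finset.filter_true] at h1
    rw [total, h1]

/-- The determinant of the path generating functions. -/
theorem det_rdWeightSum (hs : ∀ i j, i ≤ j → j < n → s i ≤ s j)
    (ht : ∀ i j, i ≤ j → j < n → t i ≤ t j) (hst : ∀ i, i + 1 < n → s i ≤ t (i + 1)) :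
    (Matrix.of fun i j : Fin n =>
      rdWeightSum (s i, ((i : ℕ) : ℤ)) (t j, ((j : ℕ) : ℤ) - 1)).det =
      T (∑ i : Fin n, (((i : ℕ) : ℤ) * t i - (((i : ℕ) : ℤ) + 1) * s i)) *
        ∑ u ∈ increasing s t n, T (∑ i, u i) := by
  have hprod : ∀ (g : Fin n → ℤ), (∏ i, T (g i) : ℤ[T;T⁻¹]) = T (∑ i, g i) := by
    intro g
    induction (Finset.univ : Finset (Fin n)) using Finset.induction_on with
    | empty => simp
    | insert a S ha ih => rw [Finset.prod_insert ha, Finset.sum_insert ha, T_add, ih]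
  have hM : (Matrix.of fun i j : Fin n =>
      rdWeightSum (s i, ((i : ℕ) : ℤ)) (t j, ((j : ℕ) : ℤ) - 1)) =
      Matrix.of fun i j : Fin n => T (-((((i : ℕ) : ℤ) + 1) * s i)) *
        (Matrix.of fun i j : Fin n => T (((j : ℕ) : ℤ) * t j) * chainMatrix s t n i j) i j := by
    ext1 i j
    simp only [Matrix.of_apply, chainMatrix]
    split_ifs with h
    · have h1 := rdWeightSum_eq (s i) i (t j) (i + 1 - j)
      have h2 : (((i : ℕ) : ℤ) - ((i + 1 - j : ℕ) : ℤ)) = ((j : ℕ) : ℤ) - 1 := by omega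
      rw [h2] at h1
      rw [h1, ← mul_assoc, ← T_add]
      congr 2
      ring
    · rw [rdWeightSum_eq_zero (by omega), mul_zero, mul_zero]
  rw [hM, Matrix.det_mul_column, Matrix.det_mul_row, det_chainMatrix hs ht hst, total_eq_sum,
    ← mul_assoc, hprod, hprod, ← T_add, ← Finset.sum_add_distrib]
  exact congrArg₂ _ (congrArg T (Finset.sum_congr rfl fun i _ => by ring)) rfl

end LatticePath

/-! ### The determinant as a sum over labels -/

theorem DyckWord.upCol_mono (w : DyckWord) : Monotone w.upCol := by
  classical
  intro r r' h
  refine Finset.card_le_card fun j hj => ?_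
  rw [Finset.mem_filter] at hj ⊢
  exact ⟨hj.1, hj.2.1, hj.2.2.trans h⟩

theorem strictMono_iff_monotone_sub {n : ℕ} {u : Fin n → ℤ} :
    StrictMono u ↔ ∀ i j : Fin n, i < j → u i - ((i : ℕ) : ℤ) ≤ u j - ((j : ℕ) : ℤ) := by
  constructor
  · intro h i j hij
    obtain ⟨j, hj⟩ := j
    induction j with
    | zero => exact absurd hij (Nat.not_lt_zero _)
    | succ j ih =>
      have h1 : u ⟨j, by omega⟩ < u ⟨j + 1, hj⟩ := h (Fin.mk_lt_mk.2 (Nat.lt_succ_self j))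
      have hij' : (i : ℕ) < j + 1 := hij
      rcases Nat.lt_succ_iff_lt_or_eq.1 hij' with h2 | h2
      · have := ih (by omega) h2
        push_cast at this ⊢
        omega
      · rw [show i = ⟨j, by omega⟩ from Fin.ext h2]
        push_cast
        omega
  · intro h i j hij
    have := h i j hij
    have h2 : (i : ℕ) < j := hij
    omega

namespace TreeEdge

variable {w : DyckWord}

/-- The edges, numbered from the last up step to the first one. -/
noncomputable def ofTop (w : DyckWord) : Fin w.semilength ≃ TreeEdge w :=
  Fin.revPerm.trans (rowEquiv w).symm

theorem row_ofTop (i : Fin w.semilength) : (ofTop w i).row = w.semilength - 1 - i := by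
  have h : ((rowEquiv w (ofTop w i)) : ℕ) = w.semilength - 1 - i := by
    simp only [ofTop, Equiv.trans_apply, Equiv.apply_symm_apply, Fin.revPerm_apply, Fin.val_rev]
    omega
  exact h

theorem opening_ofTop_lt {i j : Fin w.semilength} :
    (ofTop w j).opening < (ofTop w i).opening ↔ i < j := by
  rw [← row_lt_row_iff, row_ofTop, row_ofTop, Fin.lt_def]
  omega

theorem leftCount_ofTop (i : Fin w.semilength) :
    ((ofTop w i).leftCount : ℤ) = DyckTiling.stepX w i := by
  rw [DyckTiling.stepX, ← row_ofTop, DyckWord.upCol_row, leftCount_eq]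

end TreeEdge

namespace DyckTiling

variable {w : DyckWord} {D : DyckTiling w} {L₀ : DecreasingLabel w}

theorem source_eq (w : DyckWord) (i : ℕ) :
    source w i = ((i : ℤ) + stepX w 0 - stepX w i, (i : ℤ)) := by
  induction i with
  | zero => simp [source]
  | succ i ih =>
    rw [source, ih]
    ext
    · simp only [Prod.fst_add]
      push_cast
      ring
    · simp

theorem sink_eq (D : DyckTiling w) (i : ℕ) :
    D.sink i = ((i : ℤ) + stepX w 0 - stepX w i + D.stepTiles i, (i : ℤ) - 1) := by
  rw [sink, source_eq]
  ext <;> simp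

theorem stepX_antitone {i j : ℕ} (h : i ≤ j) : stepX w j ≤ stepX w i := by
  unfold stepX
  exact_mod_cast w.upCol_mono (by omega)

theorem stepTiles_eq (h : D.HasLabel L₀) (hD : D.IsTrivial) (i : Fin w.semilength) :
    D.stepTiles i = L₀.code (TreeEdge.ofTop w i) := by
  rw [stepTiles, ← TreeEdge.row_ofTop, card_lineTiles h hD]

/-- Up steps are numbered from the top, against pre-order, so `code - leftCount` increases weakly
with `i`; the summand `i` makes the sequence strict. -/
theorem rowMonotone_iff_strictMono {c : TreeEdge w → ℕ} :
    DecreasingLabel.RowMonotone c ↔ StrictMono fun i : Fin w.semilength =>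
      ((i : ℕ) : ℤ) + stepX w 0 - stepX w i + c (TreeEdge.ofTop w i) := by
  rw [strictMono_iff_monotone_sub]
  constructor
  · intro h i j hij
    have := h _ _ (TreeEdge.opening_ofTop_lt.2 hij)
    zify at this
    rw [TreeEdge.leftCount_ofTop, TreeEdge.leftCount_ofTop] at this
    omega
  · intro h e f hef
    obtain ⟨j, rfl⟩ := (TreeEdge.ofTop w).surjective e
    obtain ⟨i, rfl⟩ := (TreeEdge.ofTop w).surjective f
    have := h i j (TreeEdge.opening_ofTop_lt.1 hef)
    zify
    rw [TreeEdge.leftCount_ofTop, TreeEdge.leftCount_ofTop]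
    omega

open Classical in
/-- The determinant is the generating function of the labels above `L₀` with a monotone code. -/
theorem Y_eq (hL₀ : ¬ L₀.Contains312) (h : D.HasLabel L₀) (hD : D.IsTrivial) :
    D.Y = ∑ L ∈ Finset.univ.filter (fun L : DecreasingLabel w =>
      L₀.Le L ∧ DecreasingLabel.RowMonotone L.code), T (L.inv : ℤ) := by
  set s : ℕ → ℤ := fun i => (i : ℤ) + stepX w 0 - stepX w i with hsdef
  set t : ℕ → ℤ := fun i => s i + D.stepTiles i with htdef
  have hs : ∀ i j, i ≤ j → j < w.semilength → s i ≤ s j := by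
    intro i j hij _
    have := stepX_antitone (w := w) hij
    simp only [hsdef]
    omega
  -- The upper bounds are increasing because the tiling is trivial and its code is therefore row
  -- monotone.
  have ht' : StrictMono fun i : Fin w.semilength => t i := by
    have := rowMonotone_iff_strictMono.1 (rowMonotone_of_isTrivial h hD)
    simpa only [htdef, stepTiles_eq h hD] using this
  have ht : ∀ i j, i ≤ j → j < w.semilength → t i ≤ t j := fun i j hij hj =>
    ht'.monotone (show (⟨i, by omega⟩ : Fin w.semilength) ≤ ⟨j, hj⟩ from hij)
  have hst : ∀ i, i + 1 < w.semilength → s i ≤ t (i + 1) := fun i hi =>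
    (hs i (i + 1) (by omega) hi).trans (by simp [htdef])
  have hdet := LatticePath.det_rdWeightSum hs ht hst
  have hmat : (Matrix.of fun i j : Fin w.semilength => rdWeightSum (source w i) (D.sink j)) =
      Matrix.of fun i j : Fin w.semilength =>
        rdWeightSum (s i, ((i : ℕ) : ℤ)) (t j, ((j : ℕ) : ℤ) - 1) := by
    ext1 i j
    rw [Matrix.of_apply, Matrix.of_apply, source_eq, sink_eq]
  rw [Y, hmat, hdet, ← mul_assoc, ← T_add, Finset.mul_sum]
  symm
  -- The values land in the bounds by `code_le_of_le`, determine the label by `code_injective`, and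
  -- are all reached by `exists_le_code_eq`.
  refine Finset.sum_bij (fun L _ i => s i + L.code (TreeEdge.ofTop w i)) ?_ ?_ ?_ ?_
  · intro L hL
    obtain ⟨hle, hmono⟩ := (Finset.mem_filter.1 hL).2
    refine LatticePath.mem_increasing.2 ⟨fun i => ⟨by simp, ?_⟩,
      rowMonotone_iff_strictMono.1 hmono⟩
    have := DecreasingLabel.code_le_of_le hL₀ hle (TreeEdge.ofTop w i)
    simp only [htdef, stepTiles_eq h hD]
    omega
  · intro L _ L' _ hLL
    refine DecreasingLabel.code_injective fun e => ?_
    obtain ⟨i, rfl⟩ := (TreeEdge.ofTop w).surjective e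
    have := congrFun hLL i
    simpa using this
  · intro u hu
    obtain ⟨hb, hmono⟩ := LatticePath.mem_increasing.1 hu
    have hc : ∀ i : Fin w.semilength, s i +
        (((u ((TreeEdge.ofTop w).symm (TreeEdge.ofTop w i)) -
          s ((TreeEdge.ofTop w).symm (TreeEdge.ofTop w i))).toNat : ℕ) : ℤ) = u i := by
      intro i
      have := (hb i).1
      rw [Equiv.symm_apply_apply]
      omega
    obtain ⟨L, hle, hL⟩ := L₀.exists_le_code_eq (c := fun e =>
      (u ((TreeEdge.ofTop w).symm e) - s ((TreeEdge.ofTop w).symm e)).toNat)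
      (rowMonotone_iff_strictMono.2 (by
        rw [show (fun i : Fin w.semilength => _) = u from funext hc]
        exact hmono)) (by
        intro e
        obtain ⟨i, rfl⟩ := (TreeEdge.ofTop w).surjective e
        have h1 := (hb i).2
        simp only [htdef, stepTiles_eq h hD] at h1
        rw [Equiv.symm_apply_apply]
        omega)
    refine ⟨L, ?_, ?_⟩
    · rw [Finset.mem_filter]
      refine ⟨Finset.mem_univ _, hle, rowMonotone_iff_strictMono.2 ?_⟩
      simp only [hL]
      rw [show (fun i : Fin w.semilength => _) = u from funext hc]
      exact hmono
    · funext i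
      simp only [hL]
      exact hc i
  · intro L hL
    -- With `t i = s i + μ i`, the exponent at `i` is `-i * μ i + i * t i - (i + 1) * s i + u i = u
    -- i - s i`, the code entry.
    rw [← T_add]
    congr 1
    rw [DecreasingLabel.inv, ← (TreeEdge.ofTop w).sum_comp, ← Finset.sum_neg_distrib,
      ← Finset.sum_add_distrib, ← Finset.sum_add_distrib]
    push_cast
    refine Finset.sum_congr rfl fun i _ => ?_
    simp only [htdef]
    ring

open Classical in
theorem W_eq (hL₀ : ¬ L₀.Contains312) (h : D.HasLabel L₀) (hD : D.IsTrivial) :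
    W L₀ D = ∑ L ∈ Finset.univ.filter (fun L : DecreasingLabel w =>
      L₀.Le L ∧ ¬ DecreasingLabel.RowMonotone L.code), T (L.inv : ℤ) := by
  rw [W, Y_eq hL₀ h hD, DecreasingLabel.Z, sub_eq_iff_eq_add', ← Finset.filter_filter,
    ← Finset.filter_filter, Finset.sum_filter_add_sum_filter_not]

/-! ### The non-trivial tilings above a label -/

/-- The tiling with a given label. -/
noncomputable def ofLabel (L : DecreasingLabel w) : DyckTiling w :=
  (existsUnique_hasLabel L).choose

theorem ofLabel_hasLabel (L : DecreasingLabel w) : (ofLabel L).HasLabel L :=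
  (existsUnique_hasLabel L).choose_spec.1

theorem eq_ofLabel {L : DecreasingLabel w} (h : D.HasLabel L) : D = ofLabel L :=
  (existsUnique_hasLabel L).choose_spec.2 D h

theorem ofLabel_injective : Function.Injective (ofLabel (w := w)) := fun L L' h =>
  label_unique (ofLabel_hasLabel L) (h ▸ ofLabel_hasLabel L')

theorem isTrivial_ofLabel_iff (L : DecreasingLabel w) :
    (ofLabel L).IsTrivial ↔ DecreasingLabel.RowMonotone L.code :=
  ⟨rowMonotone_of_isTrivial (ofLabel_hasLabel L), isTrivial_of_rowMonotone (ofLabel_hasLabel L)⟩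

open Classical in
theorem nontrivialAbove_eq (L₀ : DecreasingLabel w) :
    nontrivialAbove L₀ = ((Finset.univ.filter (fun L : DecreasingLabel w =>
      L₀.Le L ∧ ¬ DecreasingLabel.RowMonotone L.code)).image ofLabel : Finset (DyckTiling w)) := by
  ext D
  rw [Finset.mem_coe, Finset.mem_image]
  constructor
  · rintro ⟨hD, L, hL, hle⟩
    rw [eq_ofLabel hL, isTrivial_ofLabel_iff] at hD
    exact ⟨L, by simp [hle, hD], (eq_ofLabel hL).symm⟩
  · rintro ⟨L, hL, rfl⟩
    obtain ⟨hle, hmono⟩ := (Finset.mem_filter.1 hL).2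
    exact ⟨mt (isTrivial_ofLabel_iff L).1 hmono, L, ofLabel_hasLabel L, hle⟩

end DyckTiling

theorem mainTheorem9 (w : DyckWord) (L₀ : DecreasingLabel w) (hL₀ : ¬ L₀.Contains312) :
    (∃! D₀ : DyckTiling w, D₀.HasLabel L₀) ∧
    ∀ D₀ : DyckTiling w, D₀.HasLabel L₀ →
      D₀.IsTrivial ∧
      (∃ P : Polynomial ℕ,
        DyckTiling.W L₀ D₀ = Polynomial.toLaurent (P.map (Nat.castRingHom ℤ))) ∧
      (DyckTiling.nontrivialAbove L₀).Finite ∧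
      DyckTiling.W L₀ D₀ =
        ∑ᶠ D ∈ DyckTiling.nontrivialAbove L₀, LaurentPolynomial.T (D.weight : ℤ) ∧
      ∀ D ∈ DyckTiling.nontrivialAbove L₀, ∀ L : DecreasingLabel w,
        D.HasLabel L → L.Contains312 := by
  classical
  refine ⟨DyckTiling.existsUnique_hasLabel L₀, fun D₀ h => ?_⟩
  -- A non-trivial tile would put a `312`-pattern into `L₀`.
  have hD₀ : D₀.IsTrivial :=
    not_not.1 fun hD => hL₀ (DyckTiling.contains312_of_not_isTrivial h hD)
  refine ⟨hD₀, ⟨∑ L ∈ Finset.univ.filter (fun L : DecreasingLabel w =>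
      L₀.Le L ∧ ¬ DecreasingLabel.RowMonotone L.code), Polynomial.X ^ L.inv, ?_⟩, ?_, ?_,
    fun D hD L hL => DyckTiling.contains312_of_not_isTrivial hL hD.1⟩
  · rw [DyckTiling.W_eq hL₀ h hD₀, Polynomial.map_sum, map_sum]
    simp
  · rw [DyckTiling.nontrivialAbove_eq]
    exact Finset.finite_toSet _
  · rw [DyckTiling.nontrivialAbove_eq, finsum_mem_coe_finset,
      Finset.sum_image DyckTiling.ofLabel_injective.injOn, DyckTiling.W_eq hL₀ h hD₀]
    refine Finset.sum_congr rfl fun L _ => ?_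
    rw [DyckTiling.weight_eq_inv _ (DyckTiling.ofLabel_hasLabel L)]
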